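/- **Theorem.** Let $\mathbb T=\mathbb R/2\pi\mathbb Z$ and $\Pi=(0,1)\times\mathbb T$ with variables $(\psi,\theta)$; all functions are complex valued, derivatives are weak derivatives, $L^2$ norms are taken with respect to $d\theta/2\pi$ and $d\psi\,d\theta/2\pi$, and $\hat a_k$ denotes the $k$-th Fourier coefficient in $\theta$. For $s\ge 0$, $\sigma\ge 0$ let $X^s_\sigma(\mathbb T)$ be the space of functions on $\mathbb T$ with $$\|a\|_{X^s_\sigma}^2=\sum_{k\in\mathbb Z}(1+k^2)^s e^{2\sigma|k|}|\hat a_k|^2<\infty .$$ For an integer $m\ge 0$ and $\gamma\in\mathbb R$ let $K^m_\gamma(\Pi)$ be the space of functions on $\Pi$ with $$\|u\|_{K^m_\gamma}^2=\sum_{p+q\le m}\|\psi^{p-\gamma}\partial_\psi^p\partial_\theta^q u\|_{L^2(\Pi)}^2<\infty ,$$ and let $K^{m,\sigma}_\gamma(\Pi)$ be the space of $u\in K^m_\gamma(\Pi)$ for which $e^{\sigma|D_\theta|}u:=\sum_k e^{\sigma|k|}\hat u_k(\psi)e^{ik\theta}$ also lies in $K^m_\gamma(\Pi)$, with norm $\|u\|_{K^{m,\sigma}_\gamma}=\|e^{\sigma|D_\theta|}u\|_{K^m_\gamma}$.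 Let $$J^{m,\sigma}_{\lambda,\gamma}(\Pi)=\{v(\theta)\psi^\lambda+w(\psi,\theta): v\in X^m_\sigma(\mathbb T),\ w\in K^{m,\sigma}_{\lambda+\gamma}(\Pi)\}$$ with the norm of the direct sum $X^m_\sigma(\mathbb T)\oplus K^{m,\sigma}_{\lambda+\gamma}(\Pi)$, and let $\widetilde J^{m,\sigma}_{0,\gamma}(\Pi)$ be the subspace of those $v+w\in J^{m,\sigma}_{0,\gamma}(\Pi)$ with $\int_{\mathbb T}v(\theta)e^{\pm2i\theta}\,d\theta=0$. Let $m\ge2$ be an integer, $\sigma>0$ and $1/2<\gamma<1$. Then in $J^{m,\sigma}_{1/2,\gamma}(\Pi)$ and in $J^{m-2,\sigma}_{0,\gamma}(\Pi)$ a function determines its components $v$ and $w$; the spaces $J^{m,\sigma}_{1/2,\gamma}(\Pi)$, $\widetilde J^{m-2,\sigma}_{0,\gamma}(\Pi)$ and $X^{m-1/2}_\sigma(\mathbb T)$ are complete; and the linear problem $$\begin{cases}\psi^{-1/2}\bigl[\psi^2\partial_\psi^2+2\psi\,\partial_\psi+\tfrac14(I+\partial_\theta^2)\bigr]u(\psi,\theta)=f(\psi,\theta)&\text{in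 }\Pi,\\[2pt] R+\tfrac{p_x-ip_y}{2}e^{i\theta}+\tfrac{p_x+ip_y}{2}e^{-i\theta}+u(1,\theta)=g(\theta)&\text{on }\mathbb T,\end{cases}$$ where $u(1,\cdot)$ is the boundary value of the representative of $u$ that is continuous on $(0,1]\times\mathbb T$, defines a Banach space isomorphism (a linear bijection, bounded with bounded inverse) $(R,p_x,p_y,u)\mapsto(f,g)$, $$\mathbb C^3\times J^{m,\sigma}_{1/2,\gamma}(\Pi)\;\longrightarrow\;\widetilde J^{m-2,\sigma}_{0,\gamma}(\Pi)\times X^{m-1/2}_\sigma(\mathbb T).$$ -/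

import Mathlib

open Real MeasureTheory Set AddCircle
open scoped ENNReal ContDiff

noncomputable section

namespace FlowLines

instance factTwoPiPos : Fact (0 < 2 * π) := ⟨Real.two_pi_pos⟩

/-- The circle `ℝ / 2πℤ`. Its reference measure below is `haarAddCircle`, that is `dθ / 2π`, and
`fourier k θ = exp (i k θ)`. -/
abbrev Circ : Type := AddCircle (2 * π)

/-- The measure `dψ dθ / 2π` on `Π = (0, 1) × 𝕋`. -/
def piMeasure : Measure (ℝ × Circ) :=
  (volume.restrict (Ioo (0 : ℝ) 1)).prod haarAddCircle

/-- The measure `ψ ^ (-2γ) dψ dθ / 2π` on `Π`, for which the norm of `L²` is `‖ψ ^ (-γ) u‖_{L²(Π)}`. -/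
def weightedMeasure (γ : ℝ) : Measure (ℝ × Circ) :=
  piMeasure.withDensity fun z => ENNReal.ofReal (z.1 ^ (-2 * γ))

/-! ### Functions on the circle -/

/-- The weighted Fourier coefficients `(1 + k²) ^ (s / 2) * exp (σ |k|) * â_k`. -/
def xCoeff (s σ : ℝ) (a : Lp ℂ 2 (haarAddCircle (T := 2 * π))) (k : ℤ) : ℂ :=
  (((1 + (k : ℝ) ^ 2) ^ (s / 2) * Real.exp (σ * |(k : ℝ)|) : ℝ) : ℂ) * fourierCoeff a k

theorem xCoeff_eq_repr (s σ : ℝ) (a : Lp ℂ 2 (haarAddCircle (T := 2 * π))) (k : ℤ) :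
    xCoeff s σ a k = (((1 + (k : ℝ) ^ 2) ^ (s / 2) * Real.exp (σ * |(k : ℝ)|) : ℝ) : ℂ) *
      fourierBasis.repr a k := by
  rw [xCoeff, fourierBasis_repr]

theorem xCoeff_add (s σ : ℝ) (a b : Lp ℂ 2 (haarAddCircle (T := 2 * π))) :
    xCoeff s σ (a + b) = xCoeff s σ a + xCoeff s σ b := by
  ext k
  simp only [xCoeff_eq_repr, map_add, Pi.add_apply, lp.coeFn_add, mul_add]

theorem xCoeff_smul (s σ : ℝ) (c : ℂ) (a : Lp ℂ 2 (haarAddCircle (T := 2 * π))) :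
    xCoeff s σ (c • a) = c • xCoeff s σ a := by
  ext k
  simp only [xCoeff_eq_repr, map_smul, Pi.smul_apply, lp.coeFn_smul, smul_eq_mul]
  ring

theorem xCoeff_injective (s σ : ℝ) : Function.Injective (xCoeff s σ) := by
  intro a b h
  apply fourierBasis.repr.injective
  ext k
  have hk := congrFun h k
  rw [xCoeff_eq_repr, xCoeff_eq_repr] at hk
  refine mul_left_cancel₀ ?_ hk
  have : (0 : ℝ) < (1 + (k : ℝ) ^ 2) ^ (s / 2) * Real.exp (σ * |(k : ℝ)|) := by positivity
  exact_mod_cast this.ne'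

/-- The functions on the circle with
`∑ₖ (1 + k²) ^ s * exp (2 σ |k|) * |â_k|² < ∞` (used for `s ≥ 0` and `σ ≥ 0`). -/
def xSubmodule (s σ : ℝ) : Submodule ℂ (Lp ℂ 2 (haarAddCircle (T := 2 * π))) where
  carrier := {a | Memℓp (xCoeff s σ a) 2}
  add_mem' {a b} ha hb := by
    simp only [mem_ofPred_eq, xCoeff_add] at *
    exact ha.add hb
  zero_mem' := by
    have h : xCoeff s σ 0 = 0 := by simpa using xCoeff_smul s σ 0 0
    simp only [mem_ofPred_eq, h]
    exact zero_memℓp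
  smul_mem' c a ha := by
    simp only [mem_ofPred_eq, xCoeff_smul] at *
    exact ha.const_smul c

/-- The space `X^s_σ(𝕋)`; `X^s_0(𝕋)` is the Sobolev space `H^s(𝕋)`. -/
def X (s σ : ℝ) : Type := xSubmodule s σ

namespace X

variable {s σ : ℝ}

instance : AddCommGroup (X s σ) := inferInstanceAs (AddCommGroup (xSubmodule s σ))
instance : Module ℂ (X s σ) := inferInstanceAs (Module ℂ (xSubmodule s σ))

/-- The underlying function on the circle. -/
def toFun (a : X s σ) : Circ → ℂ := a.1

/-- The sequence of weighted Fourier coefficients. -/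
def coeffs : X s σ →ₗ[ℂ] lp (fun _ : ℤ => ℂ) 2 where
  toFun a := ⟨xCoeff s σ a.1, a.2⟩
  map_add' a b := Subtype.ext (xCoeff_add s σ a.1 b.1)
  map_smul' c a := Subtype.ext (xCoeff_smul s σ c a.1)

theorem coeffs_injective : Function.Injective (coeffs (s := s) (σ := σ)) := fun _ _ h =>
  Subtype.ext (xCoeff_injective s σ (congrArg Subtype.val h))

/-- `‖a‖² = ∑ₖ (1 + k²) ^ s * exp (2 σ |k|) * |â_k|²`. -/
instance : NormedAddCommGroup (X s σ) :=
  NormedAddCommGroup.induced (X s σ) (lp (fun _ : ℤ => ℂ) 2) coeffs coeffs_injective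

instance : NormedSpace ℂ (X s σ) := NormedSpace.induced ℂ (X s σ) (lp (fun _ : ℤ => ℂ) 2) coeffs

end X

/-! ### Weak derivatives on `Π` -/

/-- Smooth functions on `(0, 1) × 𝕋` with compact support. -/
structure IsTest (φ : ℝ × Circ → ℂ) : Prop where
  smooth : ContDiff ℝ ∞ fun z : ℝ × ℝ => φ (z.1, (z.2 : Circ))
  support : ∃ a b : ℝ, 0 < a ∧ b < 1 ∧ ∀ z, φ z ≠ 0 → z.1 ∈ Icc a b

/-- The classical derivative `∂_ψ`. -/
def dPsi (φ : ℝ × Circ → ℂ) (z : ℝ × Circ) : ℂ := deriv (fun r : ℝ => φ (r, z.2)) z.1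

/-- The classical derivative `∂_θ`. -/
def dTheta (φ : ℝ × Circ → ℂ) (z : ℝ × Circ) : ℂ :=
  deriv (fun t : ℝ => φ (z.1, z.2 + (t : Circ))) 0

/-- `u` is integrable on `[a, b] × 𝕋` whenever `0 < a` and `b < 1`. -/
def LocInt (u : ℝ × Circ → ℂ) : Prop :=
  ∀ a b : ℝ, 0 < a → b < 1 → IntegrableOn u (Icc a b ×ˢ univ) piMeasure

/-- `d = ∂_ψ^p ∂_θ^q u` on `(0, 1) × 𝕋` in the sense of distributions. -/
def IsWeakDeriv (p q : ℕ) (u d : ℝ × Circ → ℂ) : Prop :=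
  LocInt u ∧ LocInt d ∧ ∀ φ, IsTest φ →
    ∫ z, u z * (dPsi^[p] (dTheta^[q] φ)) z ∂piMeasure =
      (-1) ^ (p + q) * ∫ z, d z * φ z ∂piMeasure

theorem IsTest.dPsi {φ : ℝ × Circ → ℂ} (h : IsTest φ) : IsTest (dPsi φ) := by
  obtain ⟨hs, a, b, ha, hb, hab⟩ := h
  refine ⟨?_, a, b, ha, hb, ?_⟩
  · set f : ℝ × ℝ → ℂ := fun z => φ (z.1, (z.2 : Circ)) with hf
    have h1 : (fun z : ℝ × ℝ => FlowLines.dPsi φ (z.1, (z.2 : Circ))) =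
        fun z => fderiv ℝ f z (1, 0) := by
      ext z
      have hd : HasFDerivAt f (fderiv ℝ f z) z :=
        (hs.differentiable (by simp)).differentiableAt.hasFDerivAt
      have hg : HasDerivAt (fun r : ℝ => (r, z.2)) ((1 : ℝ), (0 : ℝ)) z.1 :=
        (hasDerivAt_id z.1).prodMk (hasDerivAt_const z.1 z.2)
      exact (HasFDerivAt.comp_hasDerivAt z.1 (f := fun r : ℝ => (r, z.2)) hd hg).deriv
    rw [h1]
    exact (hs.fderiv_right (m := ∞) (by simp)).clm_apply contDiff_const
  · intro z hz
    by_contra hn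
    apply hz
    have : (fun r : ℝ => φ (r, z.2)) =ᶠ[nhds z.1] fun _ => 0 := by
      filter_upwards [isClosed_Icc.isOpen_compl.mem_nhds hn] with r hr
      by_contra h0
      exact hr (hab (r, z.2) h0)
    rw [FlowLines.dPsi, this.deriv_eq, deriv_const]

theorem IsTest.dTheta {φ : ℝ × Circ → ℂ} (h : IsTest φ) : IsTest (dTheta φ) := by
  obtain ⟨hs, a, b, ha, hb, hab⟩ := h
  refine ⟨?_, a, b, ha, hb, ?_⟩
  · set f : ℝ × ℝ → ℂ := fun z => φ (z.1, (z.2 : Circ)) with hf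
    have h1 : (fun z : ℝ × ℝ => FlowLines.dTheta φ (z.1, (z.2 : Circ))) =
        fun z => fderiv ℝ f z (0, 1) := by
      ext z
      have hd : HasFDerivAt f (fderiv ℝ f z) (z.1, z.2 + 0) := by
        rw [add_zero]
        exact (hs.differentiable (by simp)).differentiableAt.hasFDerivAt
      have hg : HasDerivAt (fun t : ℝ => (z.1, z.2 + t)) ((0 : ℝ), (1 : ℝ)) 0 :=
        (hasDerivAt_const 0 z.1).prodMk ((hasDerivAt_id (0 : ℝ)).const_add z.2)
      have := (HasFDerivAt.comp_hasDerivAt 0 (f := fun t : ℝ => (z.1, z.2 + t)) hd hg).deriv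
      rw [← this]
      simp [FlowLines.dTheta, hf, Function.comp_def]
    rw [h1]
    exact (hs.fderiv_right (m := ∞) (by simp)).clm_apply contDiff_const
  · intro z hz
    by_contra hn
    apply hz
    have : (fun t : ℝ => φ (z.1, z.2 + (t : Circ))) = fun _ => 0 := by
      ext t
      by_contra h0
      exact hn (hab (z.1, z.2 + (t : Circ)) h0)
    rw [FlowLines.dTheta, this, deriv_const]

theorem IsTest.iterate {φ : ℝ × Circ → ℂ} (h : IsTest φ) (p q : ℕ) :
    IsTest (FlowLines.dPsi^[p] (FlowLines.dTheta^[q] φ)) := by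
  have h1 : IsTest (FlowLines.dTheta^[q] φ) := by
    induction q with
    | zero => exact h
    | succ q ih => rw [Function.iterate_succ_apply']; exact ih.dTheta
  induction p with
  | zero => exact h1
  | succ p ih => rw [Function.iterate_succ_apply']; exact ih.dPsi

theorem IsTest.continuous {φ : ℝ × Circ → ℂ} (h : IsTest φ) : Continuous φ := by
  have hq : IsOpenQuotientMap (fun z : ℝ × ℝ => (z.1, (z.2 : Circ))) :=
    IsOpenQuotientMap.id.prodMap QuotientAddGroup.isOpenQuotientMap_mk
  exact hq.isQuotientMap.continuous_iff.2 h.smooth.continuous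

theorem LocInt.integrable_mul {u φ : ℝ × Circ → ℂ} (hu : LocInt u) (h : IsTest φ) :
    Integrable (fun z => u z * φ z) piMeasure := by
  obtain ⟨a, b, ha, hb, hab⟩ := h.support
  have hc : IsCompact (Icc a b ×ˢ (univ : Set Circ)) := isCompact_Icc.prod isCompact_univ
  have h1 : IntegrableOn (fun z => u z * φ z) (Icc a b ×ˢ univ) piMeasure :=
    (hu a b ha hb).mul_continuousOn h.continuous.continuousOn hc
  rw [← integrableOn_univ]
  refine h1.of_forall_sdiff_eq_zero MeasurableSet.univ fun z hz => ?_
  have : φ z = 0 := by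
    by_contra h0
    exact hz.2 ⟨hab z h0, mem_univ _⟩
  simp [this]

theorem LocInt.congr {u v : ℝ × Circ → ℂ} (hu : LocInt u) (h : u =ᵐ[piMeasure] v) : LocInt v :=
  fun a b ha hb => (hu a b ha hb).congr (ae_restrict_of_ae h)

theorem IsWeakDeriv.congr {p q : ℕ} {u v d e : ℝ × Circ → ℂ} (h : IsWeakDeriv p q u d)
    (huv : u =ᵐ[piMeasure] v) (hde : d =ᵐ[piMeasure] e) : IsWeakDeriv p q v e := by
  refine ⟨h.1.congr huv, h.2.1.congr hde, fun φ hφ => ?_⟩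
  have h1 : (fun z => v z * (FlowLines.dPsi^[p] (FlowLines.dTheta^[q] φ)) z) =ᵐ[piMeasure]
      fun z => u z * (FlowLines.dPsi^[p] (FlowLines.dTheta^[q] φ)) z := by
    filter_upwards [huv] with z hz
    rw [hz]
  have h2 : (fun z => e z * φ z) =ᵐ[piMeasure] fun z => d z * φ z := by
    filter_upwards [hde] with z hz
    rw [hz]
  rw [integral_congr_ae h1, integral_congr_ae h2, h.2.2 φ hφ]

theorem IsWeakDeriv.add {p q : ℕ} {u v d e : ℝ × Circ → ℂ} (h : IsWeakDeriv p q u d)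
    (h' : IsWeakDeriv p q v e) : IsWeakDeriv p q (u + v) (d + e) := by
  refine ⟨fun a b ha hb => (h.1 a b ha hb).add (h'.1 a b ha hb),
    fun a b ha hb => (h.2.1 a b ha hb).add (h'.2.1 a b ha hb), fun φ hφ => ?_⟩
  simp only [Pi.add_apply, add_mul]
  rw [integral_add (h.1.integrable_mul (hφ.iterate p q)) (h'.1.integrable_mul (hφ.iterate p q)),
    integral_add (h.2.1.integrable_mul hφ) (h'.2.1.integrable_mul hφ), h.2.2 φ hφ, h'.2.2 φ hφ,
    mul_add]

theorem IsWeakDeriv.smul {p q : ℕ} {u d : ℝ × Circ → ℂ} (c : ℂ) (h : IsWeakDeriv p q u d) :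
    IsWeakDeriv p q (c • u) (c • d) := by
  refine ⟨fun a b ha hb => (h.1 a b ha hb).smul c, fun a b ha hb => (h.2.1 a b ha hb).smul c,
    fun φ hφ => ?_⟩
  simp only [Pi.smul_apply, smul_eq_mul, mul_assoc]
  rw [integral_const_mul, integral_const_mul, h.2.2 φ hφ]
  ring

/-! ### Weighted measures and Fourier coefficients in `θ` -/

theorem measurable_weight (γ : ℝ) :
    Measurable fun z : ℝ × Circ => ENNReal.ofReal (z.1 ^ (-2 * γ)) :=
  ENNReal.measurable_ofReal.comp (measurable_fst.pow_const _)

theorem ae_mem_Ioo : ∀ᵐ z ∂piMeasure, z.1 ∈ Ioo (0 : ℝ) 1 := by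
  have h : ∀ᵐ s ∂volume.restrict (Ioo (0 : ℝ) 1), s ∈ Ioo (0 : ℝ) 1 :=
    ae_restrict_mem measurableSet_Ioo
  exact Measure.quasiMeasurePreserving_fst.ae h

theorem weighted_ac (γ : ℝ) : weightedMeasure γ ≪ piMeasure :=
  withDensity_absolutelyContinuous _ _

theorem ac_weighted (γ : ℝ) : piMeasure ≪ weightedMeasure γ := by
  refine withDensity_absolutelyContinuous' (measurable_weight γ).aemeasurable ?_
  filter_upwards [ae_mem_Ioo] with z hz
  simpa using Real.rpow_pos_of_pos hz.1 _

/-- Equality almost everywhere does not depend on the weight. -/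
theorem ae_of_weighted {γ : ℝ} {u v : ℝ × Circ → ℂ} (h : u =ᵐ[weightedMeasure γ] v) :
    u =ᵐ[piMeasure] v := (ac_weighted γ).ae_eq h

theorem memLp_restrict {γ : ℝ} {u : ℝ × Circ → ℂ} (hu : MemLp u 2 (weightedMeasure γ)) {a : ℝ}
    (ha : 0 < a) : MemLp u 2 ((volume.restrict (Ioo a 1)).prod haarAddCircle) := by
  set S : Set (ℝ × Circ) := Ioo a 1 ×ˢ univ with hS
  have hSm : MeasurableSet S := measurableSet_Ioo.prod MeasurableSet.univ
  have h1 : (volume.restrict (Ioo a 1)).prod (haarAddCircle (T := 2 * π)) =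
      piMeasure.restrict S := by
    rw [piMeasure, hS, ← Measure.prod_restrict, Measure.restrict_univ, Measure.restrict_restrict
      measurableSet_Ioo, inter_eq_left.2 (Ioo_subset_Ioo_left ha.le)]
  set c : ℝ := a ^ |-2 * γ| with hc
  have hc0 : 0 < c := Real.rpow_pos_of_pos ha _
  have hle : piMeasure.restrict S ≤ (ENNReal.ofReal c)⁻¹ • weightedMeasure γ := by
    refine Measure.le_iff.2 fun A hA => ?_
    rw [Measure.smul_apply, smul_eq_mul, weightedMeasure, withDensity_apply _ hA,
      Measure.restrict_apply hA, ← ENNReal.div_eq_inv_mul,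
      ENNReal.le_div_iff_mul_le (Or.inl (by simpa using hc0)) (Or.inl ENNReal.ofReal_ne_top)]
    calc piMeasure (A ∩ S) * ENNReal.ofReal c = ∫⁻ _ in A ∩ S, ENNReal.ofReal c ∂piMeasure := by
          rw [setLIntegral_const, mul_comm]
      _ ≤ ∫⁻ z in A ∩ S, ENNReal.ofReal (z.1 ^ (-2 * γ)) ∂piMeasure := by
          refine setLIntegral_mono (measurable_weight γ) fun z hz => ENNReal.ofReal_le_ofReal ?_
          have hz1 : z.1 ∈ Ioo a 1 := hz.2.1
          calc c ≤ z.1 ^ |-2 * γ| := Real.rpow_le_rpow ha.le hz1.1.le (abs_nonneg _)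
            _ ≤ z.1 ^ (-2 * γ) :=
              Real.rpow_le_rpow_of_exponent_ge (ha.trans hz1.1) hz1.2.le (le_abs_self _)
      _ ≤ ∫⁻ z in A, ENNReal.ofReal (z.1 ^ (-2 * γ)) ∂piMeasure :=
          lintegral_mono_set inter_subset_left
  rw [h1]
  exact (hu.smul_measure (by simpa using hc0)).mono_measure hle

theorem locInt_of_memLp {γ : ℝ} {u : ℝ × Circ → ℂ} (hu : MemLp u 2 (weightedMeasure γ)) :
    LocInt u := by
  intro a b ha hb
  have h1 := (memLp_restrict hu (half_pos ha)).integrable (by norm_num)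
  have h2 : (volume.restrict (Ioo (a / 2) 1)).prod (haarAddCircle (T := 2 * π)) =
      piMeasure.restrict (Ioo (a / 2) 1 ×ˢ univ) := by
    rw [piMeasure, ← Measure.prod_restrict, Measure.restrict_univ, Measure.restrict_restrict
      measurableSet_Ioo, inter_eq_left.2 (Ioo_subset_Ioo_left (half_pos ha).le)]
  rw [h2] at h1
  have h3 : IntegrableOn u (Ioo (a / 2) 1 ×ˢ univ) piMeasure := h1
  exact h3.mono_set (prod_mono (fun s hs => ⟨by linarith [hs.1], by linarith [hs.2]⟩) le_rfl)

/-- `û_k(ψ)`, the Fourier coefficient of `u(ψ, ·)`. -/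
def modeCoeff (u : ℝ × Circ → ℂ) (k : ℤ) (s : ℝ) : ℂ := fourierCoeff (fun x => u (s, x)) k

theorem memLp_slice {γ : ℝ} {u : ℝ × Circ → ℂ} (hu : MemLp u 2 (weightedMeasure γ)) :
    ∀ᵐ s ∂volume.restrict (Ioo (0 : ℝ) 1), MemLp (fun x => u (s, x)) 2 haarAddCircle := by
  have h1 : ∀ n : ℕ, ∀ᵐ s ∂volume.restrict (Ioo (1 / ((n : ℝ) + 1)) 1),
      MemLp (fun x => u (s, x)) 2 (haarAddCircle (T := 2 * π)) := by
    intro n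
    have h2 := memLp_restrict hu (a := 1 / ((n : ℝ) + 1)) (by positivity)
    filter_upwards [h2.aestronglyMeasurable.prodMk_left,
      ((memLp_two_iff_integrable_sq_norm h2.aestronglyMeasurable).1 h2).prod_right_ae] with s hs hi
    exact (memLp_two_iff_integrable_sq_norm hs).2 hi
  simp only [ae_restrict_iff' measurableSet_Ioo] at h1 ⊢
  filter_upwards [ae_all_iff.2 h1] with s hs h0
  obtain ⟨n, hn⟩ := exists_nat_one_div_lt h0.1
  exact hs n ⟨hn, h0.2⟩

theorem ae_eq_zero_of_modeCoeff {γ : ℝ} {u : ℝ × Circ → ℂ} (hu : MemLp u 2 (weightedMeasure γ))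
    (h : ∀ k, ∀ᵐ s ∂volume.restrict (Ioo (0 : ℝ) 1), modeCoeff u k s = 0) :
    u =ᵐ[weightedMeasure γ] 0 := by
  refine (weighted_ac γ).ae_eq ?_
  have hm : AEStronglyMeasurable u piMeasure := hu.aestronglyMeasurable.mono_ac (ac_weighted γ)
  have h1 : ∫⁻ z, ‖u z‖ₑ ∂piMeasure = 0 := by
    rw [piMeasure, lintegral_prod _ hm.enorm]
    refine lintegral_eq_zero_of_ae_eq_zero ?_
    filter_upwards [memLp_slice hu, ae_all_iff.2 h] with s hs hk
    refine lintegral_eq_zero_of_ae_eq_zero ?_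
    have h2 : hs.toLp _ = 0 := by
      apply fourierBasis.repr.injective
      ext k
      rw [fourierBasis_repr, map_zero, fourierCoeff_congr_ae hs.coeFn_toLp]
      exact hk k
    have h3 := hs.coeFn_toLp
    rw [h2] at h3
    filter_upwards [h3] with x hx
    simp [← hx]
  rw [lintegral_eq_zero_iff' hm.enorm] at h1
  filter_upwards [h1] with z hz
  simpa using hz

theorem IsTest.mode {g : ℝ → ℝ} (hg : ContDiff ℝ ∞ g) (hc : HasCompactSupport g)
    (hs : tsupport g ⊆ Ioo 0 1) (k : ℤ) :
    IsTest fun z : ℝ × Circ => (g z.1 : ℂ) * fourier k z.2 := by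
  constructor
  · have h1 : (fun z : ℝ × ℝ => ((g z.1 : ℝ) : ℂ) * fourier k ((z.2 : ℝ) : Circ)) =
        fun z => ((g z.1 : ℝ) : ℂ) * Complex.exp (2 * π * Complex.I * k * (z.2 : ℂ) / (2 * π : ℝ)) := by
      ext z
      rw [fourier_coe_apply]
    show ContDiff ℝ ∞ (fun z : ℝ × ℝ => ((g z.1 : ℝ) : ℂ) * fourier k ((z.2 : ℝ) : Circ))
    rw [h1]
    have h2 : ContDiff ℝ ∞ fun z : ℝ × ℝ => ((g z.1 : ℝ) : ℂ) :=
      Complex.ofRealCLM.contDiff.comp (hg.comp contDiff_fst)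
    have h3 : ContDiff ℝ ∞ fun z : ℝ × ℝ => (z.2 : ℂ) := Complex.ofRealCLM.contDiff.comp contDiff_snd
    exact h2.mul ((contDiff_const.mul h3).div_const _).cexp
  · by_cases hne : (tsupport g).Nonempty
    · obtain ⟨a, ha⟩ := hc.isCompact.exists_isLeast hne
      obtain ⟨b, hb⟩ := hc.isCompact.exists_isGreatest hne
      refine ⟨a, b, (hs ha.1).1, (hs hb.1).2, fun z hz => ?_⟩
      have : z.1 ∈ tsupport g := subset_tsupport _ fun h0 => hz (by simp [h0])
      exact ⟨ha.2 this, hb.2 this⟩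
    · refine ⟨1 / 2, 1 / 2, by norm_num, by norm_num, fun z hz => ?_⟩
      exact absurd ⟨z.1, subset_tsupport _ fun h0 => hz (by simp [h0])⟩ hne

theorem ae_eq_zero_of_test {γ : ℝ} {u : ℝ × Circ → ℂ} (hu : MemLp u 2 (weightedMeasure γ))
    (h : ∀ φ, IsTest φ → ∫ z, u z * φ z ∂piMeasure = 0) :
    u =ᵐ[weightedMeasure γ] 0 := by
  refine ae_eq_zero_of_modeCoeff hu fun k => ?_
  rw [ae_restrict_iff' measurableSet_Ioo]
  refine isOpen_Ioo.ae_eq_zero_of_integral_contDiff_smul_eq_zero ?_ ?_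
  · refine (locallyIntegrableOn_iff isOpen_Ioo.isLocallyClosed).2 fun K hK hKc => ?_
    rcases K.eq_empty_or_nonempty with rfl | hne
    · exact integrableOn_empty
    obtain ⟨a, ha⟩ := hKc.exists_isLeast hne
    have ha0 : 0 < a := (hK ha.1).1
    have h1 := (memLp_restrict hu (half_pos ha0)).integrable (by norm_num)
    have h2 : Integrable (fun z : ℝ × Circ => fourier (-k) z.2 • u z)
        ((volume.restrict (Ioo (a / 2) 1)).prod haarAddCircle) := by
      refine h1.bdd_mul (c := 1) ?_ ?_
      · exact ((fourier (-k)).continuous.comp continuous_snd).aestronglyMeasurable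
      · exact Filter.Eventually.of_forall fun z =>
          ((fourier (-k)).norm_coe_le_norm z.2).trans (fourier_norm _).le
    have h3 : IntegrableOn (modeCoeff u k) (Ioo (a / 2) 1) := h2.integral_prod_left
    exact h3.mono_set fun s hs => ⟨by linarith [ha.2 hs], (hK hs).2⟩
  · intro g hg hc hs
    have hφ := IsTest.mode hg hc hs (-k)
    have hi := (locInt_of_memLp hu).integrable_mul hφ
    have h0 := h _ hφ
    rw [piMeasure] at hi h0
    rw [integral_prod _ hi] at h0
    have h1 : ∀ s, g s • modeCoeff u k s =
        ∫ x, u (s, x) * ((g s : ℂ) * fourier (-k) x) ∂haarAddCircle := by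
      intro s
      rw [modeCoeff, fourierCoeff, ← integral_smul]
      refine integral_congr_ae (Filter.Eventually.of_forall fun x => ?_)
      simp only [Complex.real_smul, smul_eq_mul]
      ring
    simp only [h1]
    rw [← h0]
    symm
    refine setIntegral_eq_integral_of_forall_compl_eq_zero fun s hs' => ?_
    have : g s = 0 := image_eq_zero_of_notMem_tsupport fun hh => hs' (hs hh)
    simp [this]

/-! ### Kondratev spaces on `Π` -/

/-- The pairs `(p, q)` with `p + q ≤ m`. -/
abbrev KIdx (m : ℕ) : Type := {i : Fin (m + 1) × Fin (m + 1) // (i.1 : ℕ) + (i.2 : ℕ) ≤ m}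

/-- The functions `u` all of whose weak derivatives `∂_ψ^p ∂_θ^q u` with `p + q ≤ m` satisfy
`ψ ^ (p - γ) ∂_ψ^p ∂_θ^q u ∈ L²(Π)`. -/
def kSubmodule (m : ℕ) (γ : ℝ) : Submodule ℂ (Lp ℂ 2 (weightedMeasure γ)) where
  carrier := {u | ∀ i : KIdx m, ∃ d : Lp ℂ 2 (weightedMeasure (γ - (i.1.1 : ℕ))),
    IsWeakDeriv i.1.1 i.1.2 u d}
  add_mem' {u v} hu hv i := by
    obtain ⟨d, hd⟩ := hu i
    obtain ⟨e, he⟩ := hv i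
    exact ⟨d + e, (hd.add he).congr (ae_of_weighted (Lp.coeFn_add u v).symm)
      (ae_of_weighted (Lp.coeFn_add d e).symm)⟩
  zero_mem' i := by
    refine ⟨0, ?_⟩
    have h0 : IsWeakDeriv i.1.1 i.1.2 (0 : ℝ × Circ → ℂ) 0 :=
      ⟨fun a b _ _ => integrableOn_zero, fun a b _ _ => integrableOn_zero, fun φ _ => by simp⟩
    exact h0.congr (ae_of_weighted (Lp.coeFn_zero _ _ _).symm)
      (ae_of_weighted (Lp.coeFn_zero _ _ _).symm)
  smul_mem' c u hu i := by
    obtain ⟨d, hd⟩ := hu i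
    exact ⟨c • d, (hd.smul c).congr (ae_of_weighted (Lp.coeFn_smul c u).symm)
      (ae_of_weighted (Lp.coeFn_smul c d).symm)⟩

theorem IsWeakDeriv.unique {γ : ℝ} {p q : ℕ} {u : ℝ × Circ → ℂ}
    {d e : Lp ℂ 2 (weightedMeasure γ)} (hd : IsWeakDeriv p q u d) (he : IsWeakDeriv p q u e) :
    d = e := by
  rw [← sub_eq_zero, Lp.eq_zero_iff_ae_eq_zero]
  refine ae_eq_zero_of_test (Lp.memLp (d - e)) fun φ hφ => ?_
  have h1 : (fun z => (d - e) z * φ z) =ᵐ[piMeasure] fun z => d z * φ z - e z * φ z := by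
    filter_upwards [ae_of_weighted (Lp.coeFn_sub d e)] with z hz
    rw [hz, Pi.sub_apply, sub_mul]
  have h2 : ((-1) ^ (p + q) : ℂ) ≠ 0 := by simp
  rw [integral_congr_ae h1, integral_sub (hd.2.1.integrable_mul hφ) (he.2.1.integrable_mul hφ),
    sub_eq_zero]
  exact mul_left_cancel₀ h2 ((hd.2.2 φ hφ).symm.trans (he.2.2 φ hφ))

/-- The Kondratev space `K^m_γ(Π)`. -/
def K (m : ℕ) (γ : ℝ) : Type := kSubmodule m γ

namespace K

variable {m : ℕ} {γ : ℝ}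

instance : AddCommGroup (K m γ) := inferInstanceAs (AddCommGroup (kSubmodule m γ))
instance : Module ℂ (K m γ) := inferInstanceAs (Module ℂ (kSubmodule m γ))

/-- The underlying function on `Π`. -/
def toFun (u : K m γ) : ℝ × Circ → ℂ := u.1

/-- The weak derivative `∂_ψ^p ∂_θ^q u`, as an element of `L²(Π)` with weight `ψ ^ (p - γ)`. -/
def deriv (u : K m γ) (i : KIdx m) : Lp ℂ 2 (weightedMeasure (γ - (i.1.1 : ℕ))) :=
  (u.2 i).choose

theorem deriv_spec (u : K m γ) (i : KIdx m) : IsWeakDeriv i.1.1 i.1.2 u.toFun (u.deriv i) :=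
  (u.2 i).choose_spec

theorem toFun_add (u v : K m γ) : (u + v).toFun =ᵐ[piMeasure] u.toFun + v.toFun :=
  ae_of_weighted (Lp.coeFn_add u.1 v.1)

theorem toFun_smul (c : ℂ) (u : K m γ) : (c • u).toFun =ᵐ[piMeasure] c • u.toFun :=
  ae_of_weighted (Lp.coeFn_smul c u.1)

/-- The family of all weak derivatives of order at most `m`. -/
def jet : K m γ →ₗ[ℂ] PiLp 2 fun i : KIdx m => Lp ℂ 2 (weightedMeasure (γ - (i.1.1 : ℕ))) where
  toFun u := WithLp.toLp 2 u.deriv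
  map_add' u v := by
    ext1 i
    exact ((u + v).deriv_spec i).unique (((u.deriv_spec i).add (v.deriv_spec i)).congr
      (toFun_add u v).symm (ae_of_weighted (Lp.coeFn_add _ _).symm))
  map_smul' c u := by
    ext1 i
    exact ((c • u).deriv_spec i).unique (((u.deriv_spec i).smul c).congr
      (toFun_smul c u).symm (ae_of_weighted (Lp.coeFn_smul _ _).symm))

theorem ext_ae {u v : K m γ} (h : u.toFun =ᵐ[piMeasure] v.toFun) : u = v :=
  Subtype.ext (Lp.ext ((weighted_ac γ).ae_eq h))

theorem jet_injective : Function.Injective (jet (m := m) (γ := γ)) := by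
  rw [← LinearMap.ker_eq_bot, LinearMap.ker_eq_bot']
  intro u hu
  have h0 : u.deriv ⟨(0, 0), by simp⟩ = 0 := congrFun (congrArg WithLp.ofLp hu) _
  have h1 := u.deriv_spec ⟨(0, 0), by simp⟩
  rw [h0] at h1
  have h2 : (u.1 : ℝ × Circ → ℂ) =ᵐ[weightedMeasure γ] 0 := by
    refine ae_eq_zero_of_test (Lp.memLp u.1) fun φ hφ => ?_
    have h3 := h1.2.2 φ hφ
    simp only [Fin.val_zero, add_zero, pow_zero, one_mul, Function.iterate_zero, id] at h3
    refine h3.trans ?_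
    refine integral_eq_zero_of_ae ?_
    filter_upwards [ae_of_weighted (Lp.coeFn_zero ℂ 2 _)] with z hz
    exact mul_eq_zero_of_left hz _
  exact Subtype.ext ((Lp.eq_zero_iff_ae_eq_zero).2 h2)

/-- `‖u‖² = ∑_{p + q ≤ m} ‖ψ ^ (p - γ) ∂_ψ^p ∂_θ^q u‖²_{L²(Π)}`. -/
instance : NormedAddCommGroup (K m γ) :=
  NormedAddCommGroup.induced (K m γ)
    (PiLp 2 fun i : KIdx m => Lp ℂ 2 (weightedMeasure (γ - (i.1.1 : ℕ)))) jet jet_injective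

instance : NormedSpace ℂ (K m γ) :=
  NormedSpace.induced ℂ (K m γ)
    (PiLp 2 fun i : KIdx m => Lp ℂ 2 (weightedMeasure (γ - (i.1.1 : ℕ)))) jet

end K

/-! ### Partially analytic functions on `Π` -/

/-- `b = ∑ₖ exp (σ |k|) û_k(ψ) exp (i k θ)`. -/
def IsMultiplier (σ : ℝ) (u b : ℝ × Circ → ℂ) : Prop :=
  ∀ k : ℤ, ∀ᵐ s ∂volume.restrict (Ioo (0 : ℝ) 1),
    modeCoeff b k s = (Real.exp (σ * |(k : ℝ)|) : ℂ) * modeCoeff u k s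

theorem K.modeCoeff_add {m : ℕ} {γ : ℝ} (u v : K m γ) (k : ℤ) :
    ∀ᵐ s ∂volume.restrict (Ioo (0 : ℝ) 1),
      modeCoeff (u + v).toFun k s = modeCoeff u.toFun k s + modeCoeff v.toFun k s := by
  filter_upwards [memLp_slice (Lp.memLp u.1), memLp_slice (Lp.memLp v.1),
    Measure.ae_ae_of_ae_prod (K.toFun_add u v)] with s hu hv h
  rw [modeCoeff, fourierCoeff_congr_ae h]
  exact congrFun (fourierCoeff.add (hu.integrable (by norm_num)) (hv.integrable (by norm_num))) k

theorem K.modeCoeff_smul {m : ℕ} {γ : ℝ} (c : ℂ) (u : K m γ) (k : ℤ) :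
    ∀ᵐ s ∂volume.restrict (Ioo (0 : ℝ) 1),
      modeCoeff (c • u).toFun k s = c * modeCoeff u.toFun k s := by
  filter_upwards [Measure.ae_ae_of_ae_prod (K.toFun_smul c u)] with s h
  rw [modeCoeff, fourierCoeff_congr_ae h]
  exact fourierCoeff.const_smul _ c k

theorem IsMultiplier.add {m : ℕ} {γ σ : ℝ} {u v b e : K m γ} (h : IsMultiplier σ u.toFun b.toFun)
    (h' : IsMultiplier σ v.toFun e.toFun) : IsMultiplier σ (u + v).toFun (b + e).toFun := by
  intro k
  filter_upwards [h k, h' k, K.modeCoeff_add u v k, K.modeCoeff_add b e k] with s h1 h2 h3 h4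
  rw [h3, h4, h1, h2, mul_add]

theorem IsMultiplier.smul {m : ℕ} {γ σ : ℝ} {u b : K m γ} (c : ℂ)
    (h : IsMultiplier σ u.toFun b.toFun) : IsMultiplier σ (c • u).toFun (c • b).toFun := by
  intro k
  filter_upwards [h k, K.modeCoeff_smul c u k, K.modeCoeff_smul c b k] with s h1 h2 h3
  rw [h2, h3, h1]
  ring

theorem IsMultiplier.zero_iff {m : ℕ} {γ σ : ℝ} {u b : K m γ}
    (h : IsMultiplier σ u.toFun b.toFun) : u = 0 ↔ b = 0 := by
  have h0 : ∀ v : K m γ, v = 0 ↔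
      ∀ k, ∀ᵐ s ∂volume.restrict (Ioo (0 : ℝ) 1), modeCoeff v.toFun k s = 0 := by
    refine fun v => ⟨?_, fun hv => ?_⟩
    · rintro rfl k
      have := K.modeCoeff_smul (0 : ℂ) (0 : K m γ) k
      simpa using this
    · exact Subtype.ext ((Lp.eq_zero_iff_ae_eq_zero).2 (ae_eq_zero_of_modeCoeff (Lp.memLp v.1) hv))
  rw [h0, h0]
  refine forall_congr' fun k => ⟨fun hu => ?_, fun hb => ?_⟩
  · filter_upwards [h k, hu] with s h1 h2
    rw [h1, h2, mul_zero]
  · filter_upwards [h k, hb] with s h1 h2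
    rw [h2] at h1
    exact (mul_eq_zero.1 h1.symm).resolve_left (by exact_mod_cast (Real.exp_pos _).ne')

/-- The functions `u ∈ K^m_γ(Π)` for which `∑ₖ exp (σ |k|) û_k(ψ) exp (i k θ)` is in
`K^m_γ(Π)` too. -/
def ksSubmodule (m : ℕ) (σ γ : ℝ) : Submodule ℂ (K m γ) where
  carrier := {u | ∃ b : K m γ, IsMultiplier σ u.toFun b.toFun}
  add_mem' := by
    rintro u v ⟨b, hb⟩ ⟨e, he⟩
    exact ⟨b + e, hb.add he⟩
  zero_mem' := by
    refine ⟨0, fun k => ?_⟩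
    have := K.modeCoeff_smul (0 : ℂ) (0 : K m γ) k
    filter_upwards [this] with s hs
    simp only [zero_smul, zero_mul] at hs
    rw [hs, mul_zero]
  smul_mem' := by
    rintro c u ⟨b, hb⟩
    exact ⟨c • b, hb.smul c⟩

/-- The space `K^{m,σ}_γ(Π)` of partially analytic functions. -/
def KS (m : ℕ) (σ γ : ℝ) : Type := ksSubmodule m σ γ

namespace KS

variable {m : ℕ} {σ γ : ℝ}

instance : AddCommGroup (KS m σ γ) := inferInstanceAs (AddCommGroup (ksSubmodule m σ γ))
instance : Module ℂ (KS m σ γ) := inferInstanceAs (Module ℂ (ksSubmodule m σ γ))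

/-- The underlying function on `Π`. -/
def toFun (u : KS m σ γ) : ℝ × Circ → ℂ := u.1.toFun

/-- `u ↦ ∑ₖ exp (σ |k|) û_k(ψ) exp (i k θ)`. -/
def mult : KS m σ γ →ₗ[ℂ] K m γ where
  toFun u := u.2.choose
  map_add' u v := by
    have h := ((u + v).2.choose_spec).add ((u.2.choose_spec.add v.2.choose_spec).smul (-1))
    have h1 := h.zero_iff.1 (by simp only [neg_smul, one_smul]; exact add_neg_cancel (u.1 + v.1))
    rwa [neg_smul, one_smul, ← sub_eq_add_neg, sub_eq_zero] at h1
  map_smul' c u := by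
    have h := ((c • u).2.choose_spec).add ((u.2.choose_spec.smul c).smul (-1))
    have h1 := h.zero_iff.1 (by simp only [neg_smul, one_smul]; exact add_neg_cancel (c • u.1))
    rwa [neg_smul, one_smul, ← sub_eq_add_neg, sub_eq_zero] at h1

theorem mult_spec (u : KS m σ γ) : IsMultiplier σ u.toFun (mult u).toFun := u.2.choose_spec

theorem mult_injective : Function.Injective (mult (m := m) (σ := σ) (γ := γ)) := by
  rw [← LinearMap.ker_eq_bot, LinearMap.ker_eq_bot']
  exact fun u hu => Subtype.ext (u.mult_spec.zero_iff.2 hu)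

/-- `‖u‖ = ‖∑ₖ exp (σ |k|) û_k(ψ) exp (i k θ)‖_{K^m_γ(Π)}`. -/
instance : NormedAddCommGroup (KS m σ γ) :=
  NormedAddCommGroup.induced (KS m σ γ) (K m γ) mult mult_injective

instance : NormedSpace ℂ (KS m σ γ) := NormedSpace.induced ℂ (KS m σ γ) (K m γ) mult

end KS

/-- The space `J^{m,σ}_{lam,γ}(Π) ≅ X^m_σ(𝕋) ⊕ K^{m,σ}_{lam+γ}(Π)`, with the norm of the direct sum;
the pair `(v, w)` is the function `v(θ) ψ ^ lam + w(ψ, θ)`. -/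
abbrev J (m : ℕ) (σ lam γ : ℝ) : Type := WithLp 2 (X m σ × KS m σ (lam + γ))

/-- The function `v(θ) ψ ^ lam + w(ψ, θ)` on `Π`. -/
def J.toFun {m : ℕ} {σ lam γ : ℝ} (u : J m σ lam γ) (z : ℝ × Circ) : ℂ :=
  u.fst.toFun z.2 * ((z.1 ^ lam : ℝ) : ℂ) + u.snd.toFun z

/-- `∫ v(θ) exp (i k θ) dθ / 2π`, where `v` is the leading coefficient of `u`. -/
def J.leadingMoment {m : ℕ} {σ lam γ : ℝ} (u : J m σ lam γ) (k : ℤ) : ℂ :=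
  ∫ x, u.fst.toFun x * fourier k x ∂haarAddCircle

theorem J.leadingMoment_add {m : ℕ} {σ lam γ : ℝ} (u v : J m σ lam γ) (k : ℤ) :
    (u + v).leadingMoment k = u.leadingMoment k + v.leadingMoment k := by
  have hi : ∀ w : J m σ lam γ, Integrable (fun x => w.fst.toFun x * fourier k x) haarAddCircle :=
    fun w => ((Lp.memLp w.fst.1).integrable (by norm_num)).mul_bdd (c := 1)
      (fourier k).continuous.aestronglyMeasurable
      (Filter.Eventually.of_forall fun x =>
        ((fourier k).norm_coe_le_norm x).trans (fourier_norm _).le)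
  rw [J.leadingMoment, J.leadingMoment, J.leadingMoment, ← integral_add (hi u) (hi v)]
  refine integral_congr_ae ?_
  filter_upwards [Lp.coeFn_add u.fst.1 v.fst.1] with x hx
  have : (u + v).fst.toFun x = u.fst.toFun x + v.fst.toFun x := hx
  rw [this, add_mul]

theorem J.leadingMoment_smul {m : ℕ} {σ lam γ : ℝ} (c : ℂ) (u : J m σ lam γ) (k : ℤ) :
    (c • u).leadingMoment k = c * u.leadingMoment k := by
  rw [J.leadingMoment, J.leadingMoment, ← integral_const_mul]
  refine integral_congr_ae ?_
  filter_upwards [Lp.coeFn_smul c u.fst.1] with x hx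
  have : (c • u).fst.toFun x = c * u.fst.toFun x := hx
  rw [this, mul_assoc]

/-- The subspace of `J^{m,σ}_{0,γ}(Π)` on which the leading coefficient `v(θ)` satisfies
`∫ v(θ) exp (± 2 i θ) dθ = 0`, with the norm of `J^{m,σ}_{0,γ}(Π)`. -/
def JTilde (m : ℕ) (σ γ : ℝ) : Submodule ℂ (J m σ 0 γ) where
  carrier := {u | u.leadingMoment 2 = 0 ∧ u.leadingMoment (-2) = 0}
  add_mem' {u v} hu hv := by
    constructor
    · rw [J.leadingMoment_add, hu.1, hv.1, add_zero]
    · rw [J.leadingMoment_add, hu.2, hv.2, add_zero]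
  zero_mem' := by
    have h : ∀ k, (0 : J m σ 0 γ).leadingMoment k = 0 := fun k => by
      simpa using J.leadingMoment_smul (0 : ℂ) (0 : J m σ 0 γ) k
    exact ⟨h 2, h (-2)⟩
  smul_mem' c u hu := by
    constructor
    · rw [J.leadingMoment_smul, hu.1, mul_zero]
    · rw [J.leadingMoment_smul, hu.2, mul_zero]

/-! ### The linear problem -/

/-- `ψ ^ (-1/2) [ψ² ∂_ψ² + 2 ψ ∂_ψ + (I + ∂_θ²) / 4] u = f` on `Π`, with weak derivatives. -/
def SolvesInterior (u f : ℝ × Circ → ℂ) : Prop :=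
  ∃ u₁ u₂ uθθ : ℝ × Circ → ℂ,
    IsWeakDeriv 1 0 u u₁ ∧ IsWeakDeriv 2 0 u u₂ ∧ IsWeakDeriv 0 2 u uθθ ∧
      ∀ᵐ z ∂piMeasure, ((z.1 ^ (-(1 / 2) : ℝ) : ℝ) : ℂ) *
        ((z.1 : ℂ) ^ 2 * u₂ z + 2 * (z.1 : ℂ) * u₁ z + 1 / 4 * (u z + uθθ z)) = f z

/-- `h(θ) = u(1, θ)`: `u` agrees almost everywhere on `Π` with a function that is continuous on
`(0, 1] × 𝕋`, and `h` with the values of that function at `ψ = 1`. -/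
def HasTrace (u : ℝ × Circ → ℂ) (h : Circ → ℂ) : Prop :=
  ∃ U : ℝ × Circ → ℂ, ContinuousOn U (Ioc 0 1 ×ˢ univ) ∧ u =ᵐ[piMeasure] U ∧
    ∀ᵐ x ∂haarAddCircle, h x = U (1, x)

/-- `R + ((p_x - i p_y) / 2) exp (i θ) + ((p_x + i p_y) / 2) exp (- i θ) + u(1, θ) = g(θ)`. -/
def SolvesBoundary (R px py : ℂ) (u : ℝ × Circ → ℂ) (g : Circ → ℂ) : Prop :=
  ∃ h : Circ → ℂ, HasTrace u h ∧ ∀ᵐ x ∂haarAddCircle,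
    R + (px - Complex.I * py) / 2 * fourier 1 x + (px + Complex.I * py) / 2 * fourier (-1) x + h x
      = g x

end FlowLines

end

/-! Expand everything in Fourier series in `θ` and write `D = ψ ∂_ψ`. On the mode `k` the bracket
becomes `D² + D + (1 - k²)/4 = (D + (1 + |k|)/2) (D + (1 - |k|)/2)`, so the problem splits into
ordinary differential equations on `(0, 1)`, each with one boundary condition at `ψ = 1`.

The leading term `v_k ψ^(1/2)` of `u` produces the leading coefficient `(1 - k²/4) v_k` of `f`. The
factor vanishes exactly for `k = ±2`; this is the moment condition on `f`, and it leaves `v_2` and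
`v_{-2}` free. The remainder lies in `L²` with weight `ψ^(-(1/2 + γ))`. There `D + c` is solved with
an `L²` bound by integrating from `0` if `c + γ > 0` and from `1` if `c + γ < 0`; this is Hardy's
inequality, a case of the Schur test `Q_le_of_kernel`. For `c = (1 + |k|)/2` the first case always
holds. For `c = (1 - |k|)/2` the number `c + γ` is at least `γ - 1/2 > 0` when `|k| ≤ 2` and at most
`γ - 1 < 0` when `|k| ≥ 3`. Hence the remainder is unique for `|k| ≤ 2`, and determined up to a
multiple of `ψ^((|k| - 1)/2)` for `|k| ≥ 3` (`eq_zero_of_inQ_rpow`, `homogeneous_ae_eq`). One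
constant is missing in every mode, and the boundary condition supplies it: the modes `0, ±1` fix `R,
p_x, p_y`, the modes `±2` fix `v_2, v_{-2}`, and the modes `|k| ≥ 3` fix the multiples. This gives
injectivity (`SolvesModes.eq_zero`) and surjectivity (`exists_preimage`).

The regularity count is uniform in `k`. `K.reg_modeCoeff` and `K.exists_of_reg` identify the
Kondratev spaces with sequences of modes for which powers of `D` and of `(1 + k²)^(1/2)` trade one
for one. The indicial factors grow like `|k|`, so inverting the operator gains two orders
(`exists_modeSol`, `reg_of_modeEq`). The value at `ψ = 1` loses half an order (`tsum_bdry_lt_top`),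
and the homogeneous solutions give it back (`reg_homogeneous`). Since `σ > 0`, the boundary value is
that of an absolutely convergent Fourier series, which is continuous on `(0, 1] × 𝕋`
(`exists_trace`).

Boundedness in both directions needs no explicit constants. The spaces are complete and the relation
between `((R, p_x, p_y), u)` and `(f, g)` is cut out by continuous functionals
(`isClosed_problemGraph`), so the closed graph and open mapping theorems apply
(`exists_continuousLinearEquiv_of_graph`). -/

noncomputable section

namespace FlowLines

/-! ### Weak derivatives on the interval `(0, 1)` -/

/-- Smooth functions on the line with compact support in `(0, 1)`. -/
structure Test1 (g : ℝ → ℂ) : Prop where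
  smooth : ContDiff ℝ ∞ g
  support : ∃ a b : ℝ, 0 < a ∧ b < 1 ∧ ∀ s, g s ≠ 0 → s ∈ Icc a b

/-- `h` is integrable on the compact subintervals of `(0, 1)`. -/
def LocInt1 (h : ℝ → ℂ) : Prop := ∀ a b : ℝ, 0 < a → b < 1 → IntegrableOn h (Icc a b)

/-- `f` is the weak derivative of `h` on `(0, 1)`. -/
def WeakDeriv1 (h f : ℝ → ℂ) : Prop :=
  LocInt1 h ∧ LocInt1 f ∧ ∀ g, Test1 g →
    ∫ s in Ioo (0 : ℝ) 1, h s * deriv g s = -∫ s in Ioo (0 : ℝ) 1, f s * g s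

/-- `d = ψ ∂_ψ h` on `(0, 1)` in the sense of distributions. -/
def HasD (h d : ℝ → ℂ) : Prop := WeakDeriv1 h fun s => d s / s

theorem Test1.deriv {g : ℝ → ℂ} (h : Test1 g) : Test1 (deriv g) := by
  obtain ⟨hs, a, b, ha, hb, hab⟩ := h
  refine ⟨(contDiff_infty_iff_deriv.1 hs).2, a, b, ha, hb, fun s hs' => ?_⟩
  by_contra hn
  apply hs'
  have : g =ᶠ[nhds s] fun _ => 0 := by
    filter_upwards [isClosed_Icc.isOpen_compl.mem_nhds hn] with r hr
    by_contra h0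
    exact hr (hab r h0)
  rw [this.deriv_eq, deriv_const]

theorem Test1.exists_Ioo {g : ℝ → ℂ} (h : Test1 g) :
    ∃ a b : ℝ, 0 < a ∧ a < b ∧ b < 1 ∧ ∀ s, s ∉ Ioo a b → g s = 0 := by
  obtain ⟨a, b, ha, hb, hab⟩ := h.support
  -- The constants `1/4 < 1/2` keep the enlarged interval nondegenerate even when `Icc a b` is
  -- empty.
  refine ⟨min (a / 2) (1 / 4), max ((b + 1) / 2) (1 / 2), by positivity, ?_, ?_, fun s hs => ?_⟩
  · exact (min_le_right _ _).trans_lt ((by norm_num : (1 / 4 : ℝ) < 1 / 2).trans_le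
      (le_max_right _ _))
  · exact max_lt (by linarith) (by norm_num)
  · by_contra h0
    have h1 := hab s h0
    refine hs ⟨?_, ?_⟩
    · exact (min_le_left _ _).trans_lt (by linarith [h1.1])
    · exact lt_of_lt_of_le (by linarith [h1.2]) (le_max_left _ _)

/-- The factor may be singular at `0`, as real powers are, because the test function vanishes near
`0` and on the negative axis. -/
theorem Test1.mul_smoothOn {g : ℝ → ℂ} (h : Test1 g) {p : ℝ → ℂ}
    (hp : ∀ s, 0 < s → ContDiffAt ℝ ∞ p s) : Test1 fun s => p s * g s := by
  obtain ⟨a, b, ha, hb, hab⟩ := h.support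
  refine ⟨contDiff_iff_contDiffAt.2 fun s => ?_, a, b, ha, hb, fun s hs =>
    hab s (right_ne_zero_of_mul hs)⟩
  by_cases hs : 0 < s
  · exact (hp s hs).mul h.smooth.contDiffAt
  · have : (fun s => p s * g s) =ᶠ[nhds s] fun _ => 0 := by
      filter_upwards [isOpen_Iio.mem_nhds (show s ∈ Iio a by simp only [mem_Iio]; linarith)]
        with r hr
      have : g r = 0 := by
        by_contra h0
        exact absurd (hab r h0).1 (not_le.2 hr)
      simp [this]
    exact contDiffAt_const.congr_of_eventuallyEq this

theorem contDiffAt_ofReal_rpow (c : ℝ) {s : ℝ} (hs : 0 < s) :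
    ContDiffAt ℝ ∞ (fun s : ℝ => ((s ^ c : ℝ) : ℂ)) s :=
  Complex.ofRealCLM.contDiff.contDiffAt.comp s (Real.contDiffAt_rpow_const_of_ne hs.ne')

theorem Test1.rpow_mul {g : ℝ → ℂ} (h : Test1 g) (c : ℝ) :
    Test1 fun s => ((s ^ c : ℝ) : ℂ) * g s :=
  h.mul_smoothOn fun _ hs => contDiffAt_ofReal_rpow c hs

theorem Test1.const_mul {g : ℝ → ℂ} (h : Test1 g) (c : ℂ) : Test1 fun s => c * g s :=
  h.mul_smoothOn fun _ _ => contDiffAt_const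

theorem Test1.add {g g' : ℝ → ℂ} (h : Test1 g) (h' : Test1 g') : Test1 fun s => g s + g' s := by
  obtain ⟨a, b, ha, hb, hab⟩ := h.support
  obtain ⟨a', b', ha', hb', hab'⟩ := h'.support
  refine ⟨h.smooth.add h'.smooth, min a a', max b b', lt_min ha ha', max_lt hb hb', fun s hs => ?_⟩
  by_cases h0 : g s = 0
  · have h1 : g' s ≠ 0 := fun h1 => hs (by simp [h0, h1])
    exact ⟨(min_le_right _ _).trans (hab' s h1).1, (hab' s h1).2.trans (le_max_right _ _)⟩
  · exact ⟨(min_le_left _ _).trans (hab s h0).1, (hab s h0).2.trans (le_max_left _ _)⟩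

theorem LocInt1.integrable_mul {u g : ℝ → ℂ} (hu : LocInt1 u) (h : Test1 g) :
    IntegrableOn (fun s => u s * g s) (Ioo 0 1) := by
  obtain ⟨a, b, ha, hb, hab⟩ := h.support
  have h1 : IntegrableOn (fun s => u s * g s) (Icc a b) :=
    (hu a b ha hb).mul_continuousOn h.smooth.continuous.continuousOn isCompact_Icc
  refine h1.of_forall_sdiff_eq_zero measurableSet_Ioo fun s hs => ?_
  have : g s = 0 := by
    by_contra h0
    exact hs.2 (hab s h0)
  simp [this]

theorem LocInt1.congr {u v : ℝ → ℂ} (hu : LocInt1 u)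
    (h : u =ᵐ[volume.restrict (Ioo 0 1)] v) : LocInt1 v := by
  intro a b ha hb
  refine (hu a b ha hb).congr (ae_restrict_of_ae_restrict_of_subset ?_ h)
  exact fun s hs => ⟨ha.trans_le hs.1, hs.2.trans_lt hb⟩

theorem LocInt1.add {u v : ℝ → ℂ} (hu : LocInt1 u) (hv : LocInt1 v) : LocInt1 (u + v) :=
  fun a b ha hb => (hu a b ha hb).add (hv a b ha hb)

theorem LocInt1.mul_continuousOn {u : ℝ → ℂ} (hu : LocInt1 u) {p : ℝ → ℂ}
    (hp : ContinuousOn p (Ioo 0 1)) : LocInt1 fun s => p s * u s :=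
  fun a b ha hb => (hu a b ha hb).continuousOn_mul (hp.mono fun _ hs =>
    ⟨ha.trans_le hs.1, hs.2.trans_lt hb⟩) isCompact_Icc

theorem continuousOn_ofReal_rpow (c : ℝ) :
    ContinuousOn (fun s : ℝ => ((s ^ c : ℝ) : ℂ)) (Ioi 0) :=
  fun _ hs => (contDiffAt_ofReal_rpow c hs).continuousAt.continuousWithinAt

theorem LocInt1.rpow_mul {u : ℝ → ℂ} (hu : LocInt1 u) (c : ℝ) :
    LocInt1 fun s => ((s ^ c : ℝ) : ℂ) * u s :=
  hu.mul_continuousOn ((continuousOn_ofReal_rpow c).mono fun _ hs => hs.1)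

theorem LocInt1.const_mul {u : ℝ → ℂ} (hu : LocInt1 u) (c : ℂ) : LocInt1 fun s => c * u s :=
  hu.mul_continuousOn continuousOn_const

theorem LocInt1.of_continuousOn {u : ℝ → ℂ} (hu : ContinuousOn u (Ioo 0 1)) : LocInt1 u :=
  fun a b ha hb => (hu.mono fun _ hs =>
    ⟨ha.trans_le hs.1, hs.2.trans_lt hb⟩ : ContinuousOn u (Icc a b)).integrableOn_Icc

theorem LocInt1.ae_eq_zero {u : ℝ → ℂ} (hu : LocInt1 u)
    (h : ∀ g, Test1 g → ∫ s in Ioo (0 : ℝ) 1, u s * g s = 0) :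
    u =ᵐ[volume.restrict (Ioo 0 1)] 0 := by
  refine (ae_restrict_iff' measurableSet_Ioo).2 ?_
  refine isOpen_Ioo.ae_eq_zero_of_integral_contDiff_smul_eq_zero ?_ ?_
  · refine (locallyIntegrableOn_iff isOpen_Ioo.isLocallyClosed).2 fun K hK hKc => ?_
    rcases K.eq_empty_or_nonempty with rfl | hne
    · exact integrableOn_empty
    obtain ⟨a, ha⟩ := hKc.exists_isLeast hne
    obtain ⟨b, hb⟩ := hKc.exists_isGreatest hne
    exact (hu a b (hK ha.1).1 (hK hb.1).2).mono_set fun s hs => ⟨ha.2 hs, hb.2 hs⟩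
  · intro g hg hc hs
    have hT : Test1 fun s => (g s : ℂ) := by
      refine ⟨Complex.ofRealCLM.contDiff.comp hg, ?_⟩
      by_cases hne : (tsupport g).Nonempty
      · obtain ⟨a, ha⟩ := hc.isCompact.exists_isLeast hne
        obtain ⟨b, hb⟩ := hc.isCompact.exists_isGreatest hne
        refine ⟨a, b, (hs ha.1).1, (hs hb.1).2, fun z hz => ?_⟩
        have : z ∈ tsupport g := subset_tsupport _ fun h0 => hz (by simp [h0])
        exact ⟨ha.2 this, hb.2 this⟩
      · refine ⟨1 / 2, 1 / 2, by norm_num, by norm_num, fun z hz => ?_⟩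
        exact absurd ⟨z, subset_tsupport _ fun h0 => hz (by simp [h0])⟩ hne
    rw [← h _ hT]
    have h1 : ∀ s, u s * (g s : ℂ) = g s • u s := fun s => by
      rw [Complex.real_smul, mul_comm]
    simp only [h1]
    symm
    refine setIntegral_eq_integral_of_forall_compl_eq_zero fun s hs' => ?_
    have : g s = 0 := image_eq_zero_of_notMem_tsupport fun hh => hs' (hs hh)
    simp [this]

theorem Test1.integral_eq {g : ℝ → ℂ} {a b : ℝ} (ha : 0 < a) (hab : a < b) (hb : b < 1)
    (hg : ∀ s, s ∉ Ioo a b → g s = 0) (u : ℝ → ℂ) :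
    ∫ s in Ioo (0 : ℝ) 1, u s * g s = ∫ s in a..b, u s * g s := by
  rw [intervalIntegral.integral_of_le hab.le]
  refine setIntegral_eq_of_subset_of_forall_sdiff_eq_zero measurableSet_Ioo
    (fun s hs => ⟨ha.trans hs.1, hs.2.trans_lt hb⟩) fun s hs => ?_
  rw [hg s fun h => hs.2 ⟨h.1, h.2.le⟩, mul_zero]

/-- The endpoints are included: there the derivative is computed from the side on which the function
vanishes, and one-sided derivatives are unique. -/
theorem Test1.deriv_eq_zero {g : ℝ → ℂ} (h : Test1 g) {a b : ℝ}
    (hg : ∀ s, s ∉ Ioo a b → g s = 0) (s : ℝ) (hs : s ∉ Ioo a b) : _root_.deriv g s = 0 := by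
  have h0 := hg s hs
  have hd : HasDerivAt g (_root_.deriv g s) s :=
    (h.smooth.differentiable (by simp)).differentiableAt.hasDerivAt
  have h1 : ∃ S : Set ℝ, UniqueDiffWithinAt ℝ S s ∧ s ∈ S ∧ ∀ r ∈ S, g r = 0 := by
    by_cases hsa : s ≤ a
    · exact ⟨Iic s, uniqueDiffWithinAt_Iic s, self_mem_Iic,
        fun r hr => hg r fun h => absurd (h.1.trans_le hr) (not_lt.2 hsa)⟩
    · have hsb : b ≤ s := by
        by_contra hc
        exact hs ⟨not_le.1 hsa, not_le.1 hc⟩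
      exact ⟨Ici s, uniqueDiffWithinAt_Ici s, self_mem_Ici,
        fun r hr => hg r fun h => absurd (lt_of_le_of_lt hr h.2) (not_lt.2 hsb)⟩
  obtain ⟨S, hS, hsS, h2⟩ := h1
  exact hS.eq_deriv S hd.hasDerivWithinAt
    ((hasDerivWithinAt_const s S (0 : ℂ)).congr_of_mem h2 hsS)

/-- Integration by parts for a density that is only locally integrable: the primitive is inserted as
an integral and Fubini's theorem is applied on the triangle `r ≤ s`. -/
theorem WeakDeriv1.of_primitive {P f : ℝ → ℂ} (hf : LocInt1 f)
    (hP : ∀ a b : ℝ, 0 < a → a ≤ b → b < 1 → P b - P a = ∫ s in a..b, f s) :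
    WeakDeriv1 P f := by
  have hc : ∀ a b : ℝ, 0 < a → b < 1 → ContinuousOn P (Icc a b) := by
    intro a b ha hb
    rcases lt_or_ge b a with h | h
    · simp [h]
    have h1 : ContinuousOn (fun s => P a + ∫ r in a..s, f r) (Icc a b) := by
      refine continuousOn_const.add ?_
      have := intervalIntegral.continuousOn_primitive_interval (a := a) (b := b) (f := f)
        (μ := volume) (by rw [uIcc_of_le h]; exact hf a b ha hb)
      rwa [uIcc_of_le h] at this
    refine h1.congr fun s hs => ?_
    simp only [← hP a s ha hs.1 (hs.2.trans_lt hb)]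
    ring
  refine ⟨fun a b ha hb => (hc a b ha hb).integrableOn_Icc, hf, fun g hg => ?_⟩
  obtain ⟨a, b, ha, hab, hb, hz⟩ := hg.exists_Ioo
  rw [Test1.integral_eq ha hab hb hz, Test1.integral_eq ha hab hb (hg.deriv_eq_zero hz)]
  have hga : g a = 0 := hz a (by simp)
  have hgb : g b = 0 := hz b (by simp)
  have hgc : Continuous (_root_.deriv g) := hg.deriv.smooth.continuous
  have hgi : ∀ r : ℝ, ∫ s in r..b, _root_.deriv g s = -g r := fun r => by
    rw [intervalIntegral.integral_deriv_eq_sub (fun x _ =>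
      (hg.smooth.differentiable (by simp)).differentiableAt) (hgc.intervalIntegrable _ _), hgb]
    ring
  -- The variable endpoint becomes an indicator, so that the order of integration can be exchanged
  -- over the fixed square.
  have hPs : ∀ s ∈ Ioc a b, P s = P a + ∫ r in Ioc a b, (Iic s).indicator f r := by
    intro s hs
    have h1 : Iic s ∩ Ioc a b = Ioc a s := by
      ext r
      simp only [mem_inter_iff, mem_Iic, mem_Ioc]
      constructor
      · rintro ⟨h1, h2, h3⟩; exact ⟨h2, h1⟩
      · rintro ⟨h1, h2⟩; exact ⟨h2, h1, h2.trans hs.2⟩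
    rw [integral_indicator measurableSet_Iic, Measure.restrict_restrict measurableSet_Iic,
      h1, ← intervalIntegral.integral_of_le hs.1.le, ← hP a s ha hs.1.le (hs.2.trans_lt hb)]
    ring
  have hfi : Integrable f (volume.restrict (Ioc a b)) :=
    ((hf a b ha hb).mono_set Ioc_subset_Icc_self :)
  have hgint : Integrable (_root_.deriv g) (volume.restrict (Ioc a b)) :=
    (hgc.integrableOn_Icc (μ := volume)).mono_set Ioc_subset_Icc_self
  have hF : Integrable (fun z : ℝ × ℝ => (Iic z.1).indicator f z.2 * _root_.deriv g z.1)
      ((volume.restrict (Ioc a b)).prod (volume.restrict (Ioc a b))) := by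
    have h1 := (hgint.mul_prod hfi).indicator (measurableSet_le measurable_snd measurable_fst)
    refine h1.congr (Filter.Eventually.of_forall fun z => ?_)
    by_cases hz : z.2 ≤ z.1 <;> simp [indicator, hz, mul_comm]
  rw [intervalIntegral.integral_of_le hab.le, intervalIntegral.integral_of_le hab.le]
  have h2 : ∫ s in Ioc a b, P s * _root_.deriv g s = ∫ s in Ioc a b, (P a * _root_.deriv g s +
      ∫ r in Ioc a b, (Iic s).indicator f r * _root_.deriv g s) := by
    refine setIntegral_congr_fun measurableSet_Ioc fun s hs => ?_
    simp only [hPs s hs]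
    rw [integral_mul_const, add_mul]
  rw [h2, integral_add (hgint.const_mul _) hF.integral_prod_left, integral_const_mul,
    ← intervalIntegral.integral_of_le hab.le, hgi a, hga, neg_zero, mul_zero, zero_add,
    integral_integral_swap hF, ← integral_neg]
  refine setIntegral_congr_fun measurableSet_Ioc fun r hr => ?_
  have h3 : ∀ s, (Iic s).indicator f r * _root_.deriv g s =
      f r * (Ici r).indicator (_root_.deriv g) s := by
    intro s
    by_cases hz : r ≤ s <;> simp [indicator, hz]
  have h4 : Ici r ∩ Ioc a b = Icc r b := by
    ext s
    simp only [mem_inter_iff, mem_Ici, mem_Ioc, mem_Icc]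
    constructor
    · rintro ⟨h1, h2, h3⟩; exact ⟨h1, h3⟩
    · rintro ⟨h1, h2⟩; exact ⟨h1, hr.1.trans_le h1, h2⟩
  simp only [h3]
  rw [integral_const_mul, integral_indicator measurableSet_Ici, Measure.restrict_restrict
    measurableSet_Ici, h4, integral_Icc_eq_integral_Ioc,
    ← intervalIntegral.integral_of_le hr.2, hgi r]
  ring

namespace WeakDeriv1

variable {h f h' f' : ℝ → ℂ}

theorem congr (H : WeakDeriv1 h f) (hh : h =ᵐ[volume.restrict (Ioo 0 1)] h')
    (hf : f =ᵐ[volume.restrict (Ioo 0 1)] f') : WeakDeriv1 h' f' := by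
  refine ⟨H.1.congr hh, H.2.1.congr hf, fun g hg => ?_⟩
  have h1 : ∫ s in Ioo (0 : ℝ) 1, h' s * deriv g s = ∫ s in Ioo (0 : ℝ) 1, h s * deriv g s := by
    refine integral_congr_ae ?_
    filter_upwards [hh] with s hs
    rw [hs]
  have h2 : ∫ s in Ioo (0 : ℝ) 1, f' s * g s = ∫ s in Ioo (0 : ℝ) 1, f s * g s := by
    refine integral_congr_ae ?_
    filter_upwards [hf] with s hs
    rw [hs]
  rw [h1, h2, H.2.2 g hg]

theorem add (H : WeakDeriv1 h f) (H' : WeakDeriv1 h' f') : WeakDeriv1 (h + h') (f + f') := by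
  refine ⟨H.1.add H'.1, H.2.1.add H'.2.1, fun g hg => ?_⟩
  simp only [Pi.add_apply, add_mul]
  rw [integral_add (H.1.integrable_mul hg.deriv) (H'.1.integrable_mul hg.deriv),
    integral_add (H.2.1.integrable_mul hg) (H'.2.1.integrable_mul hg), H.2.2 g hg, H'.2.2 g hg]
  ring

theorem const_mul (H : WeakDeriv1 h f) (c : ℂ) :
    WeakDeriv1 (fun s => c * h s) (fun s => c * f s) := by
  refine ⟨H.1.const_mul c, H.2.1.const_mul c, fun g hg => ?_⟩
  simp only [mul_assoc]
  rw [integral_const_mul, integral_const_mul, H.2.2 g hg]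
  ring

/-- The power is moved to the test function, where the classical product rule holds. -/
theorem rpow_mul (H : WeakDeriv1 h f) (c : ℝ) :
    WeakDeriv1 (fun s => ((s ^ c : ℝ) : ℂ) * h s)
      (fun s => ((s ^ c : ℝ) : ℂ) * f s + c * (((s ^ (c - 1) : ℝ) : ℂ) * h s)) := by
  refine ⟨H.1.rpow_mul c, (H.2.1.rpow_mul c).add ((H.1.rpow_mul (c - 1)).const_mul c),
    fun g hg => ?_⟩
  have h1 := H.2.2 _ (hg.rpow_mul c)
  have h2 : ∫ s in Ioo (0 : ℝ) 1, h s * deriv (fun s => ((s ^ c : ℝ) : ℂ) * g s) s =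
      ∫ s in Ioo (0 : ℝ) 1, (((s ^ c : ℝ) : ℂ) * h s * deriv g s +
        c * (((s ^ (c - 1) : ℝ) : ℂ) * h s) * g s) := by
    refine setIntegral_congr_fun measurableSet_Ioo fun s hs => ?_
    have e1 : HasDerivAt (fun s : ℝ => ((s ^ c : ℝ) : ℂ)) ((c * s ^ (c - 1) : ℝ) : ℂ) s :=
      (Real.hasDerivAt_rpow_const (Or.inl hs.1.ne')).ofReal_comp
    have e2 : HasDerivAt g (deriv g s) s :=
      (hg.smooth.differentiable (by simp)).differentiableAt.hasDerivAt
    simp only [(e1.fun_mul e2).deriv]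
    push_cast
    ring
  have h3 : ∀ s, f s * (((s ^ c : ℝ) : ℂ) * g s) = ((s ^ c : ℝ) : ℂ) * f s * g s :=
    fun s => by ring
  simp only [h3] at h1
  rw [h2, integral_add ((H.1.rpow_mul c).integrable_mul hg.deriv)
    (((H.1.rpow_mul (c - 1)).const_mul c).integrable_mul hg)] at h1
  simp only [add_mul]
  rw [integral_add ((H.2.1.rpow_mul c).integrable_mul hg)
    (((H.1.rpow_mul (c - 1)).const_mul c).integrable_mul hg)]
  linear_combination h1

theorem unique (H : WeakDeriv1 h f) (H' : WeakDeriv1 h f') :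
    f =ᵐ[volume.restrict (Ioo 0 1)] f' := by
  have h1 : (fun s => f s + -1 * f' s) =ᵐ[volume.restrict (Ioo 0 1)] 0 := by
    refine LocInt1.ae_eq_zero (H.2.1.add (H'.2.1.const_mul (-1))) fun g hg => ?_
    simp only [add_mul]
    rw [integral_add (H.2.1.integrable_mul hg) ((H'.2.1.const_mul (-1)).integrable_mul hg)]
    simp only [mul_assoc]
    rw [integral_const_mul]
    linear_combination H.2.2 g hg - H'.2.2 g hg
  filter_upwards [h1] with s hs
  simp only [Pi.zero_apply] at hs
  linear_combination hs

end WeakDeriv1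

theorem exists_test1_integral_one : ∃ g, Test1 g ∧ ∫ s in Ioo (0 : ℝ) 1, g s = 1 := by
  let φ : ContDiffBump (1 / 2 : ℝ) := ⟨1 / 8, 1 / 4, by norm_num, by norm_num⟩
  have hz : ∀ s, s ∉ Ioo (1 / 4 : ℝ) (3 / 4) → φ.normed volume s = 0 := by
    intro s hs
    by_contra h0
    have h1 : s ∈ Function.support (φ.normed volume) := h0
    rw [φ.support_normed_eq, Real.ball_eq_Ioo] at h1
    refine hs ⟨?_, ?_⟩
    · have : (1 / 2 - 1 / 4 : ℝ) < s := h1.1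
      linarith
    · have : s < (1 / 2 + 1 / 4 : ℝ) := h1.2
      linarith
  refine ⟨fun s => (φ.normed volume s : ℂ), ⟨Complex.ofRealCLM.contDiff.comp φ.contDiff_normed,
    1 / 4, 3 / 4, by norm_num, by norm_num, fun s hs => ?_⟩, ?_⟩
  · by_contra h0
    exact hs (by rw [hz s fun h => h0 (Ioo_subset_Icc_self h), Complex.ofReal_zero])
  · rw [setIntegral_eq_integral_of_forall_compl_eq_zero, integral_complex_ofReal, φ.integral_normed,
      Complex.ofReal_one]
    intro s hs
    rw [hz s fun h => hs ⟨by linarith [h.1], by linarith [h.2]⟩, Complex.ofReal_zero]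

/-- The primitive vanishes to the left of the support by its choice of base point, and to the right
because the total integral is zero. -/
theorem Test1.exists_primitive {g : ℝ → ℂ} (hg : Test1 g)
    (h0 : ∫ s in Ioo (0 : ℝ) 1, g s = 0) : ∃ G, Test1 G ∧ _root_.deriv G = g := by
  obtain ⟨a, b, ha, hab, hb, hz⟩ := hg.exists_Ioo
  have hc := hg.smooth.continuous
  have hd : ∀ s, HasDerivAt (fun s => ∫ r in a..s, g r) (g s) s := fun s =>
    intervalIntegral.integral_hasDerivAt_right (hc.intervalIntegrable _ _)
      (hc.stronglyMeasurableAtFilter _ _) hc.continuousAt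
  have hder : _root_.deriv (fun s => ∫ r in a..s, g r) = g := funext fun s => (hd s).deriv
  refine ⟨fun s => ∫ r in a..s, g r, ⟨?_, a, b, ha, hb, fun s hs => ?_⟩, hder⟩
  · rw [contDiff_infty_iff_deriv, hder]
    exact ⟨fun s => (hd s).differentiableAt, hg.smooth⟩
  · by_contra hn
    apply hs
    have h1 := Test1.integral_eq ha hab hb hz 1
    simp only [Pi.one_apply, one_mul, h0] at h1
    rw [mem_Icc, not_and_or, not_le, not_le] at hn
    rcases hn with hn | hn
    · refine (intervalIntegral.integral_congr fun r hr => ?_).trans intervalIntegral.integral_zero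
      rw [uIcc_of_ge hn.le] at hr
      exact hz r fun h => absurd h.1 (not_lt.2 hr.2)
    · rw [← intervalIntegral.integral_add_adjacent_intervals (hc.intervalIntegrable a b)
        (hc.intervalIntegrable b s), ← h1, zero_add]
      refine (intervalIntegral.integral_congr fun r hr => ?_).trans intervalIntegral.integral_zero
      rw [uIcc_of_le hn.le] at hr
      exact hz r fun h => absurd h.2 (not_lt.2 hr.1)

/-- The du Bois-Reymond lemma. Subtracting `(∫ g) g₀`, with `g₀` a test function of integral one,
turns any test function `g` into the derivative of a test function; the constant is then the pairing
of `h` with `g₀`. -/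
theorem WeakDeriv1.ae_eq_const {h : ℝ → ℂ} (H : WeakDeriv1 h 0) :
    ∃ C : ℂ, h =ᵐ[volume.restrict (Ioo 0 1)] fun _ => C := by
  obtain ⟨g₀, hg₀, h1⟩ := exists_test1_integral_one
  set C := ∫ s in Ioo (0 : ℝ) 1, h s * g₀ s with hC
  refine ⟨C, ?_⟩
  have hl : LocInt1 fun s => h s + -C := H.1.add (LocInt1.of_continuousOn continuousOn_const)
  have h2 := hl.ae_eq_zero fun g hg => by
    have hone : LocInt1 fun _ => (1 : ℂ) := LocInt1.of_continuousOn continuousOn_const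
    have i1 := hone.integrable_mul hg
    have i2 := hone.integrable_mul hg₀
    simp only [one_mul] at i1 i2
    set I := ∫ s in Ioo (0 : ℝ) 1, g s with hI
    have ht := hg.add (hg₀.const_mul (-I))
    obtain ⟨G, hG, hGd⟩ := ht.exists_primitive (by
      rw [integral_add i1 (i2.const_mul _), integral_const_mul, h1, ← hI]; ring)
    have h3 := H.2.2 G hG
    rw [hGd] at h3
    simp only [Pi.zero_apply, zero_mul, integral_zero, neg_zero, mul_add] at h3
    rw [integral_add (H.1.integrable_mul hg) (H.1.integrable_mul (hg₀.const_mul _))] at h3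
    have h4 : ∀ s, h s * (-I * g₀ s) = -I * (h s * g₀ s) := fun s => by ring
    simp only [h4] at h3
    rw [integral_const_mul, ← hC] at h3
    simp only [add_mul]
    rw [integral_add (H.1.integrable_mul hg) (i1.const_mul _), integral_const_mul, ← hI]
    linear_combination h3
  filter_upwards [h2] with s hs
  simp only [Pi.zero_apply] at hs
  linear_combination hs

/-! ### Weighted `L²` norms on the interval -/

/-- `‖ψ ^ (-γ) h‖²` in `L²(0, 1)`. -/
def Q (γ : ℝ) (h : ℝ → ℂ) : ℝ≥0∞ :=
  ∫⁻ s in Ioo (0 : ℝ) 1, ENNReal.ofReal (s ^ (-2 * γ)) * ‖h s‖ₑ ^ 2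

/-- `ψ ^ (-γ) h` is in `L²(0, 1)`. -/
structure InQ (γ : ℝ) (h : ℝ → ℂ) : Prop where
  meas : AEStronglyMeasurable h (volume.restrict (Ioo 0 1))
  lt_top : Q γ h < ⊤

theorem ofReal_rpow_mul {s : ℝ} (hs : 0 < s) (x y : ℝ) :
    ENNReal.ofReal (s ^ x) * ENNReal.ofReal (s ^ y) = ENNReal.ofReal (s ^ (x + y)) := by
  rw [← ENNReal.ofReal_mul (by positivity), Real.rpow_add hs]

theorem ofReal_rpow_sq {s : ℝ} (hs : 0 < s) (x : ℝ) :
    ENNReal.ofReal (s ^ x) ^ 2 = ENNReal.ofReal (s ^ (2 * x)) := by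
  rw [sq, ofReal_rpow_mul hs, two_mul]

theorem enorm_ofReal_rpow {s : ℝ} (hs : 0 < s) (x : ℝ) :
    ‖((s ^ x : ℝ) : ℂ)‖ₑ = ENNReal.ofReal (s ^ x) := by
  rw [← ofReal_norm, Complex.norm_real, Real.norm_of_nonneg (by positivity)]

theorem measurable_ofReal_rpow (x : ℝ) : Measurable fun s : ℝ => ENNReal.ofReal (s ^ x) :=
  ENNReal.measurable_ofReal.comp (measurable_id.pow_const _)

theorem aestronglyMeasurable_rpow (x : ℝ) (μ : Measure ℝ) :
    AEStronglyMeasurable (fun s : ℝ => ((s ^ x : ℝ) : ℂ)) μ :=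
  (Complex.measurable_ofReal.comp (measurable_id.pow_const x)).aestronglyMeasurable

theorem enorm_add_sq_le (a b : ℂ) : ‖a + b‖ₑ ^ 2 ≤ 2 * (‖a‖ₑ ^ 2 + ‖b‖ₑ ^ 2) := by
  simp only [← ofReal_norm]
  rw [← ENNReal.ofReal_pow (norm_nonneg _), ← ENNReal.ofReal_pow (norm_nonneg _),
    ← ENNReal.ofReal_pow (norm_nonneg _), ← ENNReal.ofReal_add (by positivity) (by positivity),
    show (2 : ℝ≥0∞) = ENNReal.ofReal 2 by simp, ← ENNReal.ofReal_mul (by norm_num)]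
  refine ENNReal.ofReal_le_ofReal ?_
  have := norm_add_le a b
  nlinarith [norm_nonneg (a + b), norm_nonneg a, norm_nonneg b, sq_nonneg (‖a‖ - ‖b‖)]

theorem Q_congr {γ : ℝ} {h h' : ℝ → ℂ} (H : h =ᵐ[volume.restrict (Ioo 0 1)] h') :
    Q γ h = Q γ h' := by
  refine lintegral_congr_ae ?_
  filter_upwards [H] with s hs
  rw [hs]

/-- Squared norms with values in `[0, ∞]` avoid both roots and finiteness side conditions; the price
is the factor `2` in place of the triangle inequality. -/
theorem Q_add_le {γ : ℝ} {h h' : ℝ → ℂ}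
    (hm : AEStronglyMeasurable h (volume.restrict (Ioo 0 1))) :
    Q γ (h + h') ≤ 2 * (Q γ h + Q γ h') := by
  have h1 : AEMeasurable (fun s => ENNReal.ofReal (s ^ (-2 * γ)) * ‖h s‖ₑ ^ 2)
      (volume.restrict (Ioo 0 1)) :=
    (measurable_ofReal_rpow _).aemeasurable.mul (hm.enorm.pow_const 2)
  rw [Q, Q, Q, ← lintegral_add_left' h1, ← lintegral_const_mul' _ _ (by simp)]
  refine lintegral_mono fun s => ?_
  calc _ ≤ ENNReal.ofReal (s ^ (-2 * γ)) * (2 * (‖h s‖ₑ ^ 2 + ‖h' s‖ₑ ^ 2)) := by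
        gcongr; exact enorm_add_sq_le _ _
    _ = _ := by ring

theorem Q_const_mul (γ : ℝ) (h : ℝ → ℂ) (c : ℂ) :
    Q γ (fun s => c * h s) = ‖c‖ₑ ^ 2 * Q γ h := by
  rw [Q, Q, ← lintegral_const_mul' _ _ (by simp)]
  refine lintegral_congr fun s => ?_
  rw [enorm_mul]
  ring

theorem Q_rpow_mul (γ a : ℝ) (h : ℝ → ℂ) :
    Q γ (fun s => ((s ^ a : ℝ) : ℂ) * h s) = Q (γ - a) h := by
  refine setLIntegral_congr_fun measurableSet_Ioo fun s hs => ?_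
  simp only [enorm_mul, enorm_ofReal_rpow hs.1, mul_pow, ofReal_rpow_sq hs.1, ← mul_assoc,
    ofReal_rpow_mul hs.1]
  congr 4
  ring

theorem Q_mono {γ γ' : ℝ} (hγ : γ ≤ γ') (h : ℝ → ℂ) : Q γ h ≤ Q γ' h := by
  refine setLIntegral_mono_ae' measurableSet_Ioo (Filter.Eventually.of_forall fun s hs => ?_)
  gcongr ENNReal.ofReal ?_ * _
  exact Real.rpow_le_rpow_of_exponent_ge hs.1 hs.2.le (by linarith)

namespace InQ

variable {γ : ℝ} {h h' : ℝ → ℂ}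

theorem congr (H : InQ γ h) (hh : h =ᵐ[volume.restrict (Ioo 0 1)] h') : InQ γ h' :=
  ⟨H.1.congr hh, by rw [← Q_congr hh]; exact H.2⟩

theorem add (H : InQ γ h) (H' : InQ γ h') : InQ γ (h + h') :=
  ⟨H.1.add H'.1, (Q_add_le H.1).trans_lt
    (ENNReal.mul_lt_top (by simp) (ENNReal.add_lt_top.2 ⟨H.2, H'.2⟩))⟩

theorem const_mul (H : InQ γ h) (c : ℂ) : InQ γ fun s => c * h s :=
  ⟨H.1.const_mul c, by rw [Q_const_mul]; exact ENNReal.mul_lt_top (by simp) H.2⟩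

theorem rpow_mul (H : InQ γ h) (a : ℝ) : InQ (γ + a) fun s => ((s ^ a : ℝ) : ℂ) * h s :=
  ⟨(aestronglyMeasurable_rpow a _).mul H.1, by rw [Q_rpow_mul, add_sub_cancel_right]; exact H.2⟩

theorem mono {γ' : ℝ} (H : InQ γ h) (hγ : γ' ≤ γ) : InQ γ' h :=
  ⟨H.1, (Q_mono hγ h).trans_lt H.2⟩

end InQ

theorem lintegral_mul_sq_le {α : Type*} [MeasurableSpace α] (μ : Measure α) {f g : α → ℝ≥0∞}
    (hf : AEMeasurable f μ) (hg : AEMeasurable g μ) :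
    (∫⁻ a, f a * g a ∂μ) ^ 2 ≤ (∫⁻ a, f a ^ 2 ∂μ) * ∫⁻ a, g a ^ 2 ∂μ := by
  have h := ENNReal.lintegral_mul_le_Lp_mul_Lq μ Real.HolderConjugate.two_two hf hg
  simp only [Pi.mul_apply, ENNReal.rpow_two] at h
  calc _ ≤ ((∫⁻ a, f a ^ 2 ∂μ) ^ (1 / 2 : ℝ) * (∫⁻ a, g a ^ 2 ∂μ) ^ (1 / 2 : ℝ)) ^ 2 := by gcongr
    _ = _ := by
      rw [mul_pow, ← ENNReal.rpow_two, ← ENNReal.rpow_two, ← ENNReal.rpow_mul, ← ENNReal.rpow_mul]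
      norm_num

/-- The Cauchy–Schwarz inequality against a power. -/
theorem lintegral_rpow_mul_sq_le {γ b : ℝ} {h : ℝ → ℂ} {A : Set ℝ} (hA : A ⊆ Ioo 0 1)
    (hAm : MeasurableSet A)
    (hm : AEStronglyMeasurable h (volume.restrict (Ioo 0 1))) :
    (∫⁻ s in A, ENNReal.ofReal (s ^ b) * ‖h s‖ₑ) ^ 2 ≤
      (∫⁻ s in A, ENNReal.ofReal (s ^ (2 * (b + γ)))) * Q γ h := by
  have h1 : ∫⁻ s in A, ENNReal.ofReal (s ^ b) * ‖h s‖ₑ =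
      ∫⁻ s in A, ENNReal.ofReal (s ^ (b + γ)) * (ENNReal.ofReal (s ^ (-γ)) * ‖h s‖ₑ) := by
    refine setLIntegral_congr_fun hAm fun s hs => ?_
    simp only [← mul_assoc, ofReal_rpow_mul (hA hs).1]
    congr 3
    ring
  rw [h1]
  refine (lintegral_mul_sq_le _ (measurable_ofReal_rpow _).aemeasurable
    ((measurable_ofReal_rpow _).aemeasurable.mul
      (hm.mono_measure (Measure.restrict_mono hA le_rfl)).enorm)).trans ?_
  refine mul_le_mul' (le_of_eq ?_) ?_
  · exact setLIntegral_congr_fun hAm fun s hs => ofReal_rpow_sq (hA hs).1 _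
  · refine le_trans (le_of_eq ?_) (lintegral_mono_set hA)
    refine setLIntegral_congr_fun hAm fun s hs => ?_
    simp only [Pi.mul_apply, mul_pow, ofReal_rpow_sq (hA hs).1]
    congr 3
    ring

theorem lintegral_Ioo_rpow {κ s : ℝ} (hκ : 0 < κ) (hs : 0 ≤ s) :
    ∫⁻ r in Ioo 0 s, ENNReal.ofReal (r ^ (κ - 1)) = ENNReal.ofReal (s ^ κ / κ) := by
  have hi : IntervalIntegrable (fun r : ℝ => r ^ (κ - 1)) volume 0 s :=
    intervalIntegral.intervalIntegrable_rpow' (by linarith)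
  rw [setLIntegral_congr Ioo_ae_eq_Ioc, ← ofReal_integral_eq_lintegral_ofReal hi.1,
    ← intervalIntegral.integral_of_le hs, integral_rpow (Or.inl (by linarith))]
  · simp [Real.zero_rpow hκ.ne']
  · filter_upwards [ae_restrict_mem measurableSet_Ioc] with r hr
    exact Real.rpow_nonneg hr.1.le _

theorem lintegral_Ioi_rpow {κ s : ℝ} (hκ : 0 < κ) (hs : 0 < s) :
    ∫⁻ r in Ioi s, ENNReal.ofReal (r ^ (-κ - 1)) = ENNReal.ofReal (s ^ (-κ) / κ) := by
  rw [← ofReal_integral_eq_lintegral_ofReal (integrableOn_Ioi_rpow_of_lt (by linarith) hs),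
    integral_Ioi_rpow_of_lt (by linarith) hs]
  · congr 1
    rw [sub_add_cancel, neg_div, div_neg, neg_neg]
  · filter_upwards [ae_restrict_mem measurableSet_Ioi] with r hr
    exact Real.rpow_nonneg (hs.trans hr).le _

theorem Q_rpow {γ b : ℝ} (hb : γ - 1 / 2 < b) (C : ℂ) :
    Q γ (fun s => C * ((s ^ b : ℝ) : ℂ)) = ‖C‖ₑ ^ 2 * ENNReal.ofReal (1 / (2 * b - 2 * γ + 1)) := by
  rw [Q_const_mul]
  congr 1
  have h1 := lintegral_Ioo_rpow (κ := 2 * b - 2 * γ + 1) (by linarith) zero_le_one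
  rw [Real.one_rpow] at h1
  rw [← h1]
  refine setLIntegral_congr_fun measurableSet_Ioo fun s hs => ?_
  simp only [enorm_ofReal_rpow hs.1, ofReal_rpow_sq hs.1, ofReal_rpow_mul hs.1]
  congr 2
  ring

theorem inQ_rpow {γ b : ℝ} (hb : γ - 1 / 2 < b) (C : ℂ) :
    InQ γ (fun s => C * ((s ^ b : ℝ) : ℂ)) :=
  ⟨(aestronglyMeasurable_rpow b _).const_mul C, by
    rw [Q_rpow hb]; exact ENNReal.mul_lt_top (by simp) ENNReal.ofReal_lt_top⟩

/-- `∫ s^(2b - 2γ)` diverges at `0`. This threshold separates leading terms from remainders and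
excludes homogeneous solutions from the weighted spaces. -/
theorem eq_zero_of_inQ_rpow {γ b : ℝ} (hb : b ≤ γ - 1 / 2) {C : ℂ}
    (H : InQ γ fun s => C * ((s ^ b : ℝ) : ℂ)) : C = 0 := by
  by_contra hC
  have h1 := H.lt_top
  rw [Q_const_mul] at h1
  have h2 : Q γ (fun s => ((s ^ b : ℝ) : ℂ)) < ⊤ := by
    refine lt_top_iff_ne_top.2 fun h => ?_
    rw [h, ENNReal.mul_top (by simpa using hC)] at h1
    exact absurd h1 (by simp)
  have h3 : Q γ (fun s => ((s ^ b : ℝ) : ℂ)) =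
      ∫⁻ s in Ioo (0 : ℝ) 1, ‖s ^ (2 * b - 2 * γ)‖ₑ := by
    refine setLIntegral_congr_fun measurableSet_Ioo fun s hs => ?_
    simp only [enorm_ofReal_rpow hs.1, ofReal_rpow_sq hs.1, ofReal_rpow_mul hs.1]
    rw [← ofReal_norm, Real.norm_of_nonneg (Real.rpow_nonneg hs.1.le _)]
    congr 2
    ring
  rw [h3] at h2
  have h4 : IntegrableOn (fun s : ℝ => s ^ (2 * b - 2 * γ)) (Ioo 0 1) :=
    ⟨(measurable_id.pow_const _).aestronglyMeasurable, h2⟩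
  rw [intervalIntegral.integrableOn_Ioo_rpow_iff zero_lt_one] at h4
  linarith

/-- By Cauchy–Schwarz, since the hypothesis says precisely that `s^(2(b + γ))` is integrable at `0`.
-/
theorem InQ.integrableOn_rpow_mul {γ b : ℝ} {h : ℝ → ℂ} (H : InQ γ h) (hb : 0 < b + γ + 1 / 2) :
    IntegrableOn (fun s => ((s ^ b : ℝ) : ℂ) * h s) (Ioo 0 1) := by
  refine ⟨(aestronglyMeasurable_rpow b _).mul H.1, ?_⟩
  have h1 := lintegral_rpow_mul_sq_le (γ := γ) (b := b) Subset.rfl measurableSet_Ioo H.1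
  have h2 := lintegral_Ioo_rpow (κ := 2 * (b + γ) + 1) (by linarith) zero_le_one
  rw [add_sub_cancel_right] at h2
  rw [h2] at h1
  have h3 := h1.trans_lt (ENNReal.mul_lt_top ENNReal.ofReal_lt_top H.2)
  have h4 : ∫⁻ s in Ioo (0 : ℝ) 1, ‖((s ^ b : ℝ) : ℂ) * h s‖ₑ =
      ∫⁻ s in Ioo (0 : ℝ) 1, ENNReal.ofReal (s ^ b) * ‖h s‖ₑ := by
    refine setLIntegral_congr_fun measurableSet_Ioo fun s hs => ?_
    simp only [enorm_mul, enorm_ofReal_rpow hs.1]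
  rw [HasFiniteIntegral, h4]
  exact (ENNReal.pow_lt_top_iff.1 h3).resolve_right (by norm_num)

/-- Away from `0` the exponent is irrelevant: a large one, `|b| + |γ|`, gives integrability, and the
quotient of the two powers is continuous on `[a, 1]`. -/
theorem InQ.integrableOn_Ioo {γ a : ℝ} {h : ℝ → ℂ} (H : InQ γ h) (ha : 0 < a) (b : ℝ) :
    IntegrableOn (fun s => ((s ^ b : ℝ) : ℂ) * h s) (Ioo a 1) := by
  have h1 := (H.integrableOn_rpow_mul (b := |b| + |γ|) (by
    have := neg_abs_le γ; have := abs_nonneg b; linarith)).mono_set (Ioo_subset_Ioo_left ha.le)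
  have h2 : IntegrableOn (fun s : ℝ => ((s ^ (b - (|b| + |γ|)) : ℝ) : ℂ) *
      (((s ^ (|b| + |γ|) : ℝ) : ℂ) * h s)) (Ioo a 1) := by
    have hc : ContinuousOn (fun s : ℝ => ((s ^ (b - (|b| + |γ|)) : ℝ) : ℂ)) (Icc a 1) :=
      (continuousOn_ofReal_rpow _).mono fun s hs => ha.trans_le hs.1
    rw [← integrableOn_Icc_iff_integrableOn_Ioo] at h1 ⊢
    exact h1.continuousOn_mul hc isCompact_Icc
  refine h2.congr_fun (fun s hs => ?_) measurableSet_Ioo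
  have hs0 : 0 < s := ha.trans hs.1
  simp only [← mul_assoc, ← Complex.ofReal_mul, ← Real.rpow_add hs0]
  congr 4
  ring

theorem InQ.locInt1 {γ : ℝ} {h : ℝ → ℂ} (H : InQ γ h) : LocInt1 h := by
  intro a b ha hb
  have h1 := (H.integrableOn_Ioo (half_pos ha) 0).mono_set
    (s := Icc a b) fun s hs => ⟨by linarith [hs.1], by linarith [hs.2]⟩
  simpa using h1

/-! ### Hardy inequalities -/

/-- The Schur test with power weights for the kernel `s^(-c) r^(c - 1)` cut off to a region `A`. It
covers integration from `0` and from `1` at once: only `A` and the sign of `κ` differ. -/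
theorem Q_le_of_kernel {γ c κ : ℝ} {M : ℝ≥0∞} (hκ : κ = c + γ - 1 / 2) {A : Set (ℝ × ℝ)}
    (hA : MeasurableSet A)
    (h1 : ∀ s ∈ Ioo (0 : ℝ) 1, ∫⁻ r in Ioo (0 : ℝ) 1,
      A.indicator (fun z => ENNReal.ofReal (z.2 ^ (κ - 1))) (s, r) ≤ M * ENNReal.ofReal (s ^ κ))
    (h2 : ∀ r ∈ Ioo (0 : ℝ) 1, ∫⁻ s in Ioo (0 : ℝ) 1,
      A.indicator (fun z => ENNReal.ofReal (z.1 ^ (-κ - 1))) (s, r) ≤ M * ENNReal.ofReal (r ^ (-κ)))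
    {F G : ℝ → ℂ} (hF : AEStronglyMeasurable F (volume.restrict (Ioo 0 1)))
    (hG : ∀ s ∈ Ioo (0 : ℝ) 1, ‖G s‖ₑ ≤ ENNReal.ofReal (s ^ (-c)) * ∫⁻ r in Ioo (0 : ℝ) 1,
      A.indicator (fun z => ENNReal.ofReal (z.2 ^ (c - 1)) * ‖F z.2‖ₑ) (s, r)) :
    Q γ G ≤ M ^ 2 * Q γ F := by
  set μ : Measure ℝ := volume.restrict (Ioo 0 1) with hμ
  have hFp : AEStronglyMeasurable (fun z : ℝ × ℝ => F z.2) (μ.prod μ) := hF.comp_snd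
  have hbd : ∀ s ∈ Ioo (0 : ℝ) 1, ENNReal.ofReal (s ^ (-2 * γ)) * ‖G s‖ₑ ^ 2 ≤
      M * ∫⁻ r, A.indicator (fun z => ENNReal.ofReal (z.1 ^ (-κ - 1)) *
        (ENNReal.ofReal (z.2 ^ (2 * c - κ - 1)) * ‖F z.2‖ₑ ^ 2)) (s, r) ∂μ := by
    intro s hs
    have hAs : MeasurableSet {r | (s, r) ∈ A} := measurable_prodMk_left hA
    -- The splitting `r^(c-1) = r^((κ-1)/2) · r^((2c-κ-1)/2)` prepares Cauchy–Schwarz: the square of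
    -- the first factor is what `h1` integrates. The powers of `s` that remain combine to
    -- `s^(-κ-1)`, which `h2` integrates after Tonelli.
    have e1 : ∫⁻ r, A.indicator (fun z => ENNReal.ofReal (z.2 ^ (c - 1)) * ‖F z.2‖ₑ) (s, r) ∂μ =
        ∫⁻ r, A.indicator (fun z => ENNReal.ofReal (z.2 ^ ((κ - 1) / 2))) (s, r) *
          (ENNReal.ofReal (r ^ ((2 * c - κ - 1) / 2)) *
            A.indicator (fun z => ‖F z.2‖ₑ) (s, r)) ∂μ := by
      refine setLIntegral_congr_fun measurableSet_Ioo fun r hr => ?_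
      by_cases hz : (s, r) ∈ A
      · simp only [indicator_of_mem hz, ← mul_assoc, ofReal_rpow_mul hr.1]
        congr 3
        ring
      · simp [indicator_of_notMem hz]
    have m1 : AEMeasurable (fun r => A.indicator
        (fun z => ENNReal.ofReal (z.2 ^ ((κ - 1) / 2))) (s, r)) μ :=
      ((((measurable_ofReal_rpow _).comp measurable_snd).indicator hA).comp
        measurable_prodMk_left).aemeasurable
    have m2 : AEMeasurable (fun r => A.indicator (fun z => ‖F z.2‖ₑ) (s, r)) μ :=
      (hF.enorm.indicator hAs : _)
    have e2 := lintegral_mul_sq_le μ m1 ((measurable_ofReal_rpow ((2 * c - κ - 1) / 2)).aemeasurable.mul m2)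
    have e3 : ∫⁻ r, A.indicator (fun z => ENNReal.ofReal (z.2 ^ ((κ - 1) / 2))) (s, r) ^ 2 ∂μ ≤
        M * ENNReal.ofReal (s ^ κ) := by
      refine le_trans (le_of_eq ?_) (h1 s hs)
      refine setLIntegral_congr_fun measurableSet_Ioo fun r hr => ?_
      by_cases hz : (s, r) ∈ A
      · simp only [indicator_of_mem hz, ofReal_rpow_sq hr.1]
        congr 2
        ring
      · simp [indicator_of_notMem hz]
    calc ENNReal.ofReal (s ^ (-2 * γ)) * ‖G s‖ₑ ^ 2
        ≤ ENNReal.ofReal (s ^ (-2 * γ)) * (ENNReal.ofReal (s ^ (-c)) *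
          ∫⁻ r, A.indicator (fun z => ENNReal.ofReal (z.2 ^ (c - 1)) * ‖F z.2‖ₑ) (s, r) ∂μ) ^ 2 := by
          gcongr
          exact hG s hs
      _ ≤ ENNReal.ofReal (s ^ (-2 * γ)) * (ENNReal.ofReal (s ^ (-c)) ^ 2 *
          ((M * ENNReal.ofReal (s ^ κ)) * ∫⁻ r, (ENNReal.ofReal (r ^ ((2 * c - κ - 1) / 2)) *
            A.indicator (fun z => ‖F z.2‖ₑ) (s, r)) ^ 2 ∂μ)) := by
          rw [mul_pow, e1]
          gcongr
          exact e2.trans (mul_le_mul_left e3 _)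
      _ = M * (ENNReal.ofReal (s ^ (-κ - 1)) *
          ∫⁻ r, (ENNReal.ofReal (r ^ ((2 * c - κ - 1) / 2)) *
            A.indicator (fun z => ‖F z.2‖ₑ) (s, r)) ^ 2 ∂μ) := by
          have : ENNReal.ofReal (s ^ (-κ - 1)) = ENNReal.ofReal (s ^ (-2 * γ)) *
              ENNReal.ofReal (s ^ (-c)) ^ 2 * ENNReal.ofReal (s ^ κ) := by
            rw [ofReal_rpow_sq hs.1, ofReal_rpow_mul hs.1, ofReal_rpow_mul hs.1]
            congr 2
            rw [hκ]
            ring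
          rw [this]
          ring
      _ = _ := by
          rw [← lintegral_const_mul' _ _ ENNReal.ofReal_ne_top]
          congr 1
          refine setLIntegral_congr_fun measurableSet_Ioo fun r hr => ?_
          by_cases hz : (s, r) ∈ A
          · simp only [indicator_of_mem hz, mul_pow, ofReal_rpow_sq hr.1]
            congr 4
            ring
          · simp [indicator_of_notMem hz]
  have hmeas : AEMeasurable (fun z : ℝ × ℝ => A.indicator (fun z =>
      ENNReal.ofReal (z.1 ^ (-κ - 1)) *
        (ENNReal.ofReal (z.2 ^ (2 * c - κ - 1)) * ‖F z.2‖ₑ ^ 2)) z) (μ.prod μ) :=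
    ((((measurable_ofReal_rpow _).comp measurable_fst).aemeasurable.mul
      (((measurable_ofReal_rpow _).comp measurable_snd).aemeasurable.mul
        (hFp.enorm.pow_const 2)))).indicator hA
  calc Q γ G ≤ ∫⁻ s, M * ∫⁻ r, A.indicator (fun z => ENNReal.ofReal (z.1 ^ (-κ - 1)) *
        (ENNReal.ofReal (z.2 ^ (2 * c - κ - 1)) * ‖F z.2‖ₑ ^ 2)) (s, r) ∂μ ∂μ :=
        setLIntegral_mono_ae' measurableSet_Ioo (Filter.Eventually.of_forall hbd)
    _ = M * ∫⁻ r, ∫⁻ s, A.indicator (fun z => ENNReal.ofReal (z.1 ^ (-κ - 1)) *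
        (ENNReal.ofReal (z.2 ^ (2 * c - κ - 1)) * ‖F z.2‖ₑ ^ 2)) (s, r) ∂μ ∂μ := by
        rw [lintegral_const_mul'' _ hmeas.lintegral_prod_right', lintegral_lintegral_swap hmeas]
    _ ≤ M * ∫⁻ r, M * (ENNReal.ofReal (r ^ (-2 * γ)) * ‖F r‖ₑ ^ 2) ∂μ := by
        gcongr M * ?_
        refine setLIntegral_mono_ae' measurableSet_Ioo (Filter.Eventually.of_forall fun r hr => ?_)
        have e4 : ∀ s, A.indicator (fun z => ENNReal.ofReal (z.1 ^ (-κ - 1)) *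
            (ENNReal.ofReal (z.2 ^ (2 * c - κ - 1)) * ‖F z.2‖ₑ ^ 2)) (s, r) =
            A.indicator (fun z => ENNReal.ofReal (z.1 ^ (-κ - 1))) (s, r) *
              (ENNReal.ofReal (r ^ (2 * c - κ - 1)) * ‖F r‖ₑ ^ 2) := by
          intro s
          by_cases hz : (s, r) ∈ A
          · simp only [indicator_of_mem hz]
          · simp [indicator_of_notMem hz]
        simp only [e4]
        rw [lintegral_mul_const' _ _ (ENNReal.mul_ne_top ENNReal.ofReal_ne_top (by simp))]
        calc _ ≤ M * ENNReal.ofReal (r ^ (-κ)) *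
              (ENNReal.ofReal (r ^ (2 * c - κ - 1)) * ‖F r‖ₑ ^ 2) := by
              gcongr
              exact h2 r hr
          _ = _ := by
              rw [mul_assoc M, ← mul_assoc (ENNReal.ofReal _) (ENNReal.ofReal _),
                ofReal_rpow_mul hr.1]
              congr 4
              rw [hκ]
              ring
    _ = M ^ 2 * Q γ F := by
        have hm : AEMeasurable (fun r => ENNReal.ofReal (r ^ (-2 * γ)) * ‖F r‖ₑ ^ 2) μ :=
          (measurable_ofReal_rpow _).aemeasurable.mul (hF.enorm.pow_const 2)
        rw [lintegral_const_mul'' M hm, ← mul_assoc, sq, Q]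

/-- The solution `h = ψ ^ (-c) ∫_0^ψ r ^ (c - 1) F(r) dr` of `(D + c) h = F`. -/
def solve₀ (c : ℝ) (F : ℝ → ℂ) (s : ℝ) : ℂ :=
  ((s ^ (-c) : ℝ) : ℂ) * ∫ r in (0 : ℝ)..s, ((r ^ (c - 1) : ℝ) : ℂ) * F r

/-- The solution `h = - ψ ^ (-c) ∫_ψ^1 r ^ (c - 1) F(r) dr` of `(D + c) h = F`. -/
def solve₁ (c : ℝ) (F : ℝ → ℂ) (s : ℝ) : ℂ :=
  ((s ^ (-c) : ℝ) : ℂ) * ∫ r in (1 : ℝ)..s, ((r ^ (c - 1) : ℝ) : ℂ) * F r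

theorem enorm_integral_rpow_le {c : ℝ} {F : ℝ → ℂ} {B : Set ℝ} (hB : MeasurableSet B)
    (hB1 : B ⊆ Ioo 0 1) :
    ‖∫ r in B, ((r ^ (c - 1) : ℝ) : ℂ) * F r‖ₑ ≤
      ∫⁻ r in B, ENNReal.ofReal (r ^ (c - 1)) * ‖F r‖ₑ := by
  refine (enorm_integral_le_lintegral_enorm _).trans (le_of_eq ?_)
  refine setLIntegral_congr_fun hB fun r hr => ?_
  simp only [enorm_mul, enorm_ofReal_rpow (hB1 hr).1]

theorem setLIntegral_indicator_prod {B : Set ℝ} {A : Set (ℝ × ℝ)} {s : ℝ} (hB : MeasurableSet B)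
    (hBA : ∀ r ∈ Ioo (0 : ℝ) 1, (s, r) ∈ A ↔ r ∈ B) (hB1 : B ⊆ Ioo 0 1) (f : ℝ × ℝ → ℝ≥0∞) :
    ∫⁻ r in Ioo (0 : ℝ) 1, A.indicator f (s, r) = ∫⁻ r in B, f (s, r) := by
  rw [← inter_eq_left.2 hB1, ← Measure.restrict_restrict hB, ← lintegral_indicator hB]
  refine setLIntegral_congr_fun measurableSet_Ioo fun r hr => ?_
  by_cases h : r ∈ B
  · simp [indicator, h, (hBA r hr).2 h]
  · simp [indicator, h, (hBA r hr).not.2 h]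

theorem setLIntegral_indicator_prod' {B : Set ℝ} {A : Set (ℝ × ℝ)} {r : ℝ} (hB : MeasurableSet B)
    (hBA : ∀ s ∈ Ioo (0 : ℝ) 1, (s, r) ∈ A ↔ s ∈ B) (hB1 : B ⊆ Ioo 0 1) (f : ℝ × ℝ → ℝ≥0∞) :
    ∫⁻ s in Ioo (0 : ℝ) 1, A.indicator f (s, r) = ∫⁻ s in B, f (s, r) := by
  rw [← inter_eq_left.2 hB1, ← Measure.restrict_restrict hB, ← lintegral_indicator hB]
  refine setLIntegral_congr_fun measurableSet_Ioo fun s hs => ?_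
  by_cases h : s ∈ B
  · simp [indicator, h, (hBA s hs).2 h]
  · simp [indicator, h, (hBA s hs).not.2 h]

/-- Hardy's inequality at `0`. On the region `r < s` both Schur integrals converge because `κ > 0`,
each with constant `1/κ`. -/
theorem Q_solve₀_le {γ c : ℝ} (hκ : 0 < c + γ - 1 / 2) {F : ℝ → ℂ}
    (hF : AEStronglyMeasurable F (volume.restrict (Ioo 0 1))) :
    Q γ (solve₀ c F) ≤ ENNReal.ofReal (1 / (c + γ - 1 / 2)) ^ 2 * Q γ F := by
  set κ := c + γ - 1 / 2 with hκ'
  have hA : MeasurableSet {z : ℝ × ℝ | z.2 < z.1} :=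
    measurableSet_lt measurable_snd measurable_fst
  have hB : ∀ s ∈ Ioo (0 : ℝ) 1, Ioo 0 s ⊆ Ioo 0 1 := fun s hs => Ioo_subset_Ioo_right hs.2.le
  have hBA : ∀ s ∈ Ioo (0 : ℝ) 1, ∀ r ∈ Ioo (0 : ℝ) 1,
      (s, r) ∈ {z : ℝ × ℝ | z.2 < z.1} ↔ r ∈ Ioo 0 s := fun s _ r hr =>
    ⟨fun h => ⟨hr.1, h⟩, fun h => h.2⟩
  refine Q_le_of_kernel hκ' hA (fun s hs => ?_) (fun r hr => ?_) hF fun s hs => ?_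
  · rw [setLIntegral_indicator_prod measurableSet_Ioo (hBA s hs) (hB s hs),
      lintegral_Ioo_rpow hκ hs.1.le, ← ENNReal.ofReal_mul (by positivity)]
    exact (congrArg _ (by ring)).le
  · rw [setLIntegral_indicator_prod' (B := Ioo r 1) measurableSet_Ioo
      (fun s hs => ⟨fun h => ⟨h, hs.2⟩, fun h => h.1⟩) (Ioo_subset_Ioo_left hr.1.le)]
    refine (lintegral_mono_set Ioo_subset_Ioi_self).trans ?_
    rw [lintegral_Ioi_rpow hκ hr.1, ← ENNReal.ofReal_mul (by positivity)]
    exact (congrArg _ (by ring)).le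
  · rw [setLIntegral_indicator_prod measurableSet_Ioo (hBA s hs) (hB s hs), solve₀, enorm_mul,
      enorm_ofReal_rpow hs.1, intervalIntegral.integral_of_le hs.1.le, integral_Ioc_eq_integral_Ioo]
    gcongr
    exact enorm_integral_rpow_le measurableSet_Ioo (hB s hs)

/-- The dual Hardy inequality: on the region `s < r` the Schur integrals converge when the exponent
is negative. -/
theorem Q_solve₁_le {γ c : ℝ} (hκ : c + γ - 1 / 2 < 0) {F : ℝ → ℂ}
    (hF : AEStronglyMeasurable F (volume.restrict (Ioo 0 1))) :
    Q γ (solve₁ c F) ≤ ENNReal.ofReal (1 / -(c + γ - 1 / 2)) ^ 2 * Q γ F := by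
  -- Here `κ` is positive; the Schur test is applied with `-κ`, which exchanges the roles of the two
  -- power integrals.
  obtain ⟨κ, hκ'⟩ : ∃ κ, κ = -(c + γ - 1 / 2) := ⟨_, rfl⟩
  have hκ0 : 0 < κ := by linarith
  have hκ'' : -κ = c + γ - 1 / 2 := by linarith
  rw [← hκ']
  have hA : MeasurableSet {z : ℝ × ℝ | z.1 < z.2} :=
    measurableSet_lt measurable_fst measurable_snd
  have hB : ∀ s ∈ Ioo (0 : ℝ) 1, Ioo s 1 ⊆ Ioo 0 1 := fun s hs => Ioo_subset_Ioo_left hs.1.le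
  have hBA : ∀ s ∈ Ioo (0 : ℝ) 1, ∀ r ∈ Ioo (0 : ℝ) 1,
      (s, r) ∈ {z : ℝ × ℝ | z.1 < z.2} ↔ r ∈ Ioo s 1 := fun s _ r hr =>
    ⟨fun h => ⟨h, hr.2⟩, fun h => h.1⟩
  refine Q_le_of_kernel hκ'' hA (fun s hs => ?_) (fun r hr => ?_) hF fun s hs => ?_
  · rw [setLIntegral_indicator_prod measurableSet_Ioo (hBA s hs) (hB s hs)]
    refine (lintegral_mono_set Ioo_subset_Ioi_self).trans ?_
    rw [lintegral_Ioi_rpow hκ0 hs.1, ← ENNReal.ofReal_mul (by positivity)]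
    exact (congrArg _ (by ring)).le
  · rw [setLIntegral_indicator_prod' (B := Ioo 0 r) measurableSet_Ioo
      (fun s hs => ⟨fun h => ⟨hs.1, h⟩, fun h => h.2⟩) (Ioo_subset_Ioo_right hr.2.le)]
    simp only [neg_neg]
    rw [lintegral_Ioo_rpow hκ0 hr.1.le, ← ENNReal.ofReal_mul (by positivity)]
    exact (congrArg _ (by ring)).le
  · rw [setLIntegral_indicator_prod measurableSet_Ioo (hBA s hs) (hB s hs), solve₁, enorm_mul,
      enorm_ofReal_rpow hs.1, intervalIntegral.integral_symm, enorm_neg,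
      intervalIntegral.integral_of_le hs.2.le, integral_Ioc_eq_integral_Ioo]
    gcongr
    exact enorm_integral_rpow_le measurableSet_Ioo (hB s hs)

/-! ### The operator `D = ψ ∂_ψ` on the interval -/

theorem ae_mem_Ioo_restrict : ∀ᵐ s ∂volume.restrict (Ioo (0 : ℝ) 1), s ∈ Ioo (0 : ℝ) 1 :=
  ae_restrict_mem measurableSet_Ioo

namespace HasD

variable {h d h' d' : ℝ → ℂ}

theorem congr (H : HasD h d) (hh : h =ᵐ[volume.restrict (Ioo 0 1)] h')
    (hd : d =ᵐ[volume.restrict (Ioo 0 1)] d') : HasD h' d' := by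
  refine WeakDeriv1.congr H hh ?_
  filter_upwards [hd] with s hs
  rw [hs]

theorem add (H : HasD h d) (H' : HasD h' d') : HasD (h + h') (d + d') := by
  refine (WeakDeriv1.add H H').congr (Filter.EventuallyEq.refl _ _)
    (Filter.Eventually.of_forall fun s => ?_)
  simp [add_div]

theorem const_mul (H : HasD h d) (c : ℂ) : HasD (fun s => c * h s) (fun s => c * d s) := by
  refine (WeakDeriv1.const_mul H c).congr (Filter.EventuallyEq.refl _ _)
    (Filter.Eventually.of_forall fun s => ?_)
  simp [mul_div_assoc]

theorem rpow_mul (H : HasD h d) (a : ℝ) : HasD (fun s => ((s ^ a : ℝ) : ℂ) * h s)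
    (fun s => ((s ^ a : ℝ) : ℂ) * d s + a * (((s ^ a : ℝ) : ℂ) * h s)) := by
  refine (WeakDeriv1.rpow_mul H a).congr (Filter.EventuallyEq.refl _ _) ?_
  filter_upwards [ae_mem_Ioo_restrict] with s hs
  have h0 : (s : ℂ) ≠ 0 := by exact_mod_cast hs.1.ne'
  rw [Real.rpow_sub_one hs.1.ne']
  push_cast
  field_simp

theorem unique (H : HasD h d) (H' : HasD h d') : d =ᵐ[volume.restrict (Ioo 0 1)] d' := by
  filter_upwards [WeakDeriv1.unique H H', ae_mem_Ioo_restrict] with s h1 hs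
  have h0 : (s : ℂ) ≠ 0 := by exact_mod_cast hs.1.ne'
  exact (div_left_inj' h0).1 h1

theorem locInt1_right (H : HasD h d) : LocInt1 d := by
  refine (LocInt1.rpow_mul H.2.1 1).congr ?_
  filter_upwards [ae_mem_Ioo_restrict] with s hs
  have h0 : (s : ℂ) ≠ 0 := by exact_mod_cast hs.1.ne'
  rw [Real.rpow_one, mul_div_cancel₀ _ h0]

/-- `ψ^c` is an integrating factor: `ψ^c h` has zero weak derivative, hence is constant. -/
theorem ae_eq_rpow {c : ℝ} (H : HasD h fun s => -c * h s) :
    ∃ C : ℂ, h =ᵐ[volume.restrict (Ioo 0 1)] fun s => C * ((s ^ (-c) : ℝ) : ℂ) := by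
  have h0 : HasD (fun s => ((s ^ c : ℝ) : ℂ) * h s) 0 := by
    refine (H.rpow_mul c).congr (Filter.EventuallyEq.refl _ _) (Filter.Eventually.of_forall ?_)
    intro s
    simp only [Pi.zero_apply]
    ring
  have h1 : WeakDeriv1 (fun s => ((s ^ c : ℝ) : ℂ) * h s) 0 :=
    WeakDeriv1.congr h0 (Filter.EventuallyEq.refl _ _)
      (Filter.Eventually.of_forall fun s => by simp)
  obtain ⟨C, hC⟩ := h1.ae_eq_const
  refine ⟨C, ?_⟩
  filter_upwards [hC, ae_mem_Ioo_restrict] with s h1 hs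
  rw [← h1, mul_comm, ← mul_assoc, ← Complex.ofReal_mul, ← Real.rpow_add hs.1]
  simp

end HasD

theorem hasD_rpow (b : ℝ) (C : ℂ) :
    HasD (fun s => C * ((s ^ b : ℝ) : ℂ)) fun s => b * (C * ((s ^ b : ℝ) : ℂ)) := by
  have h1 : HasD (fun _ => C) 0 := by
    refine WeakDeriv1.of_primitive (LocInt1.of_continuousOn ?_) fun a b _ _ _ => by simp
    simpa using continuousOn_const
  refine (h1.rpow_mul b).congr (Filter.Eventually.of_forall fun s => ?_)
    (Filter.Eventually.of_forall fun s => ?_)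
  · simp only [mul_comm]
  · simp only [Pi.zero_apply]
    ring

theorem continuousOn_Ioc_of_Icc {α : Type*} [TopologicalSpace α] {f : ℝ → α}
    (h : ∀ a, 0 < a → ContinuousOn f (Icc a 1)) : ContinuousOn f (Ioc 0 1) := by
  intro s hs
  have h1 := h (s / 2) (half_pos hs.1) s ⟨by linarith [hs.1], hs.2⟩
  refine h1.mono_of_mem_nhdsWithin ?_
  filter_upwards [self_mem_nhdsWithin, mem_nhdsWithin_of_mem_nhds
    (isOpen_Ioi.mem_nhds (show s ∈ Ioi (s / 2) from half_lt_self hs.1))] with r hr hr'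
  exact ⟨(mem_Ioi.1 hr').le, hr.2⟩

/-- Continuity up to `1` carries equality almost everywhere on the open interval over to the
endpoint, which makes boundary values at `1` well defined. -/
theorem eqOn_Ioc_of_ae_eq {f g : ℝ → ℂ} (hf : ContinuousOn f (Ioc 0 1))
    (hg : ContinuousOn g (Ioc 0 1)) (h : f =ᵐ[volume.restrict (Ioo 0 1)] g) :
    EqOn f g (Ioc 0 1) := by
  rw [Measure.restrict_congr_set Ioo_ae_eq_Ioc] at h
  refine Measure.eqOn_of_ae_eq h hf hg ?_
  rw [interior_Ioc, closure_Ioo zero_ne_one]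
  exact Ioc_subset_Icc_self

theorem InQ.of_continuousOn_meas {h : ℝ → ℂ} (hc : ContinuousOn h (Ioc 0 1)) :
    AEStronglyMeasurable h (volume.restrict (Ioo 0 1)) :=
  (hc.mono Ioo_subset_Ioc_self).aestronglyMeasurable measurableSet_Ioo

/-! ### The explicit solutions of `(D + c) h = F` -/

section Solve

variable {γ c : ℝ} {F : ℝ → ℂ}

theorem continuousOn_solve₀ (hκ : 0 < c + γ - 1 / 2) (hF : InQ γ F) :
    ContinuousOn (solve₀ c F) (Ioc 0 1) := by
  have h1 := hF.integrableOn_rpow_mul (b := c - 1) (by linarith)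
  rw [← integrableOn_Icc_iff_integrableOn_Ioo] at h1
  have h2 := intervalIntegral.continuousOn_primitive_interval (μ := volume)
    (by rw [uIcc_of_le zero_le_one]; exact h1)
  rw [uIcc_of_le zero_le_one] at h2
  exact ((continuousOn_ofReal_rpow _).mono fun s hs => hs.1).mul (h2.mono Ioc_subset_Icc_self)

theorem inQ_solve₀ (hκ : 0 < c + γ - 1 / 2) (hF : InQ γ F) : InQ γ (solve₀ c F) :=
  ⟨InQ.of_continuousOn_meas (continuousOn_solve₀ hκ hF), (Q_solve₀_le hκ hF.1).trans_lt
    (ENNReal.mul_lt_top (by simp) hF.2)⟩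

/-- Variation of constants, independent of the base point of the primitive, so that both explicit
solutions are covered. -/
theorem hasD_of_primitive {P : ℝ → ℂ} (hF : InQ γ F) (hP : ∀ a b : ℝ, 0 < a → a ≤ b → b < 1 →
    P b - P a = ∫ s in a..b, ((s ^ (c - 1) : ℝ) : ℂ) * F s) :
    HasD (fun s => ((s ^ (-c) : ℝ) : ℂ) * P s)
      fun s => F s - c * (((s ^ (-c) : ℝ) : ℂ) * P s) := by
  have h1 : WeakDeriv1 P fun s => ((s ^ (c - 1) : ℝ) : ℂ) * F s :=
    WeakDeriv1.of_primitive (hF.locInt1.rpow_mul _) hP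
  refine (h1.rpow_mul (-c)).congr (Filter.EventuallyEq.refl _ _) ?_
  filter_upwards [ae_mem_Ioo_restrict] with s hs
  have h0 : (s : ℂ) ≠ 0 := by exact_mod_cast hs.1.ne'
  have h2 : ((s ^ (-c) : ℝ) : ℂ) * ((s ^ c : ℝ) : ℂ) = 1 := by
    rw [← Complex.ofReal_mul, ← Real.rpow_add hs.1]
    simp
  rw [Real.rpow_sub_one hs.1.ne', Real.rpow_sub_one hs.1.ne']
  push_cast at h2 ⊢
  field_simp
  linear_combination F s * h2

theorem hasD_solve₀ (hκ : 0 < c + γ - 1 / 2) (hF : InQ γ F) :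
    HasD (solve₀ c F) fun s => F s - c * solve₀ c F s := by
  refine hasD_of_primitive hF fun a b ha hab hb => ?_
  have h1 := hF.integrableOn_rpow_mul (b := c - 1) (by linarith)
  rw [← integrableOn_Icc_iff_integrableOn_Ioo] at h1
  have hi : ∀ s, 0 ≤ s → s ≤ 1 →
      IntervalIntegrable (fun s => ((s ^ (c - 1) : ℝ) : ℂ) * F s) volume 0 s := by
    intro s hs hs1
    rw [intervalIntegrable_iff_integrableOn_Icc_of_le hs]
    exact h1.mono_set (Icc_subset_Icc_right hs1)
  exact intervalIntegral.integral_interval_sub_left (hi b (ha.le.trans hab) hb.le)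
    (hi a ha.le (hab.trans hb.le))

theorem intervalIntegrable_one (hF : InQ γ F) {s : ℝ} (hs : 0 < s) (hs1 : s ≤ 1) (b : ℝ) :
    IntervalIntegrable (fun s => ((s ^ b : ℝ) : ℂ) * F s) volume 1 s := by
  refine IntervalIntegrable.symm ?_
  rw [intervalIntegrable_iff_integrableOn_Ioo_of_le hs1]
  exact hF.integrableOn_Ioo hs b

theorem continuousOn_solve₁ (c : ℝ) (hF : InQ γ F) : ContinuousOn (solve₁ c F) (Ioc 0 1) := by
  refine continuousOn_Ioc_of_Icc fun a ha => ?_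
  rcases lt_or_ge 1 a with h | h
  · simp [h]
  have h1 := hF.integrableOn_Ioo ha (c - 1)
  rw [← integrableOn_Icc_iff_integrableOn_Ioo] at h1
  have h2 := intervalIntegral.continuousOn_primitive_interval (μ := volume) (a := 1) (b := a)
    (by rw [uIcc_of_ge h]; exact h1)
  rw [uIcc_of_ge h] at h2
  exact ((continuousOn_ofReal_rpow _).mono fun s hs => ha.trans_le hs.1).mul h2

theorem inQ_solve₁ (hκ : c + γ - 1 / 2 < 0) (hF : InQ γ F) : InQ γ (solve₁ c F) :=
  ⟨InQ.of_continuousOn_meas (continuousOn_solve₁ c hF), (Q_solve₁_le hκ hF.1).trans_lt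
    (ENNReal.mul_lt_top (by simp) hF.2)⟩

theorem hasD_solve₁ (c : ℝ) (hF : InQ γ F) :
    HasD (solve₁ c F) fun s => F s - c * solve₁ c F s := by
  refine hasD_of_primitive hF fun a b ha hab hb => ?_
  exact intervalIntegral.integral_interval_sub_left
    (intervalIntegrable_one hF (ha.trans_le hab) hb.le _)
    (intervalIntegrable_one hF ha (hab.trans hb.le) _)

end Solve

/-- The difference solves the homogeneous equation, so it is a multiple of `ψ^(-c)`; as `-c < γ -
1/2`, this power is not in the weighted space. The resulting formula gives a representative that is
continuous up to `ψ = 1`. -/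
theorem HasD.ae_eq_solve₀ {γ c : ℝ} {h d : ℝ → ℂ} (hκ : 0 < c + γ - 1 / 2) (H : HasD h d)
    (hh : InQ γ h) (hd : InQ γ d) :
    h =ᵐ[volume.restrict (Ioo 0 1)] solve₀ c fun s => d s + c * h s := by
  have hF : InQ γ fun s => d s + c * h s := hd.add (hh.const_mul c)
  have h1 : HasD (fun s => h s + -1 * solve₀ c (fun s => d s + c * h s) s)
      fun s => -c * (h s + -1 * solve₀ c (fun s => d s + c * h s) s) := by
    refine (H.add ((hasD_solve₀ hκ hF).const_mul (-1))).congr (Filter.EventuallyEq.refl _ _)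
      (Filter.Eventually.of_forall fun s => ?_)
    simp only [Pi.add_apply]
    ring
  obtain ⟨C, hC⟩ := h1.ae_eq_rpow
  have h2 : InQ γ fun s => C * ((s ^ (-c) : ℝ) : ℂ) :=
    (hh.add ((inQ_solve₀ hκ hF).const_mul (-1))).congr hC
  have h3 : C = 0 := eq_zero_of_inQ_rpow (by linarith) h2
  filter_upwards [hC] with s hs
  rw [h3] at hs
  linear_combination hs

/-- The boundary value at `ψ = 1` of a function `h` with `D h = d`. -/
def bdry (h d : ℝ → ℂ) : ℂ := ∫ s in Ioo (0 : ℝ) 1, (d s + h s)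

theorem solve₀_at_one (c : ℝ) (F : ℝ → ℂ) :
    solve₀ c F 1 = ∫ s in Ioo (0 : ℝ) 1, ((s ^ (c - 1) : ℝ) : ℂ) * F s := by
  rw [solve₀, intervalIntegral.integral_of_le zero_le_one, integral_Ioc_eq_integral_Ioo]
  simp

/-- Since `D h + h = (ψ h)'`, the integral that defines `bdry` is the representation formula with `c
= 1`, evaluated at `1`. -/
theorem bdry_eq_of_continuousOn {γ : ℝ} {h d H : ℝ → ℂ} (hγ : 0 ≤ γ) (hd' : HasD h d)
    (hh : InQ γ h) (hd : InQ γ d) (hH : ContinuousOn H (Ioc 0 1))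
    (hae : h =ᵐ[volume.restrict (Ioo 0 1)] H) : bdry h d = H 1 := by
  have hκ : 0 < 1 + γ - 1 / 2 := by linarith
  have h1 := hd'.ae_eq_solve₀ hκ hh hd
  simp only [Complex.ofReal_one, one_mul] at h1
  have h2 := eqOn_Ioc_of_ae_eq hH (continuousOn_solve₀ hκ (hd.add hh)) (hae.symm.trans h1) (right_mem_Ioc.2 zero_lt_one)
  rw [h2, solve₀_at_one]
  simp [bdry]

/-- The boundary value is also `∫ s^(c-1) (d + c h)` for every admissible `c`, and Cauchy–Schwarz
gains a factor of order `1/c`. The freedom in `c` is what later yields the trace estimate with half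
an order of loss. -/
theorem enorm_bdry_sq_le {γ c : ℝ} {h d : ℝ → ℂ} (hγ : 0 ≤ γ) (hκ : 0 < c + γ - 1 / 2)
    (H : HasD h d) (hh : InQ γ h) (hd : InQ γ d) :
    ‖bdry h d‖ₑ ^ 2 ≤ ENNReal.ofReal (1 / (2 * (c + γ - 1 / 2))) *
      Q γ (fun s => d s + c * h s) := by
  have hF : InQ γ fun s => d s + c * h s := hd.add (hh.const_mul c)
  rw [bdry_eq_of_continuousOn hγ H hh hd (continuousOn_solve₀ hκ hF) (H.ae_eq_solve₀ hκ hh hd),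
    solve₀_at_one]
  have h1 := lintegral_rpow_mul_sq_le (γ := γ) (b := c - 1) Subset.rfl measurableSet_Ioo hF.1
  have h2 := lintegral_Ioo_rpow (κ := 2 * (c - 1 + γ) + 1) (by linarith) zero_le_one
  rw [add_sub_cancel_right] at h2
  rw [h2, Real.one_rpow] at h1
  calc _ ≤ (∫⁻ s in Ioo (0 : ℝ) 1, ENNReal.ofReal (s ^ (c - 1)) * ‖d s + c * h s‖ₑ) ^ 2 := by
        gcongr
        exact enorm_integral_rpow_le measurableSet_Ioo Subset.rfl
    _ ≤ _ := h1
    _ = _ := by congr 4; ring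

/-! ### Fourier series on `Π` -/

theorem eLpNorm_two_sq {α : Type*} [MeasurableSpace α] (f : α → ℂ) (μ : Measure α) :
    eLpNorm f 2 μ ^ 2 = ∫⁻ a, ‖f a‖ₑ ^ 2 ∂μ := by
  have h := eLpNorm_nnreal_pow_eq_lintegral (f := f) (μ := μ) (p := 2) two_ne_zero
  simpa [ENNReal.rpow_two] using h

theorem lintegral_enorm_sq_lt_top {α : Type*} [MeasurableSpace α] {f : α → ℂ} {μ : Measure α}
    (hf : MemLp f 2 μ) : ∫⁻ a, ‖f a‖ₑ ^ 2 ∂μ < ⊤ := by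
  rw [← eLpNorm_two_sq]
  exact ENNReal.pow_lt_top hf.2

theorem memLp_two_of_lintegral {α : Type*} [MeasurableSpace α] {f : α → ℂ} {μ : Measure α}
    (hm : AEStronglyMeasurable f μ) (hf : ∫⁻ a, ‖f a‖ₑ ^ 2 ∂μ < ⊤) : MemLp f 2 μ := by
  rw [← eLpNorm_two_sq] at hf
  exact ⟨hm, (ENNReal.pow_lt_top_iff.1 hf).resolve_right (by norm_num)⟩

theorem enorm_sq_eq_ofReal (a : ℂ) : ‖a‖ₑ ^ 2 = ENNReal.ofReal (‖a‖ ^ 2) := by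
  rw [← ofReal_norm, ENNReal.ofReal_pow (norm_nonneg _)]

theorem lintegral_enorm_sq_eq_tsum {f : Circ → ℂ} (hf : MemLp f 2 haarAddCircle) :
    ∫⁻ x, ‖f x‖ₑ ^ 2 ∂haarAddCircle = ∑' k : ℤ, ‖fourierCoeff f k‖ₑ ^ 2 := by
  have h1 := hasSum_sq_fourierCoeff (hf.toLp f)
  have h2 : ∀ k, fourierCoeff (hf.toLp f) k = fourierCoeff f k := fun k => by
    rw [fourierCoeff_congr_ae hf.coeFn_toLp]
  have h3 : ∫ x, ‖hf.toLp f x‖ ^ 2 ∂haarAddCircle = ∫ x, ‖f x‖ ^ 2 ∂haarAddCircle := by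
    refine integral_congr_ae ?_
    filter_upwards [hf.coeFn_toLp] with x hx
    rw [hx]
  simp only [h2, h3] at h1
  simp only [enorm_sq_eq_ofReal]
  rw [← ofReal_integral_eq_lintegral_ofReal ((memLp_two_iff_integrable_sq_norm hf.1).1 hf)
    (Filter.Eventually.of_forall fun x => sq_nonneg _), ← h1.tsum_eq,
    ENNReal.ofReal_tsum_of_nonneg (fun k => sq_nonneg _) h1.summable]

theorem aestronglyMeasurable_modeCoeff {u : ℝ × Circ → ℂ} (hu : AEStronglyMeasurable u piMeasure)
    (k : ℤ) : AEStronglyMeasurable (modeCoeff u k) (volume.restrict (Ioo 0 1)) := by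
  have h : AEStronglyMeasurable (fun z : ℝ × Circ => fourier (-k) z.2 • u z) piMeasure :=
    ((fourier (-k)).continuous.comp continuous_snd).aestronglyMeasurable.smul hu
  exact h.integral_prod_right'

theorem lintegral_weighted {γ : ℝ} {f : ℝ × Circ → ℝ≥0∞} (hf : AEMeasurable f piMeasure) :
    ∫⁻ z, f z ∂weightedMeasure γ = ∫⁻ s in Ioo (0 : ℝ) 1, ENNReal.ofReal (s ^ (-2 * γ)) *
      ∫⁻ x, f (s, x) ∂haarAddCircle := by
  rw [weightedMeasure, lintegral_withDensity_eq_lintegral_mul₀ (measurable_weight γ).aemeasurable hf,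
    piMeasure, lintegral_prod _ ((measurable_weight γ).aemeasurable.mul hf)]
  refine lintegral_congr fun s => ?_
  simp only [Pi.mul_apply]
  rw [lintegral_const_mul' _ _ ENNReal.ofReal_ne_top]

theorem aestronglyMeasurable_pi {γ : ℝ} {u : ℝ × Circ → ℂ}
    (hu : AEStronglyMeasurable u (weightedMeasure γ)) : AEStronglyMeasurable u piMeasure :=
  hu.mono_ac (ac_weighted γ)

/-- Parseval's identity on `Π`. -/
theorem lintegral_weighted_eq_tsum {γ : ℝ} {u : ℝ × Circ → ℂ}
    (hu : MemLp u 2 (weightedMeasure γ)) :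
    ∫⁻ z, ‖u z‖ₑ ^ 2 ∂weightedMeasure γ = ∑' k : ℤ, Q γ (modeCoeff u k) := by
  have hm := aestronglyMeasurable_pi hu.1
  have h1 : ∀ k, AEMeasurable (fun s => ENNReal.ofReal (s ^ (-2 * γ)) * ‖modeCoeff u k s‖ₑ ^ 2)
      (volume.restrict (Ioo 0 1)) := fun k => (measurable_ofReal_rpow _).aemeasurable.mul
      ((aestronglyMeasurable_modeCoeff hm k).enorm.pow_const 2)
  simp only [Q]
  rw [lintegral_weighted (hm.enorm.pow_const 2), ← lintegral_tsum h1]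
  refine lintegral_congr_ae ?_
  filter_upwards [memLp_slice hu] with s hs
  rw [lintegral_enorm_sq_eq_tsum hs, ← ENNReal.tsum_mul_left]
  rfl

theorem enorm_sq_eq_tsum {γ : ℝ} (u : Lp ℂ 2 (weightedMeasure γ)) :
    ‖u‖ₑ ^ 2 = ∑' k : ℤ, Q γ (modeCoeff u k) := by
  rw [← lintegral_weighted_eq_tsum (Lp.memLp u), ← eLpNorm_two_sq, Lp.enorm_def]

theorem inQ_modeCoeff {γ : ℝ} {u : ℝ × Circ → ℂ} (hu : MemLp u 2 (weightedMeasure γ)) (k : ℤ) :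
    InQ γ (modeCoeff u k) := by
  refine ⟨aestronglyMeasurable_modeCoeff (aestronglyMeasurable_pi hu.1) k, ?_⟩
  have h := lintegral_enorm_sq_lt_top hu
  rw [lintegral_weighted_eq_tsum hu] at h
  exact (ENNReal.le_tsum k).trans_lt h

theorem modeCoeff_congr {u v : ℝ × Circ → ℂ} (h : u =ᵐ[piMeasure] v) (k : ℤ) :
    modeCoeff u k =ᵐ[volume.restrict (Ioo 0 1)] modeCoeff v k := by
  filter_upwards [Measure.ae_ae_of_ae_prod h] with s hs
  exact congrFun (fourierCoeff_congr_ae hs) k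

theorem modeCoeff_add {γ γ' : ℝ} {u v : ℝ × Circ → ℂ} (hu : MemLp u 2 (weightedMeasure γ))
    (hv : MemLp v 2 (weightedMeasure γ')) (k : ℤ) :
    modeCoeff (u + v) k =ᵐ[volume.restrict (Ioo 0 1)] modeCoeff u k + modeCoeff v k := by
  filter_upwards [memLp_slice hu, memLp_slice hv] with s hu hv
  exact congrFun (fourierCoeff.add (hu.integrable (by norm_num)) (hv.integrable (by norm_num))) k

theorem modeCoeff_const_mul (c : ℂ) (u : ℝ × Circ → ℂ) (k : ℤ) (s : ℝ) :
    modeCoeff (fun z => c * u z) k s = c * modeCoeff u k s :=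
  fourierCoeff.const_mul _ c k

theorem ae_eq_of_modeCoeff {γ : ℝ} {u v : ℝ × Circ → ℂ} (hu : MemLp u 2 (weightedMeasure γ))
    (hv : MemLp v 2 (weightedMeasure γ))
    (h : ∀ k, modeCoeff u k =ᵐ[volume.restrict (Ioo 0 1)] modeCoeff v k) :
    u =ᵐ[piMeasure] v := by
  have h1 := ae_eq_zero_of_modeCoeff (hu.add (hv.const_mul (-1))) fun k => by
    filter_upwards [h k, modeCoeff_add hu (hv.const_mul (-1)) k] with s h1 h2
    rw [h2, Pi.add_apply, modeCoeff_const_mul, h1]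
    ring
  filter_upwards [ae_of_weighted h1] with z hz
  simp only [Pi.add_apply, Pi.zero_apply] at hz
  linear_combination hz

/-- The function `h(ψ) exp (i k θ)`. -/
def modeFun (k : ℤ) (h : ℝ → ℂ) (z : ℝ × Circ) : ℂ := h z.1 * fourier k z.2

theorem enorm_fourier (k : ℤ) (x : Circ) : ‖fourier k x‖ₑ = 1 := by
  rw [← ofReal_norm, fourier_apply, Circle.norm_coe, ENNReal.ofReal_one]

theorem norm_fourier_apply (k : ℤ) (x : Circ) : ‖fourier k x‖ = 1 := by
  rw [fourier_apply, Circle.norm_coe]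

theorem aestronglyMeasurable_modeFun (k : ℤ) {h : ℝ → ℂ}
    (hm : AEStronglyMeasurable h (volume.restrict (Ioo 0 1))) :
    AEStronglyMeasurable (modeFun k h) piMeasure :=
  hm.comp_fst.mul ((fourier k).continuous.comp continuous_snd).aestronglyMeasurable

theorem memLp_modeFun {γ : ℝ} (k : ℤ) {h : ℝ → ℂ} (hh : InQ γ h) :
    MemLp (modeFun k h) 2 (weightedMeasure γ) := by
  have hm := aestronglyMeasurable_modeFun k hh.1
  refine memLp_two_of_lintegral (hm.mono_ac (weighted_ac γ)) ?_
  rw [lintegral_weighted (hm.enorm.pow_const 2)]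
  simp only [modeFun, enorm_mul, enorm_fourier, mul_one, lintegral_const, measure_univ]
  exact hh.2

theorem modeCoeff_modeFun (k : ℤ) (h : ℝ → ℂ) (n : ℤ) (s : ℝ) :
    modeCoeff (modeFun k h) n s = if n = k then h s else 0 := by
  have : modeCoeff (modeFun k h) n s = h s * fourierCoeff (fourier k : Circ → ℂ) n :=
    fourierCoeff.const_mul _ (h s) n
  rw [this, fourierCoeff_fourier, Pi.single_apply]
  split_ifs <;> simp

theorem modeCoeff_sum_modeFun {γ : ℝ} {h : ℤ → ℝ → ℂ} (hh : ∀ k, InQ γ (h k)) (t : Finset ℤ)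
    (n : ℤ) : modeCoeff (∑ k ∈ t, (memLp_modeFun k (hh k)).toLp : Lp ℂ 2 (weightedMeasure γ)) n
      =ᵐ[volume.restrict (Ioo 0 1)] fun s => if n ∈ t then h n s else 0 := by
  induction t using Finset.induction_on with
  | empty =>
    refine (modeCoeff_congr (ae_of_weighted (Lp.coeFn_zero ℂ 2 (weightedMeasure γ))) n).trans
      (Filter.Eventually.of_forall fun s => ?_)
    simp [modeCoeff, fourierCoeff]
  | insert k t hk ih =>
    rw [Finset.sum_insert hk]
    refine (modeCoeff_congr (ae_of_weighted (Lp.coeFn_add _ _)) n).trans ?_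
    filter_upwards [modeCoeff_add (Lp.memLp (memLp_modeFun k (hh k)).toLp)
      (Lp.memLp (∑ k ∈ t, (memLp_modeFun k (hh k)).toLp)) n, ih,
      modeCoeff_congr (ae_of_weighted (memLp_modeFun k (hh k)).coeFn_toLp) n] with s h1 h2 h3
    rw [h1, Pi.add_apply, h2, h3, modeCoeff_modeFun]
    by_cases hnk : n = k
    · subst hnk
      simp [hk]
    · simp [hnk]

theorem enorm_sum_modeFun {γ : ℝ} {h : ℤ → ℝ → ℂ} (hh : ∀ k, InQ γ (h k)) (t : Finset ℤ) :
    ‖(∑ k ∈ t, (memLp_modeFun k (hh k)).toLp : Lp ℂ 2 (weightedMeasure γ))‖ₑ ^ 2 =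
      ∑ k ∈ t, Q γ (h k) := by
  rw [enorm_sq_eq_tsum, tsum_eq_sum (s := t)]
  · refine Finset.sum_congr rfl fun k hk => Q_congr ?_
    filter_upwards [modeCoeff_sum_modeFun hh t k] with s hs
    rw [hs, if_pos hk]
  · intro k hk
    rw [Q_congr (modeCoeff_sum_modeFun hh t k)]
    simp [Q, hk]

theorem Q_eq_zero_iff {γ : ℝ} {h : ℝ → ℂ}
    (hm : AEStronglyMeasurable h (volume.restrict (Ioo 0 1))) :
    Q γ h = 0 ↔ h =ᵐ[volume.restrict (Ioo 0 1)] 0 := by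
  have h1 : AEMeasurable (fun s => ENNReal.ofReal (s ^ (-2 * γ)) * ‖h s‖ₑ ^ 2)
      (volume.restrict (Ioo 0 1)) :=
    (measurable_ofReal_rpow _).aemeasurable.mul (hm.enorm.pow_const 2)
  rw [Q, lintegral_eq_zero_iff' h1]
  refine ⟨fun H => ?_, fun H => ?_⟩
  · filter_upwards [H, ae_mem_Ioo_restrict] with s hs h0
    have h2 : ENNReal.ofReal (s ^ (-2 * γ)) ≠ 0 := by
      simpa using Real.rpow_pos_of_pos h0.1 _
    simp only [Pi.zero_apply, mul_eq_zero, h2, false_or] at hs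
    simpa using hs
  · filter_upwards [H] with s hs
    simp [hs]

/-- Riesz–Fischer on `Π`: distinct modes are orthogonal, so finite partial sums have squared norm `∑
Q γ (h k)` and the series is Cauchy. -/
theorem exists_hasSum_modeFun {γ : ℝ} {h : ℤ → ℝ → ℂ} (hh : ∀ k, InQ γ (h k))
    (hsum : ∑' k, Q γ (h k) < ⊤) :
    ∃ u : Lp ℂ 2 (weightedMeasure γ), HasSum (fun k => (memLp_modeFun k (hh k)).toLp) u ∧
      ∀ k, modeCoeff u k =ᵐ[volume.restrict (Ioo 0 1)] h k := by
  have hS : Summable fun k => ((memLp_modeFun k (hh k)).toLp : Lp ℂ 2 (weightedMeasure γ)) := by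
    rw [summable_iff_vanishing_norm]
    intro ε hε
    obtain ⟨s, hs⟩ := summable_iff_vanishing_norm.1 (ENNReal.summable_toReal hsum.ne) (ε ^ 2)
      (by positivity)
    refine ⟨s, fun t ht => ?_⟩
    have h1 := hs t ht
    have h2 := congrArg ENNReal.toReal (enorm_sum_modeFun hh t)
    rw [ENNReal.toReal_pow, toReal_enorm, ENNReal.toReal_sum fun k _ => (hh k).2.ne] at h2
    rw [← h2, Real.norm_of_nonneg (by positivity)] at h1
    exact lt_of_pow_lt_pow_left₀ 2 hε.le h1
  refine ⟨_, hS.hasSum, fun k => ?_⟩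
  set u := ∑' k, ((memLp_modeFun k (hh k)).toLp : Lp ℂ 2 (weightedMeasure γ)) with hu
  have hm : AEStronglyMeasurable (modeCoeff u k + fun s => -1 * h k s)
      (volume.restrict (Ioo 0 1)) :=
    (inQ_modeCoeff (Lp.memLp u) k).1.add ((hh k).1.const_mul (-1))
  -- By Parseval one mode of the error is dominated by the whole error, which tends to zero; this
  -- identifies the modes of the limit.
  have h1 : ∀ t : Finset ℤ, k ∈ t → Q γ (modeCoeff u k + fun s => -1 * h k s) ≤
      ‖u - ∑ k ∈ t, ((memLp_modeFun k (hh k)).toLp : Lp ℂ 2 (weightedMeasure γ))‖ₑ ^ 2 := by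
    intro t ht
    rw [enorm_sq_eq_tsum]
    refine le_trans (le_of_eq (Q_congr ?_)) (ENNReal.le_tsum k)
    have hc : ((u - ∑ k ∈ t, (memLp_modeFun k (hh k)).toLp : Lp ℂ 2 (weightedMeasure γ)) :
        ℝ × Circ → ℂ) =ᵐ[piMeasure] u + fun z => -1 *
          (∑ k ∈ t, (memLp_modeFun k (hh k)).toLp : Lp ℂ 2 (weightedMeasure γ)) z := by
      filter_upwards [ae_of_weighted (Lp.coeFn_sub u
        (∑ k ∈ t, (memLp_modeFun k (hh k)).toLp))] with z hz
      rw [hz, Pi.sub_apply, Pi.add_apply]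
      ring
    filter_upwards [modeCoeff_congr hc k, modeCoeff_add (Lp.memLp u)
      ((Lp.memLp (∑ k ∈ t, (memLp_modeFun k (hh k)).toLp)).const_mul (-1)) k,
      modeCoeff_sum_modeFun hh t k] with s h1 h2 h3
    rw [h1, h2, Pi.add_apply, Pi.add_apply, modeCoeff_const_mul, h3, if_pos ht]
  have h2 : Filter.Tendsto (fun t : Finset ℤ => ‖u - ∑ k ∈ t,
      ((memLp_modeFun k (hh k)).toLp : Lp ℂ 2 (weightedMeasure γ))‖ₑ ^ 2) Filter.atTop
      (nhds 0) := by
    have h3 := (tendsto_const_nhds (x := u)).sub hS.hasSum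
    rw [sub_self] at h3
    have h4 := ENNReal.Tendsto.pow (n := 2) h3.enorm
    simpa using h4
  have h3 : Q γ (modeCoeff u k + fun s => -1 * h k s) ≤ 0 := by
    refine ge_of_tendsto h2 ?_
    filter_upwards [Filter.eventually_ge_atTop ({k} : Finset ℤ)] with t ht
    exact h1 t (ht (Finset.mem_singleton_self k))
  have h4 := (Q_eq_zero_iff hm).1 (le_antisymm h3 zero_le)
  filter_upwards [h4] with s hs
  simp only [Pi.add_apply, Pi.zero_apply] at hs
  linear_combination hs

/-! ### Test functions and their Fourier modes -/

theorem Test1.isTest {g : ℝ → ℂ} (hg : Test1 g) (k : ℤ) : IsTest (modeFun k g) := by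
  obtain ⟨a, b, ha, hb, hab⟩ := hg.support
  refine ⟨?_, a, b, ha, hb, fun z hz => hab z.1 (left_ne_zero_of_mul hz)⟩
  have h1 : (fun z : ℝ × ℝ => modeFun k g (z.1, (z.2 : Circ))) =
      fun z => g z.1 * Complex.exp (2 * π * Complex.I * k * (z.2 : ℂ) / (2 * π : ℝ)) := by
    ext z
    rw [modeFun, fourier_coe_apply]
  rw [h1]
  have h3 : ContDiff ℝ ∞ fun z : ℝ × ℝ => (z.2 : ℂ) := Complex.ofRealCLM.contDiff.comp contDiff_snd
  exact (hg.smooth.comp contDiff_fst).mul ((contDiff_const.mul h3).div_const _).cexp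

theorem IsTest.rpow_mul {φ : ℝ × Circ → ℂ} (h : IsTest φ) (c : ℝ) :
    IsTest fun z => ((z.1 ^ c : ℝ) : ℂ) * φ z := by
  obtain ⟨a, b, ha, hb, hab⟩ := h.support
  refine ⟨contDiff_iff_contDiffAt.2 fun z => ?_, a, b, ha, hb, fun z hz =>
    hab z (right_ne_zero_of_mul hz)⟩
  by_cases hz : 0 < z.1
  · exact ((contDiffAt_ofReal_rpow c hz).comp (f := fun z : ℝ × ℝ => z.1) z
      contDiffAt_fst).mul h.smooth.contDiffAt
  · have : (fun z : ℝ × ℝ => ((z.1 ^ c : ℝ) : ℂ) * φ (z.1, (z.2 : Circ))) =ᶠ[nhds z]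
        fun _ => 0 := by
      filter_upwards [(isOpen_Iio.preimage continuous_fst).mem_nhds
        (show z ∈ Prod.fst ⁻¹' Iio a by simp only [mem_preimage, mem_Iio]; linarith)] with r hr
      have : φ (r.1, (r.2 : Circ)) = 0 := by
        by_contra h0
        exact absurd (hab _ h0).1 (not_le.2 hr)
      simp [this]
    exact contDiffAt_const.congr_of_eventuallyEq this

theorem IsTest.exists_bound {φ : ℝ × Circ → ℂ} (h : IsTest φ) : ∃ C : ℝ, ∀ z, ‖φ z‖ ≤ C := by
  obtain ⟨a, b, ha, hb, hab⟩ := h.support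
  have hc : IsCompact (Icc a b ×ˢ (univ : Set Circ)) := isCompact_Icc.prod isCompact_univ
  obtain ⟨C, hC⟩ := hc.exists_bound_of_continuousOn h.continuous.continuousOn
  refine ⟨max C 0, fun z => ?_⟩
  by_cases h0 : φ z = 0
  · simp [h0]
  · exact (hC z ⟨hab z h0, mem_univ _⟩).trans (le_max_left _ _)

theorem IsTest.hasDerivAt_psi {φ : ℝ × Circ → ℂ} (h : IsTest φ) (s : ℝ) (x : Circ) :
    HasDerivAt (fun r => φ (r, x)) (FlowLines.dPsi φ (s, x)) s := by
  obtain ⟨t, rfl⟩ := QuotientAddGroup.mk_surjective x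
  have h1 : ContDiff ℝ ∞ fun r : ℝ => φ (r, (t : Circ)) :=
    h.smooth.comp (contDiff_id.prodMk contDiff_const)
  exact (h1.differentiable (by simp)).differentiableAt.hasDerivAt

theorem IsTest.hasDerivAt_theta {φ : ℝ × Circ → ℂ} (h : IsTest φ) (s : ℝ) (x : Circ) (t : ℝ) :
    HasDerivAt (fun r : ℝ => φ (s, x + (r : Circ))) (FlowLines.dTheta φ (s, x + (t : Circ))) t := by
  obtain ⟨y, rfl⟩ := QuotientAddGroup.mk_surjective x
  have h1 : ContDiff ℝ ∞ fun r : ℝ => φ (s, (y : Circ) + (r : Circ)) := by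
    have := h.smooth.comp (contDiff_const.prodMk (contDiff_const.add contDiff_id) :
      ContDiff ℝ ∞ fun r : ℝ => (s, y + r))
    simpa [Function.comp_def] using this
  have h2 : HasDerivAt (fun r : ℝ => φ (s, (y : Circ) + (r : Circ)))
      (_root_.deriv (fun r : ℝ => φ (s, (y : Circ) + (r : Circ))) t) t :=
    (h1.differentiable (by simp)).differentiableAt.hasDerivAt
  have h3 : FlowLines.dTheta φ (s, (y : Circ) + (t : Circ)) =
      _root_.deriv (fun r : ℝ => φ (s, (y : Circ) + (r : Circ))) t := by
    have h4 := h2.deriv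
    have h5 : HasDerivAt (fun r : ℝ => φ (s, (y : Circ) + (t : Circ) + (r : Circ)))
        (_root_.deriv (fun r : ℝ => φ (s, (y : Circ) + (r : Circ))) t) 0 := by
      have h6 : HasDerivAt (fun r : ℝ => φ (s, (y : Circ) + (r : Circ)))
        (_root_.deriv (fun r : ℝ => φ (s, (y : Circ) + (r : Circ))) t) (t + 0) := by simpa using h2
      have := h6.comp_const_add t 0
      simpa [add_assoc] using this
    exact h5.deriv
  rw [h3]
  exact h2

theorem IsTest.integrable_slice {φ : ℝ × Circ → ℂ} (h : IsTest φ) (k : ℤ) (s : ℝ) :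
    Integrable (fun x => fourier (-k) x • φ (s, x)) haarAddCircle :=
  (((fourier (-k)).continuous.smul (h.continuous.comp (Continuous.prodMk_right s)))).integrable_of_hasCompactSupport
    (HasCompactSupport.of_compactSpace _)

/-- Differentiation under the integral, dominated by the constant that bounds `∂_ψ φ`. -/
theorem IsTest.hasDerivAt_modeCoeff {φ : ℝ × Circ → ℂ} (h : IsTest φ) (k : ℤ) (s : ℝ) :
    HasDerivAt (modeCoeff φ k) (modeCoeff (FlowLines.dPsi φ) k s) s := by
  obtain ⟨C, hC⟩ := h.dPsi.exists_bound
  refine (hasDerivAt_integral_of_dominated_loc_of_deriv_le (bound := fun _ => C)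
    (F := fun s x => fourier (-k) x • φ (s, x))
    (F' := fun s x => fourier (-k) x • FlowLines.dPsi φ (s, x)) (s := univ) Filter.univ_mem
    (Filter.Eventually.of_forall fun r => (h.integrable_slice k r).1) (h.integrable_slice k s)
    (h.dPsi.integrable_slice k s).1 (Filter.Eventually.of_forall fun x r _ => ?_)
    (integrable_const C) (Filter.Eventually.of_forall fun x r _ => ?_)).2
  · rw [norm_smul, norm_fourier_apply, one_mul]
    exact hC _
  · simp only [smul_eq_mul]
    exact (h.hasDerivAt_psi r x).const_mul _

theorem IsTest.modeCoeff_dPsi {φ : ℝ × Circ → ℂ} (h : IsTest φ) (k : ℤ) :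
    modeCoeff (FlowLines.dPsi φ) k = _root_.deriv (modeCoeff φ k) :=
  funext fun s => (h.hasDerivAt_modeCoeff k s).deriv.symm

theorem IsTest.contDiff_modeCoeff {φ : ℝ × Circ → ℂ} (h : IsTest φ) (k : ℤ) (n : ℕ) :
    ContDiff ℝ n (modeCoeff φ k) := by
  induction n generalizing φ with
  | zero =>
    exact contDiff_zero.2 (continuous_iff_continuousAt.2 fun s =>
      (h.hasDerivAt_modeCoeff k s).continuousAt)
  | succ n ih =>
    have h1 : ContDiff ℝ ((n : ℕ∞ω) + 1) (modeCoeff φ k) := by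
      rw [contDiff_succ_iff_deriv]
      refine ⟨fun s => (h.hasDerivAt_modeCoeff k s).differentiableAt, by simp, ?_⟩
      rw [← h.modeCoeff_dPsi]
      exact ih h.dPsi
    exact_mod_cast h1

theorem IsTest.test1_modeCoeff {φ : ℝ × Circ → ℂ} (h : IsTest φ) (k : ℤ) :
    Test1 (modeCoeff φ k) := by
  obtain ⟨a, b, ha, hb, hab⟩ := h.support
  refine ⟨contDiff_infty.2 fun n => h.contDiff_modeCoeff k n, a, b, ha, hb, fun s hs => ?_⟩
  by_contra h0
  apply hs
  have : ∀ x, φ (s, x) = 0 := by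
    intro x
    by_contra h1
    exact h0 (hab (s, x) h1)
  simp [modeCoeff, this, fourierCoeff]

/-- Integration by parts on the circle is replaced by translation invariance: translating `φ` by `t`
multiplies its coefficient by `exp (i k t)`, and both sides are differentiated at `t = 0`. -/
theorem IsTest.modeCoeff_dTheta {φ : ℝ × Circ → ℂ} (h : IsTest φ) (k : ℤ) (s : ℝ) :
    modeCoeff (FlowLines.dTheta φ) k s = (Complex.I * k) * modeCoeff φ k s := by
  obtain ⟨C, hC⟩ := h.dTheta.exists_bound
  have hi : ∀ t : ℝ, Integrable (fun x => fourier (-k) x • φ (s, x + (t : Circ)))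
      haarAddCircle := fun t =>
    ((fourier (-k)).continuous.smul (h.continuous.comp
      (continuous_const.prodMk (continuous_id.add continuous_const)))).integrable_of_hasCompactSupport
      (HasCompactSupport.of_compactSpace _)
  have h1 : HasDerivAt (fun t : ℝ => ∫ x, fourier (-k) x • φ (s, x + (t : Circ)) ∂haarAddCircle)
      (∫ x, fourier (-k) x • FlowLines.dTheta φ (s, x + ((0 : ℝ) : Circ)) ∂haarAddCircle) 0 := by
    refine (hasDerivAt_integral_of_dominated_loc_of_deriv_le (bound := fun _ => C)
      (F := fun (t : ℝ) x => fourier (-k) x • φ (s, x + (t : Circ)))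
      (F' := fun (t : ℝ) x => fourier (-k) x • FlowLines.dTheta φ (s, x + (t : Circ)))
      (s := univ) Filter.univ_mem
      (Filter.Eventually.of_forall fun r => (hi r).1) (hi 0) ?_
      (Filter.Eventually.of_forall fun x r _ => ?_)
      (integrable_const C) (Filter.Eventually.of_forall fun x r _ => ?_)).2
    · simpa using (h.dTheta.integrable_slice k s).1
    · rw [norm_smul, norm_fourier_apply, one_mul]
      exact hC _
    · simp only [smul_eq_mul]
      exact (h.hasDerivAt_theta s x r).const_mul _
  have h2 : ∀ t : ℝ, ∫ x, fourier (-k) x • φ (s, x + (t : Circ)) ∂haarAddCircle =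
      fourier k (t : Circ) * modeCoeff φ k s := by
    intro t
    rw [← integral_sub_right_eq_self (μ := haarAddCircle) _ (t : Circ)]
    rw [modeCoeff, fourierCoeff, ← integral_const_mul]
    refine integral_congr_ae (Filter.Eventually.of_forall fun x => ?_)
    simp only [sub_add_cancel, smul_eq_mul]
    rw [sub_eq_add_neg]
    have e1 : fourier (-k) (x + -(t : Circ)) = fourier (-k) x * fourier k (t : Circ) := by
      simp only [fourier_apply, smul_add, toCircle_add, Circle.coe_mul, neg_smul, smul_neg, neg_neg]
    rw [e1]
    ring
  simp only [h2] at h1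
  have h3 : HasDerivAt (fun t : ℝ => fourier k (t : Circ) * modeCoeff φ k s)
      ((2 * π * Complex.I * k / (2 * π : ℝ) * fourier k ((0 : ℝ) : Circ)) * modeCoeff φ k s) 0 :=
    (hasDerivAt_fourier (2 * π) k 0).mul_const _
  have h4 := h1.unique h3
  simp only [QuotientAddGroup.mk_zero, add_zero] at h4
  have hpi : (π : ℂ) ≠ 0 := by exact_mod_cast Real.pi_ne_zero
  rw [modeCoeff, fourierCoeff, h4, fourier_eval_zero]
  push_cast
  field_simp

theorem dPsi_modeFun (k : ℤ) {g : ℝ → ℂ} (hg : Test1 g) :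
    FlowLines.dPsi (modeFun k g) = modeFun k (deriv g) := by
  ext z
  have h1 : HasDerivAt g (deriv g z.1) z.1 :=
    (hg.smooth.differentiable (by simp)).differentiableAt.hasDerivAt
  exact (h1.mul_const (fourier k z.2)).deriv

theorem dTheta_modeFun (k : ℤ) (g : ℝ → ℂ) :
    FlowLines.dTheta (modeFun k g) = modeFun k fun s => (Complex.I * k) * g s := by
  ext z
  have h1 : ∀ t : ℝ, modeFun k g (z.1, z.2 + (t : Circ)) =
      g z.1 * fourier k z.2 * fourier k (t : Circ) := by
    intro t
    simp only [modeFun, fourier_apply, smul_add, toCircle_add, Circle.coe_mul]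
    ring
  have h3 : HasDerivAt (fun t : ℝ => modeFun k g (z.1, z.2 + (t : Circ)))
      (g z.1 * fourier k z.2 * (2 * π * Complex.I * k / (2 * π : ℝ) *
        fourier k ((0 : ℝ) : Circ))) 0 := by
    simp only [h1]
    exact (hasDerivAt_fourier (2 * π) k 0).const_mul _
  rw [FlowLines.dTheta, h3.deriv, QuotientAddGroup.mk_zero, fourier_eval_zero, modeFun]
  have hpi : (π : ℂ) ≠ 0 := by exact_mod_cast Real.pi_ne_zero
  push_cast
  field_simp

theorem Test1.iterate_deriv {g : ℝ → ℂ} (hg : Test1 g) (p : ℕ) : Test1 (_root_.deriv^[p] g) := by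
  induction p with
  | zero => exact hg
  | succ p ih => rw [Function.iterate_succ_apply']; exact ih.deriv

theorem iterate_modeFun (k : ℤ) {g : ℝ → ℂ} (hg : Test1 g) (p q : ℕ) :
    FlowLines.dPsi^[p] (FlowLines.dTheta^[q] (modeFun k g)) =
      modeFun k fun s => (Complex.I * k) ^ q * (deriv^[p] g) s := by
  have h1 : FlowLines.dTheta^[q] (modeFun k g) = modeFun k fun s => (Complex.I * k) ^ q * g s := by
    induction q with
    | zero => simp
    | succ q ih =>
      rw [Function.iterate_succ_apply', ih, dTheta_modeFun]
      congr 1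
      ext s
      ring
  rw [h1]
  induction p with
  | zero => rfl
  | succ p ih =>
    rw [Function.iterate_succ_apply', ih, dPsi_modeFun k ((hg.iterate_deriv p).const_mul _),
      Function.iterate_succ_apply']
    congr 1
    ext s
    exact deriv_const_mul _ ((hg.iterate_deriv p).smooth.differentiable (by simp)).differentiableAt

theorem IsTest.modeCoeff_iterate {φ : ℝ × Circ → ℂ} (h : IsTest φ) (p q : ℕ) (k : ℤ) (s : ℝ) :
    modeCoeff (FlowLines.dPsi^[p] (FlowLines.dTheta^[q] φ)) k s =
      (Complex.I * k) ^ q * (_root_.deriv^[p] (modeCoeff φ k)) s := by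
  have h1 : ∀ q, modeCoeff (FlowLines.dTheta^[q] φ) k = fun s =>
      (Complex.I * k) ^ q * modeCoeff φ k s := by
    intro q
    induction q with
    | zero => simp
    | succ q ih =>
      ext s
      rw [Function.iterate_succ_apply', IsTest.modeCoeff_dTheta (show IsTest (FlowLines.dTheta^[q] φ) from h.iterate 0 q),
        ih]
      ring
  have h2 : ∀ p, modeCoeff (FlowLines.dPsi^[p] (FlowLines.dTheta^[q] φ)) k = fun s =>
      (Complex.I * k) ^ q * (_root_.deriv^[p] (modeCoeff φ k)) s := by
    intro p
    induction p with
    | zero => rw [Function.iterate_zero, id, h1]; rfl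
    | succ p ih =>
      rw [Function.iterate_succ_apply', (h.iterate p q).modeCoeff_dPsi, ih]
      ext s
      rw [Function.iterate_succ_apply']
      exact deriv_const_mul _
        (((h.test1_modeCoeff k).iterate_deriv p).smooth.differentiable (by simp)).differentiableAt
  rw [h2]

/-! ### Pairing with a test function -/

theorem IsTest.memLp_pi {φ : ℝ × Circ → ℂ} (h : IsTest φ) : MemLp φ 2 piMeasure := by
  obtain ⟨C, hC⟩ := h.exists_bound
  have : IsFiniteMeasure piMeasure := by
    rw [piMeasure]
    have : IsFiniteMeasure (volume.restrict (Ioo (0 : ℝ) 1)) := ⟨by simp⟩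
    infer_instance
  exact MemLp.of_bound h.continuous.aestronglyMeasurable C (Filter.Eventually.of_forall hC)

/-- The pairing is the weighted inner product with the conjugate of `ψ^(2γ) φ`: the power cancels
the density of the measure, and it is harmless because `φ` is supported away from `ψ = 0`.
Continuity of such pairings is what lets weak derivatives and series pass to the limit. -/
theorem IsTest.exists_clm {φ : ℝ × Circ → ℂ} (h : IsTest φ) (γ : ℝ) :
    ∃ L : Lp ℂ 2 (weightedMeasure γ) →L[ℂ] ℂ, ∀ u, L u = ∫ z, u z * φ z ∂piMeasure := by
  set χ : ℝ × Circ → ℂ := fun z => (starRingEnd ℂ) (((z.1 ^ (2 * γ) : ℝ) : ℂ) * φ z) with hχ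
  have hχm : AEStronglyMeasurable χ piMeasure :=
    (Complex.continuous_conj.comp (h.rpow_mul (2 * γ)).continuous).aestronglyMeasurable
  have hχL : MemLp χ 2 (weightedMeasure γ) := by
    refine memLp_two_of_lintegral (hχm.mono_ac (weighted_ac γ)) ?_
    rw [weightedMeasure, lintegral_withDensity_eq_lintegral_mul₀ (measurable_weight γ).aemeasurable
      (hχm.enorm.pow_const 2)]
    refine lt_of_eq_of_lt ?_ (lintegral_enorm_sq_lt_top (h.rpow_mul γ).memLp_pi)
    refine lintegral_congr_ae ?_
    filter_upwards [ae_mem_Ioo] with z hz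
    simp only [Pi.mul_apply, hχ, RCLike.enorm_conj, enorm_mul, enorm_ofReal_rpow hz.1, mul_pow,
      ofReal_rpow_sq hz.1, ← mul_assoc, ofReal_rpow_mul hz.1]
    congr 3
    ring
  refine ⟨innerSL ℂ hχL.toLp, fun u => ?_⟩
  rw [innerSL_apply_apply, L2.inner_def]
  refine (integral_withDensity_eq_integral_toReal_smul (measurable_weight γ)
    (Filter.Eventually.of_forall fun _ => ENNReal.ofReal_lt_top) _).trans ?_
  refine integral_congr_ae ?_
  filter_upwards [ae_mem_Ioo, ae_of_weighted hχL.coeFn_toLp] with z hz hχz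
  have h1 : (hχL.toLp χ) z = χ z := hχz
  have h2 : ((z.1 ^ (-2 * γ) : ℝ) : ℂ) * ((z.1 ^ (2 * γ) : ℝ) : ℂ) = 1 := by
    rw [← Complex.ofReal_mul, ← Real.rpow_add hz.1]
    simp
  change (ENNReal.ofReal (z.1 ^ (-2 * γ))).toReal • inner ℂ ((hχL.toLp χ) z) (u z) = _
  rw [h1, ENNReal.toReal_ofReal (Real.rpow_nonneg hz.1.le _), Complex.real_smul, RCLike.inner_apply,
    hχ]
  simp only [Complex.conj_conj]
  linear_combination (u z * φ z) * h2

theorem integral_modeFun_mul {γ : ℝ} (k : ℤ) {h : ℝ → ℂ} (hh : InQ γ h) {φ : ℝ × Circ → ℂ}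
    (hφ : IsTest φ) : ∫ z, modeFun k h z * φ z ∂piMeasure =
      ∫ s in Ioo (0 : ℝ) 1, h s * modeCoeff φ (-k) s := by
  have hi := (locInt_of_memLp (memLp_modeFun k hh)).integrable_mul hφ
  rw [piMeasure] at hi ⊢
  rw [integral_prod _ hi]
  refine integral_congr_ae (Filter.Eventually.of_forall fun s => ?_)
  simp only [modeCoeff, fourierCoeff, neg_neg]
  rw [← integral_const_mul]
  refine integral_congr_ae (Filter.Eventually.of_forall fun x => ?_)
  simp only [modeFun, smul_eq_mul]
  ring

theorem integral_mul_modeFun {u : ℝ × Circ → ℂ} (hu : LocInt u) (k : ℤ) {g : ℝ → ℂ}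
    (hg : Test1 g) : ∫ z, u z * modeFun (-k) g z ∂piMeasure =
      ∫ s in Ioo (0 : ℝ) 1, modeCoeff u k s * g s := by
  have hi := hu.integrable_mul (hg.isTest (-k))
  rw [piMeasure] at hi ⊢
  rw [integral_prod _ hi]
  refine integral_congr_ae (Filter.Eventually.of_forall fun s => ?_)
  simp only [modeCoeff, fourierCoeff]
  rw [← integral_mul_const]
  refine integral_congr_ae (Filter.Eventually.of_forall fun x => ?_)
  simp only [modeFun, smul_eq_mul]
  ring

/-- The Fourier series of `u` converges in the weighted space, and the pairing is a continuous
functional there, so it may be applied term by term. -/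
theorem hasSum_pairing {γ : ℝ} (u : Lp ℂ 2 (weightedMeasure γ)) {φ : ℝ × Circ → ℂ}
    (hφ : IsTest φ) : HasSum (fun k => ∫ s in Ioo (0 : ℝ) 1, modeCoeff u k s * modeCoeff φ (-k) s)
      (∫ z, u z * φ z ∂piMeasure) := by
  have hh := fun k => inQ_modeCoeff (Lp.memLp u) k
  have hs : ∑' k, Q γ (modeCoeff u k) < ⊤ := by
    rw [← enorm_sq_eq_tsum]
    exact ENNReal.pow_lt_top enorm_lt_top
  obtain ⟨v, hv, hvm⟩ := exists_hasSum_modeFun hh hs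
  have huv : v = u := Lp.ext ((weighted_ac γ).ae_eq
    (ae_eq_of_modeCoeff (Lp.memLp v) (Lp.memLp u) hvm))
  rw [huv] at hv
  obtain ⟨L, hL⟩ := hφ.exists_clm γ
  have h1 := hv.mapL L
  rw [hL] at h1
  refine h1.congr_fun fun k => ?_
  rw [hL, ← integral_modeFun_mul k (hh k) hφ]
  refine integral_congr_ae ?_
  filter_upwards [ae_of_weighted (memLp_modeFun k (hh k)).coeFn_toLp] with z hz
  rw [hz]

/-! ### Weak derivatives and Fourier modes -/

theorem LocInt.locInt1_modeCoeff {u : ℝ × Circ → ℂ} (hu : LocInt u) (k : ℤ) :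
    LocInt1 (modeCoeff u k) := by
  intro a b ha hb
  have h1 : piMeasure.restrict (Icc a b ×ˢ univ) =
      (volume.restrict (Icc a b)).prod (haarAddCircle (T := 2 * π)) := by
    rw [piMeasure, ← Measure.prod_restrict, Measure.restrict_univ, Measure.restrict_restrict
      measurableSet_Icc, inter_eq_left.2 (Icc_subset_Ioo ha hb)]
  have h2 := hu a b ha hb
  rw [IntegrableOn, h1] at h2
  have h3 : Integrable (fun z : ℝ × Circ => fourier (-k) z.2 • u z)
      ((volume.restrict (Icc a b)).prod haarAddCircle) := by
    refine h2.bdd_mul (c := 1) ?_ ?_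
    · exact ((fourier (-k)).continuous.comp continuous_snd).aestronglyMeasurable
    · exact Filter.Eventually.of_forall fun z => (norm_fourier_apply _ _).le
  exact h3.integral_prod_left

theorem LocInt.isWeakDeriv_zero {u : ℝ × Circ → ℂ} (hu : LocInt u) : IsWeakDeriv 0 0 u u :=
  ⟨hu, hu, fun φ _ => by simp⟩

/-- Test with `g(ψ) exp (-i k θ)`. Its `θ`-derivatives give `(-i k)^q`, whose sign cancels the
`(-1)^q` of the weak derivative. -/
theorem IsWeakDeriv.modeCoeff_eq {p q : ℕ} {u d : ℝ × Circ → ℂ} (H : IsWeakDeriv p q u d) (k : ℤ)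
    {g : ℝ → ℂ} (hg : Test1 g) :
    (Complex.I * k) ^ q * ∫ s in Ioo (0 : ℝ) 1, modeCoeff u k s * (_root_.deriv^[p] g) s =
      (-1) ^ p * ∫ s in Ioo (0 : ℝ) 1, modeCoeff d k s * g s := by
  have h1 := H.2.2 _ (hg.isTest (-k))
  rw [iterate_modeFun _ hg, integral_mul_modeFun H.1 k ((hg.iterate_deriv p).const_mul _),
    integral_mul_modeFun H.2.1 k hg] at h1
  have h2 : ∀ s, modeCoeff u k s * ((Complex.I * ((-k : ℤ) : ℂ)) ^ q * (_root_.deriv^[p] g) s) =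
      (-1) ^ q * ((Complex.I * k) ^ q * (modeCoeff u k s * (_root_.deriv^[p] g) s)) := by
    intro s
    have : (Complex.I * ((-k : ℤ) : ℂ)) ^ q = (-1) ^ q * (Complex.I * k) ^ q := by
      rw [← mul_pow]
      push_cast
      ring
    rw [this]
    ring
  simp only [h2] at h1
  rw [integral_const_mul, integral_const_mul, pow_add] at h1
  have h3 : ((-1 : ℂ) ^ q) * (-1) ^ q = 1 := by
    rw [← mul_pow]
    simp
  linear_combination (-1 : ℂ) ^ q * h1 + ((-1) ^ p * (∫ s in Ioo (0 : ℝ) 1, modeCoeff d k s * g s) -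
    (Complex.I * k) ^ q * ∫ s in Ioo (0 : ℝ) 1, modeCoeff u k s * (_root_.deriv^[p] g) s) * h3

theorem IsWeakDeriv.weakDeriv1 {p : ℕ} {u d d' : ℝ × Circ → ℂ} (H : IsWeakDeriv p 0 u d)
    (H' : IsWeakDeriv (p + 1) 0 u d') (k : ℤ) : WeakDeriv1 (modeCoeff d k) (modeCoeff d' k) := by
  refine ⟨H.2.1.locInt1_modeCoeff k, H'.2.1.locInt1_modeCoeff k, fun g hg => ?_⟩
  have h1 := H.modeCoeff_eq k hg.deriv
  have h2 := H'.modeCoeff_eq k hg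
  rw [Function.iterate_succ_apply, h1, pow_succ] at h2
  have h3 : ((-1 : ℂ) ^ p) ≠ 0 := by simp
  refine mul_left_cancel₀ h3 ?_
  linear_combination h2

theorem IsWeakDeriv.modeCoeff_theta {p q : ℕ} {u d d' : ℝ × Circ → ℂ} (H : IsWeakDeriv p 0 u d)
    (H' : IsWeakDeriv p q u d') (k : ℤ) :
    modeCoeff d' k =ᵐ[volume.restrict (Ioo 0 1)] fun s => (Complex.I * k) ^ q * modeCoeff d k s := by
  have hl := H'.2.1.locInt1_modeCoeff k
  have hl' := (H.2.1.locInt1_modeCoeff k).const_mul (-(Complex.I * k) ^ q)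
  have h0 := (hl.add hl').ae_eq_zero fun g hg => by
    simp only [Pi.add_apply, add_mul]
    rw [integral_add (hl.integrable_mul hg) (hl'.integrable_mul hg)]
    simp only [mul_assoc]
    rw [integral_const_mul]
    have h1 := H.modeCoeff_eq k hg
    have h2 := H'.modeCoeff_eq k hg
    rw [pow_zero, one_mul] at h1
    rw [h1] at h2
    have h3 : ((-1 : ℂ) ^ p) ≠ 0 := by simp
    refine mul_left_cancel₀ h3 ?_
    linear_combination -h2
  filter_upwards [h0] with s hs
  simp only [Pi.add_apply, Pi.zero_apply] at hs
  linear_combination hs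

/-- The converse passage: both pairings with `φ` are expanded in modes, and the one-dimensional
identity is used with the mode `-k` of `φ` as test function. -/
theorem isWeakDeriv_of_modeCoeff {γ γ' : ℝ} {p q : ℕ} {u d : ℝ × Circ → ℂ}
    (hu : MemLp u 2 (weightedMeasure γ)) (hd : MemLp d 2 (weightedMeasure γ'))
    (H : ∀ k, ∀ g, Test1 g →
      (Complex.I * k) ^ q * ∫ s in Ioo (0 : ℝ) 1, modeCoeff u k s * (_root_.deriv^[p] g) s =
        (-1) ^ p * ∫ s in Ioo (0 : ℝ) 1, modeCoeff d k s * g s) : IsWeakDeriv p q u d := by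
  have hu' := hu.coeFn_toLp
  have hd' := hd.coeFn_toLp
  suffices h : IsWeakDeriv p q (hu.toLp u) (hd.toLp d) from
    h.congr (ae_of_weighted hu') (ae_of_weighted hd')
  refine ⟨locInt_of_memLp (Lp.memLp _), locInt_of_memLp (Lp.memLp _), fun φ hφ => ?_⟩
  have h1 := hasSum_pairing (hu.toLp u) (hφ.iterate p q)
  have h2 := (hasSum_pairing (hd.toLp d) hφ).mul_left ((-1) ^ (p + q))
  refine h1.unique (h2.congr_fun fun k => ?_)
  have e1 : ∫ s in Ioo (0 : ℝ) 1, modeCoeff (hu.toLp u) k s *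
      modeCoeff (FlowLines.dPsi^[p] (FlowLines.dTheta^[q] φ)) (-k) s =
      (-1) ^ q * ((Complex.I * k) ^ q * ∫ s in Ioo (0 : ℝ) 1, modeCoeff u k s *
        (_root_.deriv^[p] (modeCoeff φ (-k))) s) := by
    rw [← integral_const_mul, ← integral_const_mul]
    refine integral_congr_ae ?_
    filter_upwards [modeCoeff_congr (ae_of_weighted hu') k] with s hs
    have : (Complex.I * ((-k : ℤ) : ℂ)) ^ q = (-1) ^ q * (Complex.I * k) ^ q := by
      rw [← mul_pow]
      push_cast
      ring
    rw [hs, hφ.modeCoeff_iterate, this]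
    ring
  have e2 : ∫ s in Ioo (0 : ℝ) 1, modeCoeff (hd.toLp d) k s * modeCoeff φ (-k) s =
      ∫ s in Ioo (0 : ℝ) 1, modeCoeff d k s * modeCoeff φ (-k) s := by
    refine integral_congr_ae ?_
    filter_upwards [modeCoeff_congr (ae_of_weighted hd') k] with s hs
    rw [hs]
  rw [e1, e2, H k _ (hφ.test1_modeCoeff (-k))]
  ring

/-! ### Regularity of sequences of Fourier modes -/

/-- The weight `(1 + k²) ^ n * exp (2 σ |k|)`. -/
def jw (σ n : ℝ) (k : ℤ) : ℝ := (1 + (k : ℝ) ^ 2) ^ n * Real.exp (2 * σ * |(k : ℝ)|)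

theorem one_le_jap (k : ℤ) : (1 : ℝ) ≤ 1 + (k : ℝ) ^ 2 := by
  have := sq_nonneg (k : ℝ)
  linarith

theorem jap_pos (k : ℤ) : (0 : ℝ) < 1 + (k : ℝ) ^ 2 := zero_lt_one.trans_le (one_le_jap k)

theorem jw_pos (σ n : ℝ) (k : ℤ) : 0 < jw σ n k :=
  mul_pos (Real.rpow_pos_of_pos (jap_pos k) _) (Real.exp_pos _)

theorem jw_add (σ n a : ℝ) (k : ℤ) : jw σ (n + a) k = (1 + (k : ℝ) ^ 2) ^ a * jw σ n k := by
  rw [jw, jw, Real.rpow_add (jap_pos k)]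
  ring

/-- `∑ₖ (1 + k²) ^ n * exp (2 σ |k|) * ‖ψ ^ (-γ) hₖ‖² < ∞`. -/
structure Base (σ γ n : ℝ) (h : ℤ → ℝ → ℂ) : Prop where
  inQ : ∀ k, InQ γ (h k)
  lt_top : ∑' k, ENNReal.ofReal (jw σ n k) * Q γ (h k) < ⊤

/-- The first `j` powers of `D = ψ ∂_ψ` applied to the modes `hₖ` are square summable, the `p`-th
one with the weight `(1 + k²) ^ (n - p) * exp (2 σ |k|)`. -/
def Reg (σ γ : ℝ) : ℝ → ℕ → (ℤ → ℝ → ℂ) → Prop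
  | n, 0, h => Base σ γ n h
  | n, j + 1, h => Base σ γ n h ∧ ∃ d : ℤ → ℝ → ℂ, (∀ k, HasD (h k) (d k)) ∧ Reg σ γ (n - 1) j d

theorem Base.of_le {σ γ n σ' γ' n' : ℝ} {h h' : ℤ → ℝ → ℂ} (H : Base σ γ n h)
    (hm : ∀ k, AEStronglyMeasurable (h' k) (volume.restrict (Ioo 0 1))) {C : ℝ≥0∞} (hC : C ≠ ⊤)
    (hle : ∀ k, ENNReal.ofReal (jw σ' n' k) * Q γ' (h' k) ≤
      C * (ENNReal.ofReal (jw σ n k) * Q γ (h k))) : Base σ' γ' n' h' := by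
  have h1 : ∑' k, ENNReal.ofReal (jw σ' n' k) * Q γ' (h' k) < ⊤ := by
    refine (ENNReal.tsum_le_tsum hle).trans_lt ?_
    rw [ENNReal.tsum_mul_left]
    exact ENNReal.mul_lt_top hC.lt_top H.2
  refine ⟨fun k => ⟨hm k, ?_⟩, h1⟩
  refine lt_top_iff_ne_top.2 fun h0 => ?_
  -- As the weight of each mode is positive, finiteness of the sum forces finiteness of each norm.
  have h2 := (ENNReal.le_tsum k).trans_lt h1
  rw [h0, ENNReal.mul_top (by simpa using jw_pos σ' n' k)] at h2
  exact absurd h2 (by simp)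

theorem Base.congr {σ γ n : ℝ} {h h' : ℤ → ℝ → ℂ} (H : Base σ γ n h)
    (hh : ∀ k, h k =ᵐ[volume.restrict (Ioo 0 1)] h' k) : Base σ γ n h' :=
  H.of_le (C := 1) (fun k => ((H.1 k).congr (hh k)).1) (by simp) fun k => by
    rw [Q_congr (hh k), one_mul]

theorem Base.add {σ γ n : ℝ} {h h' : ℤ → ℝ → ℂ} (H : Base σ γ n h) (H' : Base σ γ n h') :
    Base σ γ n (h + h') := by
  refine ⟨fun k => (H.1 k).add (H'.1 k), ?_⟩
  have h1 : ∀ k, ENNReal.ofReal (jw σ n k) * Q γ ((h + h') k) ≤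
      2 * (ENNReal.ofReal (jw σ n k) * Q γ (h k) + ENNReal.ofReal (jw σ n k) * Q γ (h' k)) := by
    intro k
    calc _ ≤ ENNReal.ofReal (jw σ n k) * (2 * (Q γ (h k) + Q γ (h' k))) := by
          gcongr
          exact Q_add_le (H.1 k).1
      _ = _ := by ring
  refine (ENNReal.tsum_le_tsum h1).trans_lt ?_
  rw [ENNReal.tsum_mul_left, ENNReal.tsum_add]
  exact ENNReal.mul_lt_top (by simp) (ENNReal.add_lt_top.2 ⟨H.2, H'.2⟩)

/-- A Fourier multiplier may change the Sobolev order and the exponential rate together. The second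
freedom is what reduces partially analytic spaces to ordinary Kondratev spaces. -/
theorem Base.mul {σ σ' γ n n' : ℝ} {h : ℤ → ℝ → ℂ} (H : Base σ γ n h) {c : ℤ → ℂ} {C : ℝ}
    (hc : ∀ k, ‖c k‖ ^ 2 * Real.exp (2 * σ' * |(k : ℝ)|) ≤
      C * (1 + (k : ℝ) ^ 2) ^ (n - n') * Real.exp (2 * σ * |(k : ℝ)|)) :
    Base σ' γ n' fun k s => c k * h k s := by
  refine H.of_le (C := ENNReal.ofReal C) (fun k => ((H.1 k).const_mul _).1)
    ENNReal.ofReal_ne_top fun k => ?_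
  rw [Q_const_mul, ← mul_assoc, ← mul_assoc]
  gcongr ?_ * _
  have hC : 0 ≤ C := by
    have h0 := hc 0
    simp only [Int.cast_zero, abs_zero, mul_zero, Real.exp_zero, mul_one, ne_eq,
      OfNat.ofNat_ne_zero, not_false_eq_true, zero_pow, add_zero, Real.one_rpow] at h0
    exact (sq_nonneg _).trans h0
  rw [enorm_sq_eq_ofReal, ← ENNReal.ofReal_mul (jw_pos _ _ _).le, ← ENNReal.ofReal_mul hC]
  refine ENNReal.ofReal_le_ofReal ?_
  have h1 := mul_le_mul_of_nonneg_left (hc k) (Real.rpow_nonneg (jap_pos k).le n')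
  have h2 : (1 + (k : ℝ) ^ 2) ^ n = (1 + (k : ℝ) ^ 2) ^ n' * (1 + (k : ℝ) ^ 2) ^ (n - n') := by
    rw [← Real.rpow_add (jap_pos k)]
    congr 1
    ring
  rw [jw, jw, h2]
  linarith

namespace Reg

variable {σ γ n : ℝ} {j : ℕ} {h h' : ℤ → ℝ → ℂ}

theorem base (H : Reg σ γ n j h) : Base σ γ n h := by
  cases j with
  | zero => exact H
  | succ j => exact H.1

theorem congr (H : Reg σ γ n j h) (hh : ∀ k, h k =ᵐ[volume.restrict (Ioo 0 1)] h' k) :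
    Reg σ γ n j h' := by
  cases j with
  | zero => exact Base.congr H hh
  | succ j =>
    obtain ⟨hb, d, hd, hr⟩ := H
    exact ⟨hb.congr hh, d, fun k => (hd k).congr (hh k) (Filter.EventuallyEq.refl _ _), hr⟩

theorem add (H : Reg σ γ n j h) (H' : Reg σ γ n j h') : Reg σ γ n j (h + h') := by
  induction j generalizing n h h' with
  | zero => exact Base.add H H'
  | succ j ih =>
    obtain ⟨hb, d, hd, hr⟩ := H
    obtain ⟨hb', d', hd', hr'⟩ := H'
    exact ⟨hb.add hb', d + d', fun k => (hd k).add (hd' k), ih hr hr'⟩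

theorem mul {σ' n' : ℝ} (H : Reg σ γ n j h) {c : ℤ → ℂ} {C : ℝ}
    (hc : ∀ k, ‖c k‖ ^ 2 * Real.exp (2 * σ' * |(k : ℝ)|) ≤
      C * (1 + (k : ℝ) ^ 2) ^ (n - n') * Real.exp (2 * σ * |(k : ℝ)|)) :
    Reg σ' γ n' j fun k s => c k * h k s := by
  induction j generalizing n n' h with
  | zero => exact Base.mul H hc
  | succ j ih =>
    obtain ⟨hb, d, hd, hr⟩ := H
    refine ⟨hb.mul hc, _, fun k => (hd k).const_mul (c k), ih hr ?_⟩
    simpa using hc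

theorem const_mul (H : Reg σ γ n j h) (c : ℂ) : Reg σ γ n j fun k s => c * h k s :=
  H.mul (c := fun _ => c) (C := ‖c‖ ^ 2) fun k => by simp

theorem weaken {n' : ℝ} (H : Reg σ γ n j h) (hn : n' ≤ n) : Reg σ γ n' j h := by
  have := H.mul (n' := n') (σ' := σ) (c := fun _ => 1) (C := 1) fun k => by
    rw [norm_one, one_pow, one_mul, one_mul]
    exact le_mul_of_one_le_left (Real.exp_pos _).le
      (Real.one_le_rpow (one_le_jap k) (by linarith))
  simpa using this

theorem sq_mul (H : Reg σ γ n j h) : Reg σ γ (n - 2) j fun k s => (k : ℂ) ^ 2 * h k s := by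
  refine H.mul (c := fun k => (k : ℂ) ^ 2) (C := 1) fun k => ?_
  have h1 : n - (n - 2) = ((2 : ℕ) : ℝ) := by push_cast; ring
  rw [one_mul, h1, Real.rpow_natCast]
  gcongr
  rw [norm_pow, Complex.norm_intCast, sq_abs]
  linarith

theorem pred (H : Reg σ γ n (j + 1) h) : Reg σ γ n j h := by
  induction j generalizing n h with
  | zero => exact H.1
  | succ j ih =>
    obtain ⟨hb, d, hd, hr⟩ := H
    exact ⟨hb, d, hd, ih hr⟩

theorem le {i : ℕ} (H : Reg σ γ n j h) (hij : i ≤ j) : Reg σ γ n i h := by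
  induction hij with
  | refl => exact H
  | step _ ih => exact ih H.pred

theorem mono {γ' : ℝ} (H : Reg σ γ n j h) (hγ : γ' ≤ γ) : Reg σ γ' n j h := by
  have hB : ∀ {n : ℝ} {h : ℤ → ℝ → ℂ}, Base σ γ n h → Base σ γ' n h := fun H =>
    H.of_le (C := 1) (fun k => (H.1 k).1) (by simp) fun k => by
      rw [one_mul]
      gcongr
      exact Q_mono hγ _
  induction j generalizing n h with
  | zero => exact hB H
  | succ j ih =>
    obtain ⟨hb, d, hd, hr⟩ := H
    exact ⟨hB hb, d, hd, ih hr⟩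

theorem rpow_mul (H : Reg σ γ n j h) (a : ℝ) :
    Reg σ (γ + a) n j fun k s => ((s ^ a : ℝ) : ℂ) * h k s := by
  have hB : ∀ {n : ℝ} {h : ℤ → ℝ → ℂ}, Base σ γ n h →
      Base σ (γ + a) n fun k s => ((s ^ a : ℝ) : ℂ) * h k s := fun H =>
    H.of_le (C := 1) (fun k => ((H.1 k).rpow_mul a).1) (by simp) fun k => by
      rw [one_mul, Q_rpow_mul, add_sub_cancel_right]
  induction j generalizing n h with
  | zero => exact hB H
  | succ j ih =>
    have H0 := H
    obtain ⟨hb, d, hd, hr⟩ := H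
    refine ⟨hB hb, _, fun k => (hd k).rpow_mul a, ?_⟩
    exact (ih hr).add ((ih (H0.pred.weaken (sub_le_self n zero_le_one))).const_mul a)

/-- Passes from powers of `D` to the operators `ψ^i ∂_ψ^i`: as `ψ^(i+1) ∂_ψ^(i+1) = (D - i) ψ^i
∂_ψ^i`, each term of the chain is `D - (p + i)` applied to the previous one. The shift `p` is there
for the induction. -/
theorem exists_chain {p : ℕ} (H : Reg σ γ n j h) :
    ∃ δ : ℕ → ℤ → ℝ → ℂ, δ 0 = h ∧ (∀ i < j, ∀ k, HasD (δ i k) fun s =>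
      ((p + i : ℕ) : ℂ) * δ i k s + δ (i + 1) k s) ∧ ∀ i ≤ j, Base σ γ (n - i) (δ i) := by
  induction j generalizing n p h with
  | zero =>
    refine ⟨fun _ => h, rfl, fun i hi => absurd hi (Nat.not_lt_zero i), fun i hi => ?_⟩
    obtain rfl : i = 0 := Nat.le_zero.1 hi
    simpa using H.base
  | succ j ih =>
    have H0 := H
    obtain ⟨hb, d, hd, hr⟩ := H
    have h1 : Reg σ γ (n - 1) j (d + fun k s => -(p : ℂ) * h k s) :=
      hr.add ((H0.pred.weaken (sub_le_self n zero_le_one)).const_mul _)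
    obtain ⟨δ, h0, hδ, hB⟩ := ih (p := p + 1) h1
    refine ⟨fun i => Nat.casesOn i h δ, rfl, fun i hi k => ?_, fun i hi => ?_⟩
    · cases i with
      | zero =>
        refine (hd k).congr (Filter.EventuallyEq.refl _ _) (Filter.Eventually.of_forall fun s => ?_)
        simp [h0]
      | succ i =>
        refine (hδ i (by omega) k).congr (Filter.EventuallyEq.refl _ _)
          (Filter.Eventually.of_forall fun s => ?_)
        simp only
        congr 3
        ring
    · cases i with
      | zero => simpa using hb
      | succ i =>
        have := hB i (by omega)
        push_cast
        rwa [sub_sub, add_comm] at this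

end Reg

/-- The converse passage, from `ψ^p ∂_ψ^p` back to powers of `D`. -/
theorem reg_of_chain {σ γ : ℝ} {m : ℕ} {δ : ℕ → ℤ → ℝ → ℂ}
    (hδ : ∀ i < m, ∀ k, HasD (δ i k) fun s => (i : ℂ) * δ i k s + δ (i + 1) k s)
    (hB : ∀ i ≤ m, Base σ γ ((m : ℝ) - i) (δ i)) (j p : ℕ) (hjp : p + j ≤ m) :
    Reg σ γ ((m : ℝ) - p) j (δ p) := by
  induction j generalizing p with
  | zero => exact hB p hjp
  | succ j ih =>
    refine ⟨hB p (by omega), _, fun k => hδ p (by omega) k, ?_⟩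
    refine Reg.add (h := fun k s => (p : ℂ) * δ p k s) ?_ ?_
    · exact ((ih p (by omega)).weaken (sub_le_self _ zero_le_one)).const_mul _
    · have := ih (p + 1) (by omega)
      push_cast at this
      rwa [← sub_sub] at this

/-! ### Kondratev spaces in terms of Fourier modes -/

theorem jap_pow_le (k : ℤ) (r : ℕ) : (1 + (k : ℝ) ^ 2) ^ r ≤ 2 ^ r * (1 + (k : ℝ) ^ (2 * r)) := by
  have h := add_pow_le (zero_le_one' ℝ) (sq_nonneg (k : ℝ)) r
  rw [one_pow, ← pow_mul] at h
  refine h.trans ?_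
  gcongr
  · have : (0 : ℝ) ≤ (k : ℝ) ^ (2 * r) := by rw [pow_mul]; positivity
    positivity
  · norm_num
  · omega

theorem enorm_I_mul_pow_sq (k : ℤ) (q : ℕ) :
    ‖(Complex.I * (k : ℂ)) ^ q‖ₑ ^ 2 = ENNReal.ofReal ((k : ℝ) ^ (2 * q)) := by
  rw [enorm_sq_eq_ofReal, norm_pow, norm_mul, Complex.norm_I, one_mul, Complex.norm_intCast,
    ← pow_mul, mul_comm q 2, pow_mul, sq_abs, ← pow_mul]

theorem jw_zero_natCast (r : ℕ) (k : ℤ) : jw 0 r k = (1 + (k : ℝ) ^ 2) ^ r := by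
  simp [jw]

/-- Only the derivatives `(p, 0)` and `(p, m - p)` matter: together they control the weight `(1 +
k²)^(m - p)` on the modes of `ψ^p ∂_ψ^p u`, and all intermediate tangential orders follow. -/
theorem K.reg_modeCoeff {m : ℕ} {γ : ℝ} (u : K m γ) : Reg 0 γ m m (modeCoeff u.toFun) := by
  have hs : ∀ i : KIdx m, IsWeakDeriv i.1.1 i.1.2 u.toFun (u.deriv i) := u.deriv_spec
  -- The family is extended by `0` beyond `m` only to be indexed by all natural numbers.
  let d : ℕ → ℝ × Circ → ℂ := fun p =>
    if hp : p ≤ m then u.deriv ⟨(⟨p, by omega⟩, ⟨0, by omega⟩), by simpa using hp⟩ else 0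
  have hd : ∀ p (hp : p ≤ m), d p = u.deriv ⟨(⟨p, by omega⟩, ⟨0, by omega⟩), by simpa using hp⟩ :=
    fun p hp => dif_pos hp
  have hw : ∀ p, p ≤ m → IsWeakDeriv p 0 u.toFun (d p) := fun p hp => by
    rw [hd p hp]
    exact hs _
  have hL : ∀ p, p ≤ m → MemLp (d p) 2 (weightedMeasure (γ - p)) := fun p hp => by
    rw [hd p hp]
    exact Lp.memLp _
  set δ : ℕ → ℤ → ℝ → ℂ := fun p k s => ((s ^ (p : ℝ) : ℝ) : ℂ) * modeCoeff (d p) k s with hδ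
  have hInQ : ∀ p, p ≤ m → ∀ k, InQ γ (δ p k) := fun p hp k => by
    have h1 := (inQ_modeCoeff (hL p hp) k).rpow_mul (p : ℝ)
    rwa [sub_add_cancel] at h1
  have hQ : ∀ p k, Q γ (δ p k) = Q (γ - p) (modeCoeff (d p) k) := fun p k => Q_rpow_mul _ _ _
  have hchain : ∀ p < m, ∀ k, HasD (δ p k) fun s => (p : ℂ) * δ p k s + δ (p + 1) k s := by
    intro p hp k
    have h1 := (hw p hp.le).weakDeriv1 (hw (p + 1) hp) k
    have h2 : HasD (modeCoeff (d p) k) fun s => s * modeCoeff (d (p + 1)) k s := by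
      refine WeakDeriv1.congr h1 (Filter.EventuallyEq.refl _ _) ?_
      filter_upwards [ae_mem_Ioo_restrict] with s hs
      have h0 : (s : ℂ) ≠ 0 := by exact_mod_cast hs.1.ne'
      rw [mul_div_cancel_left₀ _ h0]
    refine (h2.rpow_mul p).congr (Filter.EventuallyEq.refl _ _) ?_
    filter_upwards [ae_mem_Ioo_restrict] with s hs
    simp only [hδ]
    rw [Nat.cast_succ, Real.rpow_add hs.1, Real.rpow_one]
    push_cast
    ring
  have hB : ∀ p ≤ m, Base 0 γ ((m : ℝ) - p) (δ p) := by
    intro p hp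
    refine ⟨hInQ p hp, ?_⟩
    have hq : p + (m - p) ≤ m := by omega
    let i : KIdx m := ⟨(⟨p, by omega⟩, ⟨m - p, by omega⟩), hq⟩
    have hLi : MemLp (u.deriv i) 2 (weightedMeasure (γ - p)) := Lp.memLp (u.deriv i)
    have h1 : ∀ k, Q (γ - p) (modeCoeff (u.deriv i) k) =
        ENNReal.ofReal ((k : ℝ) ^ (2 * (m - p))) * Q γ (δ p k) := by
      intro k
      rw [hQ, ← enorm_I_mul_pow_sq, ← Q_const_mul]
      exact Q_congr ((hw p hp).modeCoeff_theta (hs i) k)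
    have h2 := lintegral_enorm_sq_lt_top hLi
    have h3 := lintegral_enorm_sq_lt_top (hL p hp)
    rw [lintegral_weighted_eq_tsum hLi] at h2
    rw [lintegral_weighted_eq_tsum (hL p hp)] at h3
    simp only [h1] at h2
    simp only [← hQ] at h3
    have h4 : ∀ k, ENNReal.ofReal (jw 0 ((m : ℝ) - p) k) * Q γ (δ p k) ≤
        ENNReal.ofReal (2 ^ (m - p)) * (Q γ (δ p k) +
          ENNReal.ofReal ((k : ℝ) ^ (2 * (m - p))) * Q γ (δ p k)) := by
      intro k
      rw [← Nat.cast_sub hp, jw_zero_natCast]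
      have h5 : (0 : ℝ) ≤ (k : ℝ) ^ (2 * (m - p)) := by rw [pow_mul]; positivity
      calc _ ≤ ENNReal.ofReal (2 ^ (m - p) * (1 + (k : ℝ) ^ (2 * (m - p)))) * Q γ (δ p k) := by
            gcongr
            exact jap_pow_le k _
        _ = _ := by
            rw [ENNReal.ofReal_mul (by positivity), ENNReal.ofReal_add zero_le_one h5,
              ENNReal.ofReal_one]
            ring
    refine (ENNReal.tsum_le_tsum h4).trans_lt ?_
    rw [ENNReal.tsum_mul_left, ENNReal.tsum_add]
    exact ENNReal.mul_lt_top ENNReal.ofReal_lt_top (ENNReal.add_lt_top.2 ⟨h3, h2⟩)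
  have hR := reg_of_chain hchain hB m 0 (by omega)
  rw [Nat.cast_zero, sub_zero] at hR
  refine hR.congr fun k => ?_
  have h5 := (hw 0 (Nat.zero_le m)).modeCoeff_theta
    ((hw 0 (Nat.zero_le m)).1.isWeakDeriv_zero) k
  filter_upwards [h5] with s hs
  simp only [hδ, Nat.cast_zero, Real.rpow_zero, Complex.ofReal_one, one_mul]
  rw [hs, pow_zero, one_mul]

theorem integral_iterate_deriv {m : ℕ} {d : ℕ → ℝ → ℂ}
    (hd : ∀ p < m, WeakDeriv1 (d p) (d (p + 1))) {p : ℕ} (hp : p ≤ m) {g : ℝ → ℂ} (hg : Test1 g) :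
    ∫ s in Ioo (0 : ℝ) 1, d 0 s * (deriv^[p] g) s =
      (-1) ^ p * ∫ s in Ioo (0 : ℝ) 1, d p s * g s := by
  induction p generalizing g with
  | zero => simp
  | succ p ih =>
    rw [Function.iterate_succ_apply, ih (by omega) hg.deriv, (hd p hp).2.2 g hg, pow_succ]
    ring

/-- With the chain `δ p = ψ^p ∂_ψ^p h`, the modes of the weak derivative `∂_ψ^p ∂_θ^q` must be `(i
k)^q ψ^(-p) δ p`. Riesz–Fischer sums them, and `isWeakDeriv_of_modeCoeff` confirms that the sums are
the weak derivatives. -/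
theorem K.exists_of_reg {m : ℕ} {γ : ℝ} {h : ℤ → ℝ → ℂ} (H : Reg 0 γ m m h) :
    ∃ u : K m γ, ∀ k, modeCoeff u.toFun k =ᵐ[volume.restrict (Ioo 0 1)] h k := by
  obtain ⟨δ, h0, hδ, hB⟩ := H.exists_chain (p := 0)
  set d : ℕ → ℤ → ℝ → ℂ := fun p k s => ((s ^ (-(p : ℝ)) : ℝ) : ℂ) * δ p k s with hd
  have hQ : ∀ (p : ℕ) k, Q (γ - p) (d p k) = Q γ (δ p k) := fun p k => by
    rw [hd, Q_rpow_mul]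
    congr 1
    ring
  have hInQ : ∀ p ≤ m, ∀ k, InQ (γ - p) (d p k) := fun p hp k => by
    have h1 := ((hB p hp).1 k).rpow_mul (-(p : ℝ))
    rwa [← sub_eq_add_neg] at h1
  have hw : ∀ k, ∀ p < m, WeakDeriv1 (d p k) (d (p + 1) k) := by
    intro k p hp
    refine WeakDeriv1.congr ((hδ p hp k).rpow_mul (-(p : ℝ))) (Filter.EventuallyEq.refl _ _) ?_
    filter_upwards [ae_mem_Ioo_restrict] with s hs
    have h0 : (s : ℂ) ≠ 0 := by exact_mod_cast hs.1.ne'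
    simp only [hd]
    rw [Nat.cast_succ, neg_add, Real.rpow_add hs.1, Real.rpow_neg_one]
    push_cast
    field_simp
    ring
  have hsum : ∀ p q : ℕ, p + q ≤ m →
      ∑' k, Q (γ - p) (fun s => (Complex.I * k) ^ q * d p k s) < ⊤ := by
    intro p q hpq
    refine lt_of_le_of_lt (ENNReal.tsum_le_tsum fun k => ?_) (hB p (by omega)).2
    rw [Q_const_mul, hQ, enorm_I_mul_pow_sq, ← Nat.cast_sub (by omega : p ≤ m), jw_zero_natCast]
    gcongr
    calc (k : ℝ) ^ (2 * q) = ((k : ℝ) ^ 2) ^ q := by rw [pow_mul]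
      _ ≤ (1 + (k : ℝ) ^ 2) ^ q := by gcongr; linarith
      _ ≤ _ := pow_le_pow_right₀ (one_le_jap k) (by omega)
  have hd0 : ∀ k, d 0 k = h k := fun k => by
    ext s
    simp [hd, h0]
  have hs0 := hsum 0 0 (Nat.zero_le m)
  simp only [pow_zero, one_mul, hd0, Nat.cast_zero, sub_zero] at hs0
  obtain ⟨u, -, hu⟩ := exists_hasSum_modeFun (fun k => H.base.1 k) hs0
  refine ⟨⟨u, fun i => ?_⟩, hu⟩
  obtain ⟨v, -, hv⟩ := exists_hasSum_modeFun
    (fun k => (hInQ i.1.1 (by have := i.2; omega) k).const_mul ((Complex.I * k) ^ (i.1.2 : ℕ)))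
    (hsum i.1.1 i.1.2 i.2)
  refine ⟨v, isWeakDeriv_of_modeCoeff (Lp.memLp u) (Lp.memLp v) fun k g hg => ?_⟩
  have e1 : ∫ s in Ioo (0 : ℝ) 1, modeCoeff u k s * (_root_.deriv^[(i.1.1 : ℕ)] g) s =
      ∫ s in Ioo (0 : ℝ) 1, d 0 k s * (_root_.deriv^[(i.1.1 : ℕ)] g) s := by
    refine integral_congr_ae ?_
    filter_upwards [hu k] with s hs
    rw [hs, hd0]
  have e2 : ∫ s in Ioo (0 : ℝ) 1, modeCoeff v k s * g s =
      (Complex.I * k) ^ (i.1.2 : ℕ) * ∫ s in Ioo (0 : ℝ) 1, d i.1.1 k s * g s := by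
    rw [← integral_const_mul]
    refine integral_congr_ae ?_
    filter_upwards [hv k] with s hs
    rw [hs, mul_assoc]
  rw [e1, e2, integral_iterate_deriv (d := fun p => d p k) (hw k)
    (by have := i.2; omega : (i.1.1 : ℕ) ≤ m) hg]
  ring

theorem K.ext_modeCoeff {m : ℕ} {γ : ℝ} {u v : K m γ}
    (h : ∀ k, modeCoeff u.toFun k =ᵐ[volume.restrict (Ioo 0 1)] modeCoeff v.toFun k) : u = v :=
  K.ext_ae (ae_eq_of_modeCoeff (Lp.memLp u.1) (Lp.memLp v.1) h)

/-- The exponential weight is absorbed into the modes; it does not depend on `ψ` and so commutes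
with `D`. -/
theorem reg_zero_iff {σ γ n : ℝ} {j : ℕ} {h : ℤ → ℝ → ℂ} :
    Reg σ γ n j h ↔ Reg 0 γ n j fun k s => (Real.exp (σ * |(k : ℝ)|) : ℂ) * h k s := by
  have h1 : ∀ (t : ℝ), ‖(Real.exp t : ℂ)‖ ^ 2 = Real.exp (2 * t) := fun t => by
    rw [Complex.norm_real, Real.norm_of_nonneg (Real.exp_pos _).le, ← Real.exp_nat_mul]
    norm_num
  refine ⟨fun H => ?_, fun H => ?_⟩
  · refine H.mul (C := 1) fun k => ?_
    rw [h1]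
    simp [mul_assoc]
  · have h2 := H.mul (σ' := σ) (n' := n) (c := fun k => (Real.exp (-(σ * |(k : ℝ)|)) : ℂ)) (C := 1)
      fun k => by
        rw [h1, ← Real.exp_add]
        simp [mul_assoc]
    refine h2.congr fun k => Filter.Eventually.of_forall fun s => ?_
    simp only
    rw [← mul_assoc, ← Complex.ofReal_mul, ← Real.exp_add]
    simp

theorem KS.reg_modeCoeff {m : ℕ} {σ γ : ℝ} (u : KS m σ γ) :
    Reg σ γ m m (modeCoeff u.toFun) := by
  rw [reg_zero_iff]
  exact (K.reg_modeCoeff (KS.mult u)).congr fun k => u.mult_spec k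

theorem KS.exists_of_reg {m : ℕ} {σ γ : ℝ} (hσ : 0 ≤ σ) {h : ℤ → ℝ → ℂ} (H : Reg σ γ m m h) :
    ∃ u : KS m σ γ, ∀ k, modeCoeff u.toFun k =ᵐ[volume.restrict (Ioo 0 1)] h k := by
  obtain ⟨b, hb⟩ := K.exists_of_reg (reg_zero_iff.1 H)
  -- Membership requires both the function and its exponential multiple in `K`; the former comes for
  -- free because `σ ≥ 0`.
  have h1 : Reg 0 γ m m h := by
    have h2 := H.mul (σ' := 0) (n' := m) (c := fun _ => 1) (C := 1) fun k => by
      rw [norm_one, one_pow, sub_self, Real.rpow_zero, one_mul, one_mul, one_mul]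
      refine Real.exp_le_exp.2 ?_
      rw [mul_zero, zero_mul]
      positivity
    simpa using h2
  obtain ⟨u, hu⟩ := K.exists_of_reg h1
  refine ⟨⟨u, b, fun k => ?_⟩, hu⟩
  filter_upwards [hu k, hb k] with s h1 h2
  rw [h1, h2]

theorem KS.ext_modeCoeff {m : ℕ} {σ γ : ℝ} {u v : KS m σ γ}
    (h : ∀ k, modeCoeff u.toFun k =ᵐ[volume.restrict (Ioo 0 1)] modeCoeff v.toFun k) : u = v :=
  Subtype.ext (K.ext_modeCoeff h)

theorem KS.memLp {m : ℕ} {σ γ : ℝ} (u : KS m σ γ) : MemLp u.toFun 2 (weightedMeasure γ) :=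
  Lp.memLp u.1.1

/-! ### Completeness and continuous functionals -/

theorem completeSpace_of_isClosed_range {E F : Type*} [NormedAddCommGroup E] [NormedSpace ℂ E]
    [NormedAddCommGroup F] [NormedSpace ℂ F] [CompleteSpace F] (f : E →ₗ[ℂ] F)
    (hf : ∀ x, ‖f x‖ = ‖x‖) (h : IsClosed (range f)) : CompleteSpace E :=
  (completeSpace_iff_isComplete_range
    (AddMonoidHomClass.isometry_of_norm f hf).isUniformInducing).2 h.isComplete

namespace X

variable {s σ : ℝ}

theorem continuous_coeffs : Continuous (coeffs (s := s) (σ := σ)) :=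
  (AddMonoidHomClass.isometry_of_norm coeffs fun _ => rfl).continuous

theorem coeffs_apply (a : X s σ) (k : ℤ) : coeffs a k =
    (((1 + (k : ℝ) ^ 2) ^ (s / 2) * Real.exp (σ * |(k : ℝ)|) : ℝ) : ℂ) * fourierCoeff a.toFun k :=
  rfl

theorem weight_pos (s σ : ℝ) (k : ℤ) :
    0 < (1 + (k : ℝ) ^ 2) ^ (s / 2) * Real.exp (σ * |(k : ℝ)|) :=
  mul_pos (Real.rpow_pos_of_pos (jap_pos k) _) (Real.exp_pos _)

theorem weight_sq (s σ : ℝ) (k : ℤ) :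
    ((1 + (k : ℝ) ^ 2) ^ (s / 2) * Real.exp (σ * |(k : ℝ)|)) ^ 2 = jw σ s k := by
  rw [jw, mul_pow, ← Real.rpow_natCast, ← Real.rpow_mul (jap_pos k).le, ← Real.exp_nat_mul]
  congr 2
  · push_cast; ring
  · push_cast; ring

theorem continuous_fourierCoeff (k : ℤ) :
    Continuous fun a : X s σ => fourierCoeff a.toFun k := by
  have h1 : Continuous fun a : X s σ => coeffs a k :=
    (lp.evalCLM ℂ (fun _ : ℤ => ℂ) 2 k).continuous.comp continuous_coeffs
  have h2 : ∀ a : X s σ, fourierCoeff a.toFun k =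
      (((1 + (k : ℝ) ^ 2) ^ (s / 2) * Real.exp (σ * |(k : ℝ)|) : ℝ) : ℂ)⁻¹ * coeffs a k := by
    intro a
    rw [coeffs_apply, inv_mul_cancel_left₀]
    exact_mod_cast (weight_pos s σ k).ne'
  simp only [h2]
  exact continuous_const.mul h1

theorem ext_fourierCoeff {a b : X s σ} (h : ∀ k, fourierCoeff a.toFun k = fourierCoeff b.toFun k) :
    a = b := by
  apply coeffs_injective
  ext k
  rw [coeffs_apply, coeffs_apply, h]

theorem fourierCoeff_add (a b : X s σ) (k : ℤ) :
    fourierCoeff (a + b).toFun k = fourierCoeff a.toFun k + fourierCoeff b.toFun k := by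
  have h : ∀ c : X s σ, fourierCoeff c.toFun k = fourierBasis.repr c.1 k := fun c =>
    (fourierBasis_repr c.1 k).symm
  rw [h, h, h]
  exact congrFun (congrArg Subtype.val (map_add fourierBasis.repr a.1 b.1)) k

theorem fourierCoeff_smul (c : ℂ) (a : X s σ) (k : ℤ) :
    fourierCoeff (c • a).toFun k = c * fourierCoeff a.toFun k := by
  have h : ∀ c : X s σ, fourierCoeff c.toFun k = fourierBasis.repr c.1 k := fun c =>
    (fourierBasis_repr c.1 k).symm
  rw [h, h]
  exact congrFun (congrArg Subtype.val (map_smul fourierBasis.repr c a.1)) k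

theorem enorm_weight_mul_sq (s σ : ℝ) (k : ℤ) (z : ℂ) :
    ENNReal.ofReal (‖(((1 + (k : ℝ) ^ 2) ^ (s / 2) * Real.exp (σ * |(k : ℝ)|) : ℝ) : ℂ) * z‖ ^ 2) =
      ENNReal.ofReal (jw σ s k) * ‖z‖ₑ ^ 2 := by
  rw [norm_mul, mul_pow, Complex.norm_real, Real.norm_of_nonneg (weight_pos s σ k).le, weight_sq,
    ENNReal.ofReal_mul (jw_pos σ s k).le, enorm_sq_eq_ofReal]

theorem tsum_lt_top (a : X s σ) :
    ∑' k, ENNReal.ofReal (jw σ s k) * ‖fourierCoeff a.toFun k‖ₑ ^ 2 < ⊤ := by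
  have h := (memℓp_gen_iff (by norm_num)).1 a.2
  simp only [ENNReal.toReal_ofNat, Real.rpow_two] at h
  have h1 := h.tsum_ofReal_lt_top
  simp only [xCoeff, enorm_weight_mul_sq] at h1
  exact h1

/-- Nonnegative orders make all weights at least one, so the coefficients are square summable and
define an `L²` function. -/
theorem exists_of_tsum (hs : 0 ≤ s) (hσ : 0 ≤ σ) {c : ℤ → ℂ}
    (hc : ∑' k, ENNReal.ofReal (jw σ s k) * ‖c k‖ₑ ^ 2 < ⊤) :
    ∃ a : X s σ, ∀ k, fourierCoeff a.toFun k = c k := by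
  have hw : ∀ k : ℤ, 1 ≤ jw σ s k := fun k =>
    one_le_mul_of_one_le_of_one_le (Real.one_le_rpow (one_le_jap k) hs)
      (Real.one_le_exp (by positivity))
  have hc0 : Memℓp c 2 := by
    rw [memℓp_gen_iff (by norm_num)]
    simp only [ENNReal.toReal_ofNat, Real.rpow_two]
    have h1 : ∑' k, ENNReal.ofReal (‖c k‖ ^ 2) < ⊤ := by
      refine lt_of_le_of_lt (ENNReal.tsum_le_tsum fun k => ?_) hc
      rw [← enorm_sq_eq_ofReal]
      exact le_mul_of_one_le_left' (by simpa using ENNReal.ofReal_le_ofReal (hw k))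
    refine (ENNReal.summable_toReal h1.ne).congr fun k => ?_
    rw [ENNReal.toReal_ofReal (sq_nonneg _)]
  set a : Lp ℂ 2 (haarAddCircle (T := 2 * π)) := fourierBasis.repr.symm ⟨c, hc0⟩ with ha
  have hca : ∀ k, fourierCoeff a k = c k := fun k => by
    rw [← fourierBasis_repr, ha, LinearIsometryEquiv.apply_symm_apply]
  refine ⟨⟨a, ?_⟩, hca⟩
  change Memℓp (xCoeff s σ a) 2
  rw [memℓp_gen_iff (by norm_num)]
  simp only [ENNReal.toReal_ofNat, Real.rpow_two]
  refine (ENNReal.summable_toReal hc.ne).congr fun k => ?_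
  rw [xCoeff, hca, ← enorm_weight_mul_sq, ENNReal.toReal_ofReal (sq_nonneg _)]

theorem completeSpace (hs : 0 ≤ s) (hσ : 0 ≤ σ) : CompleteSpace (X s σ) := by
  refine completeSpace_of_isClosed_range coeffs (fun _ => rfl) ?_
  have : range (coeffs (s := s) (σ := σ)) = univ := by
    refine range_eq_univ.2 fun y => ?_
    have hw : ∀ k : ℤ,
        (((1 + (k : ℝ) ^ 2) ^ (s / 2) * Real.exp (σ * |(k : ℝ)|) : ℝ) : ℂ) ≠ 0 := fun k => by
      exact_mod_cast (weight_pos s σ k).ne'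
    obtain ⟨a, ha⟩ := exists_of_tsum (s := s) (σ := σ) hs hσ
      (c := fun k => (((1 + (k : ℝ) ^ 2) ^ (s / 2) * Real.exp (σ * |(k : ℝ)|) : ℝ) : ℂ)⁻¹ * y k) (by
        simp only [← enorm_weight_mul_sq]
        simp only [mul_inv_cancel_left₀ (hw _)]
        have h := (memℓp_gen_iff (by norm_num)).1 y.2
        simp only [ENNReal.toReal_ofNat, Real.rpow_two] at h
        exact h.tsum_ofReal_lt_top)
    refine ⟨a, ?_⟩
    ext k
    rw [coeffs_apply, ha, mul_inv_cancel_left₀ (hw k)]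
  rw [this]
  exact isClosed_univ

end X

namespace K

variable {m : ℕ} {γ : ℝ}

theorem continuous_deriv (i : KIdx m) : Continuous fun u : K m γ => u.deriv i := by
  have h1 : Continuous (jet (m := m) (γ := γ)) :=
    (AddMonoidHomClass.isometry_of_norm (jet (m := m) (γ := γ)) fun _ => rfl).continuous
  exact (PiLp.continuous_apply 2 _ i).comp h1

/-- The weak derivatives in the jet are obtained by choice, even that of order zero, so its
agreement with `u` has to be proved; comparing Fourier modes does it. -/
theorem deriv_zero_ae (u : K m γ) :
    (u.deriv ⟨(0, 0), by simp⟩ : ℝ × Circ → ℂ) =ᵐ[piMeasure] u.toFun := by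
  have h1 := u.deriv_spec ⟨(0, 0), by simp⟩
  have hm : MemLp (u.deriv ⟨(0, 0), by simp⟩) 2 (weightedMeasure γ) := by
    have := Lp.memLp (u.deriv ⟨(0, 0), by simp⟩)
    simpa using this
  refine ae_eq_of_modeCoeff hm (Lp.memLp u.1) fun k => ?_
  have h2 := h1.1.isWeakDeriv_zero.modeCoeff_theta h1 k
  filter_upwards [h2] with s hs
  rw [hs]
  simp [toFun]

theorem continuous_integral_mul {φ : ℝ × Circ → ℂ} (hφ : IsTest φ) :
    Continuous fun u : K m γ => ∫ z, u.toFun z * φ z ∂piMeasure := by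
  obtain ⟨L, hL⟩ := hφ.exists_clm (γ - ((0 : Fin (m + 1)) : ℕ))
  refine (L.continuous.comp (continuous_deriv ⟨(0, 0), by simp⟩)).congr fun u => ?_
  simp only [Function.comp_apply]
  rw [hL]
  refine integral_congr_ae ?_
  filter_upwards [u.deriv_zero_ae] with z hz
  rw [hz]

/-- The jet is isometric by definition of the norm. Its range is closed because, for each fixed test
function, both sides of the weak derivative identity are continuous in the jet. -/
theorem completeSpace : CompleteSpace (K m γ) := by
  refine completeSpace_of_isClosed_range jet (fun _ => rfl) ?_
  refine IsSeqClosed.isClosed fun x y hx hy => ?_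
  choose u hu using hx
  have hi : ∀ i : KIdx m, Filter.Tendsto (fun n => (u n).deriv i) Filter.atTop (nhds (y i)) := by
    intro i
    have h1 := ((PiLp.continuous_apply 2 _ i).tendsto y).comp hy
    refine h1.congr fun n => ?_
    simp only [Function.comp_apply, ← hu n]
    rfl
  set i0 : KIdx m := ⟨(0, 0), by simp⟩ with hi0
  have hm : MemLp (y i0) 2 (weightedMeasure γ) := by
    have := Lp.memLp (y i0)
    simpa [hi0] using this
  have hw : ∀ i : KIdx m, IsWeakDeriv i.1.1 i.1.2 (y i0) (y i) := by
    intro i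
    refine ⟨locInt_of_memLp (Lp.memLp _), locInt_of_memLp (Lp.memLp _), fun φ hφ => ?_⟩
    obtain ⟨L, hL⟩ := (hφ.iterate i.1.1 i.1.2).exists_clm (γ - ((0 : Fin (m + 1)) : ℕ))
    obtain ⟨L', hL'⟩ := hφ.exists_clm (γ - (i.1.1 : ℕ))
    have e1 := (L.continuous.tendsto _).comp (hi i0)
    have e2 := ((L'.continuous.tendsto _).comp (hi i)).const_mul ((-1) ^ ((i.1.1 : ℕ) + i.1.2))
    rw [← hL, ← hL']
    refine tendsto_nhds_unique (e1.congr fun n => ?_) e2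
    simp only [Function.comp_apply, hL, hL']
    rw [← ((u n).deriv_spec i).2.2 φ hφ]
    refine integral_congr_ae ?_
    filter_upwards [(u n).deriv_zero_ae] with z hz
    rw [hz]
  have hc := ae_of_weighted hm.coeFn_toLp
  let v : K m γ := ⟨hm.toLp, fun i => ⟨y i, (hw i).congr hc.symm (Filter.EventuallyEq.refl _ _)⟩⟩
  refine ⟨v, ?_⟩
  ext1 i
  exact (v.deriv_spec i).unique ((hw i).congr hc.symm (Filter.EventuallyEq.refl _ _))

end K

namespace KS

variable {m : ℕ} {σ γ : ℝ}

theorem continuous_mult : Continuous (mult (m := m) (σ := σ) (γ := γ)) :=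
  (AddMonoidHomClass.isometry_of_norm mult fun _ => rfl).continuous

/-- The multiplier is an isometry onto the complete space `K m γ`: dividing the modes by `exp (σ
|k|)` inverts it. -/
theorem completeSpace (hσ : 0 ≤ σ) : CompleteSpace (KS m σ γ) := by
  have := K.completeSpace (m := m) (γ := γ)
  refine completeSpace_of_isClosed_range mult (fun _ => rfl) ?_
  have : range (mult (m := m) (σ := σ) (γ := γ)) = univ := by
    refine range_eq_univ.2 fun b => ?_
    have he : ∀ k : ℤ, (Real.exp (σ * |(k : ℝ)|) : ℂ) ≠ 0 := fun k => by
      exact_mod_cast (Real.exp_pos _).ne'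
    obtain ⟨u, hu⟩ := KS.exists_of_reg (m := m) (σ := σ) (γ := γ) hσ
      (h := fun k s => (Real.exp (σ * |(k : ℝ)|) : ℂ)⁻¹ * modeCoeff b.toFun k s) (by
        rw [reg_zero_iff]
        simp only [mul_inv_cancel_left₀ (he _)]
        exact b.reg_modeCoeff)
    refine ⟨u, K.ext_modeCoeff fun k => ?_⟩
    filter_upwards [u.mult_spec k, hu k] with s h1 h2
    rw [h1, h2, mul_inv_cancel_left₀ (he k)]
  rw [this]
  exact isClosed_univ

theorem modeCoeff_eq_mult (u : KS m σ γ) (k : ℤ) :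
    modeCoeff u.toFun k =ᵐ[volume.restrict (Ioo 0 1)]
      fun s => (Real.exp (σ * |(k : ℝ)|) : ℂ)⁻¹ * modeCoeff (mult u).toFun k s := by
  filter_upwards [u.mult_spec k] with s hs
  rw [hs, inv_mul_cancel_left₀]
  exact_mod_cast (Real.exp_pos _).ne'

theorem continuous_integral_modeCoeff (k : ℤ) {g : ℝ → ℂ} (hg : Test1 g) :
    Continuous fun u : KS m σ γ => ∫ s in Ioo (0 : ℝ) 1, modeCoeff u.toFun k s * g s := by
  have h1 := (K.continuous_integral_mul (m := m) (γ := γ) (hg.isTest (-k))).comp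
    (continuous_mult (m := m) (σ := σ) (γ := γ))
  refine (h1.const_mul (Real.exp (σ * |(k : ℝ)|) : ℂ)⁻¹).congr fun u => ?_
  simp only [Function.comp_apply]
  rw [integral_mul_modeFun (u := (mult u).toFun) (locInt_of_memLp (Lp.memLp (mult u).1)) k hg, ← integral_const_mul]
  refine integral_congr_ae ?_
  filter_upwards [u.modeCoeff_eq_mult k] with s hs
  rw [hs, mul_assoc]

end KS

/-- The Riesz representative is `ψ^(b + 2β) exp (i k θ)`, which lies in the weighted space exactly
under the stated inequality. -/
theorem exists_clm_rpow {β b : ℝ} (hb : 0 < b + β + 1 / 2) (k : ℤ) :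
    ∃ L : Lp ℂ 2 (weightedMeasure β) →L[ℂ] ℂ, ∀ v,
      L v = ∫ s in Ioo (0 : ℝ) 1, ((s ^ b : ℝ) : ℂ) * modeCoeff v k s := by
  have hh : InQ β (fun s => (1 : ℂ) * ((s ^ (b + 2 * β) : ℝ) : ℂ)) := inQ_rpow (by linarith) 1
  set x := (memLp_modeFun k hh).toLp with hx
  refine ⟨innerSL ℂ x, fun v => ?_⟩
  have hint := L2.integrable_inner (𝕜 := ℂ) x v
  rw [innerSL_apply_apply, L2.inner_def]
  have hd := integral_withDensity_eq_integral_toReal_smul (μ := piMeasure) (measurable_weight β)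
    (Filter.Eventually.of_forall fun _ => ENNReal.ofReal_lt_top) fun z => inner ℂ (x z) (v z)
  have hd' := (integrable_withDensity_iff_integrable_smul' (μ := piMeasure) (measurable_weight β)
    (Filter.Eventually.of_forall fun _ => ENNReal.ofReal_lt_top)).1 hint
  refine hd.trans ?_
  have hae : (fun z => (ENNReal.ofReal (z.1 ^ (-2 * β))).toReal • inner ℂ (x z) (v z))
      =ᵐ[piMeasure] fun z => ((z.1 ^ b : ℝ) : ℂ) * (fourier (-k) z.2 * v z) := by
    filter_upwards [ae_mem_Ioo, ae_of_weighted (memLp_modeFun k hh).coeFn_toLp] with z hz hxz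
    rw [hx, hxz, ENNReal.toReal_ofReal (Real.rpow_nonneg hz.1.le _), Complex.real_smul,
      RCLike.inner_apply, modeFun, map_mul, map_mul, map_one, Complex.conj_ofReal, ← fourier_neg]
    have h2 : ((z.1 ^ b : ℝ) : ℂ) =
        ((z.1 ^ (-2 * β) : ℝ) : ℂ) * ((z.1 ^ (b + 2 * β) : ℝ) : ℂ) := by
      rw [← Complex.ofReal_mul, ← Real.rpow_add hz.1]
      congr 2
      ring
    rw [h2]
    ring
  rw [integral_congr_ae hae]
  have hi := hd'.congr hae
  rw [piMeasure] at hi ⊢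
  rw [integral_prod _ hi]
  refine integral_congr_ae (Filter.Eventually.of_forall fun s => ?_)
  simp only [modeCoeff, fourierCoeff, smul_eq_mul]
  rw [integral_const_mul]

/-- The boundary values of the Fourier modes are continuous functionals. -/
theorem KS.exists_bdry {m : ℕ} {σ γ : ℝ} (hm : 1 ≤ m) (hγ : 0 ≤ γ) (k : ℤ) :
    ∃ Λ : KS m σ γ → ℂ, Continuous Λ ∧ ∀ u d, HasD (modeCoeff u.toFun k) d →
      Λ u = bdry (modeCoeff u.toFun k) d := by
  let i0 : KIdx m := ⟨(⟨0, by omega⟩, ⟨0, by omega⟩), by simp⟩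
  let i1 : KIdx m := ⟨(⟨1, by omega⟩, ⟨0, by omega⟩), by simpa using hm⟩
  obtain ⟨L0, hL0⟩ := exists_clm_rpow (β := γ - (i0.1.1 : ℕ)) (b := 0)
    (by simp only [i0]; push_cast; linarith) k
  obtain ⟨L1, hL1⟩ := exists_clm_rpow (β := γ - (i1.1.1 : ℕ)) (b := 1)
    (by simp only [i1]; push_cast; linarith) k
  -- The boundary value is `∫ (ψ ∂_ψ h + h)`, hence the exponent `1` on the first derivative and `0`
  -- on the function. The prefactor undoes the multiplier, because the norm of `u` only sees
  -- `KS.mult u`.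
  refine ⟨fun u => (Real.exp (σ * |(k : ℝ)|) : ℂ)⁻¹ *
    (L1 ((KS.mult u).deriv i1) + L0 ((KS.mult u).deriv i0)), ?_, fun u d hd => ?_⟩
  · exact continuous_const.mul ((L1.continuous.comp ((K.continuous_deriv i1).comp
      KS.continuous_mult)).add (L0.continuous.comp ((K.continuous_deriv i0).comp
      KS.continuous_mult)))
  set w := KS.mult u with hw
  set e : ℂ := (Real.exp (σ * |(k : ℝ)|) : ℂ)⁻¹ with he
  have w0 := w.deriv_zero_ae
  have h1 : WeakDeriv1 (modeCoeff w.toFun k) (modeCoeff (w.deriv i1) k) :=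
    (w.deriv_spec i1).1.isWeakDeriv_zero.weakDeriv1 (w.deriv_spec i1) k
  have h2 : HasD (modeCoeff w.toFun k) fun s => s * modeCoeff (w.deriv i1) k s := by
    refine WeakDeriv1.congr h1 (Filter.EventuallyEq.refl _ _) ?_
    filter_upwards [ae_mem_Ioo_restrict] with s hs
    have h0 : (s : ℂ) ≠ 0 := by exact_mod_cast hs.1.ne'
    rw [mul_div_cancel_left₀ _ h0]
  have h3 : HasD (modeCoeff u.toFun k) fun s => e * (s * modeCoeff (w.deriv i1) k s) :=
    (h2.const_mul e).congr (u.modeCoeff_eq_mult k).symm (Filter.EventuallyEq.refl _ _)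
  have h4 := hd.unique h3
  have hI1 : IntegrableOn (fun s => ((s ^ (1 : ℝ) : ℝ) : ℂ) * modeCoeff (w.deriv i1) k s)
      (Ioo 0 1) := by
    refine InQ.integrableOn_rpow_mul (γ := γ - (i1.1.1 : ℕ))
      (inQ_modeCoeff (Lp.memLp (w.deriv i1)) k) ?_
    simp only [i1]; push_cast; linarith
  have hI0 : IntegrableOn (fun s => ((s ^ (0 : ℝ) : ℝ) : ℂ) * modeCoeff (w.deriv i0) k s)
      (Ioo 0 1) := by
    refine InQ.integrableOn_rpow_mul (γ := γ - (i0.1.1 : ℕ))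
      (inQ_modeCoeff (Lp.memLp (w.deriv i0)) k) ?_
    simp only [i0]; push_cast; linarith
  change e * (L1 (w.deriv i1) + L0 (w.deriv i0)) = _
  rw [hL0, hL1, ← integral_add hI1 hI0, ← integral_const_mul, bdry]
  refine integral_congr_ae ?_
  filter_upwards [h4, u.modeCoeff_eq_mult k, modeCoeff_congr w0 k] with s e1 e2 e3
  have e3' : modeCoeff (w.deriv i0) k s = modeCoeff w.toFun k s := e3
  have e2' : modeCoeff u.toFun k s = e * modeCoeff w.toFun k s := e2
  rw [e1, e2', e3', Real.rpow_one, Real.rpow_zero, Complex.ofReal_one]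
  ring

theorem J.completeSpace {m : ℕ} {σ lam γ : ℝ} (hσ : 0 ≤ σ) : CompleteSpace (J m σ lam γ) := by
  have := X.completeSpace (s := m) (σ := σ) m.cast_nonneg hσ
  have := KS.completeSpace (m := m) (σ := σ) (γ := lam + γ) hσ
  infer_instance

theorem J.continuous_fst {m : ℕ} {σ lam γ : ℝ} : Continuous fun u : J m σ lam γ => u.fst :=
  WithLp.continuous_fst 2 _ _

theorem J.continuous_snd {m : ℕ} {σ lam γ : ℝ} : Continuous fun u : J m σ lam γ => u.snd :=
  WithLp.continuous_snd 2 _ _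

theorem J.leadingMoment_eq {m : ℕ} {σ lam γ : ℝ} (u : J m σ lam γ) (k : ℤ) :
    u.leadingMoment k = fourierCoeff u.fst.toFun (-k) := by
  simp only [J.leadingMoment, fourierCoeff, neg_neg, smul_eq_mul, mul_comm]

theorem JTilde.completeSpace {m : ℕ} {σ γ : ℝ} (hσ : 0 ≤ σ) : CompleteSpace (JTilde m σ γ) := by
  have := J.completeSpace (m := m) (σ := σ) (lam := 0) (γ := γ) hσ
  have hc : ∀ k, Continuous fun u : J m σ 0 γ => u.leadingMoment k := fun k => by
    simp only [J.leadingMoment_eq]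
    exact (X.continuous_fourierCoeff (-k)).comp J.continuous_fst
  have : IsClosed (JTilde m σ γ : Set (J m σ 0 γ)) :=
    (isClosed_eq (hc 2) continuous_const).inter (isClosed_eq (hc (-2)) continuous_const)
  exact this.completeSpace_coe

/-! ### Functions `v(θ) ψ ^ lam + w(ψ, θ)` -/

theorem reg_rpow {σ γ n b : ℝ} (hb : γ - 1 / 2 < b) {c : ℤ → ℂ}
    (hc : ∑' k, ENNReal.ofReal (jw σ n k) * ‖c k‖ₑ ^ 2 < ⊤) (j : ℕ) :
    Reg σ γ n j fun k s => c k * ((s ^ b : ℝ) : ℂ) := by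
  have hB : Base σ γ n fun k s => c k * ((s ^ b : ℝ) : ℂ) := by
    refine ⟨fun k => inQ_rpow hb (c k), ?_⟩
    simp only [Q_rpow hb, ← mul_assoc]
    rw [ENNReal.tsum_mul_right]
    exact ENNReal.mul_lt_top hc ENNReal.ofReal_lt_top
  induction j generalizing n with
  | zero => exact hB
  | succ j ih =>
    refine ⟨hB, _, fun k => hasD_rpow b (c k), ?_⟩
    have h1 : Reg σ γ n j fun k s => c k * ((s ^ b : ℝ) : ℂ) := ih hc hB
    exact (h1.weaken (sub_le_self n zero_le_one)).const_mul b

theorem memLp_rpow_mul {γ : ℝ} {u : ℝ × Circ → ℂ} (hu : MemLp u 2 (weightedMeasure γ)) (a : ℝ) :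
    MemLp (fun z => ((z.1 ^ a : ℝ) : ℂ) * u z) 2 (weightedMeasure (γ + a)) := by
  have hm := aestronglyMeasurable_pi hu.1
  have hm' : AEStronglyMeasurable (fun z : ℝ × Circ => ((z.1 ^ a : ℝ) : ℂ) * u z) piMeasure :=
    (aestronglyMeasurable_rpow a _).comp_fst.mul hm
  refine memLp_two_of_lintegral (hm'.mono_ac (weighted_ac _)) ?_
  refine lt_of_eq_of_lt ?_ (lintegral_enorm_sq_lt_top hu)
  rw [lintegral_weighted (hm'.enorm.pow_const 2), lintegral_weighted (hm.enorm.pow_const 2)]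
  refine setLIntegral_congr_fun measurableSet_Ioo fun s hs => ?_
  simp only [enorm_mul, enorm_ofReal_rpow hs.1, mul_pow, ofReal_rpow_sq hs.1]
  rw [lintegral_const_mul' _ _ ENNReal.ofReal_ne_top, ← mul_assoc, ofReal_rpow_mul hs.1]
  congr 3
  ring

theorem memLp_weighted_mono {γ γ' : ℝ} {u : ℝ × Circ → ℂ} (hu : MemLp u 2 (weightedMeasure γ))
    (hγ : γ' ≤ γ) : MemLp u 2 (weightedMeasure γ') := by
  have hm := aestronglyMeasurable_pi hu.1
  refine memLp_two_of_lintegral (hm.mono_ac (weighted_ac _)) ?_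
  refine lt_of_le_of_lt ?_ (lintegral_enorm_sq_lt_top hu)
  rw [lintegral_weighted (hm.enorm.pow_const 2), lintegral_weighted (hm.enorm.pow_const 2)]
  refine setLIntegral_mono_ae' measurableSet_Ioo (Filter.Eventually.of_forall fun s hs => ?_)
  gcongr ENNReal.ofReal ?_ * _
  exact Real.rpow_le_rpow_of_exponent_ge hs.1 hs.2.le (by linarith)

namespace J

variable {m : ℕ} {σ lam γ : ℝ}

/-- The Fourier coefficients of the leading coefficient. -/
def lead (u : J m σ lam γ) (k : ℤ) : ℂ := fourierCoeff u.fst.toFun k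

/-- The Fourier modes of the remainder. -/
def rem (u : J m σ lam γ) (k : ℤ) : ℝ → ℂ := modeCoeff u.snd.toFun k

theorem ext_modes {u v : J m σ lam γ} (h1 : ∀ k, u.lead k = v.lead k)
    (h2 : ∀ k, u.rem k =ᵐ[volume.restrict (Ioo 0 1)] v.rem k) : u = v :=
  WithLp.ofLp_injective 2 (Prod.ext (X.ext_fourierCoeff h1) (KS.ext_modeCoeff h2))

theorem reg_rem (u : J m σ lam γ) : Reg σ (lam + γ) m m u.rem := u.snd.reg_modeCoeff

theorem tsum_lead_lt_top (u : J m σ lam γ) :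
    ∑' k, ENNReal.ofReal (jw σ m k) * ‖u.lead k‖ₑ ^ 2 < ⊤ := u.fst.tsum_lt_top

theorem modeCoeff_toFun (u : J m σ lam γ) (k : ℤ) :
    modeCoeff u.toFun k =ᵐ[volume.restrict (Ioo 0 1)]
      fun s => u.lead k * ((s ^ lam : ℝ) : ℂ) + u.rem k s := by
  filter_upwards [memLp_slice u.snd.memLp] with s hs
  have h1 : Integrable u.fst.toFun haarAddCircle := (Lp.memLp u.fst.1).integrable (by norm_num)
  have h2 := congrFun (fourierCoeff.add (h1.mul_const ((s ^ lam : ℝ) : ℂ))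
    (hs.integrable (by norm_num))) k
  refine h2.trans ?_
  rw [Pi.add_apply]
  congr 1
  have h3 := fourierCoeff.const_mul u.fst.toFun ((s ^ lam : ℝ) : ℂ) k
  have h4 : (fun x => u.fst.toFun x * ((s ^ lam : ℝ) : ℂ)) =
      fun x => ((s ^ lam : ℝ) : ℂ) * u.fst.toFun x := by
    ext x
    ring
  rw [h4]
  exact h3.trans (mul_comm _ _)

/-- The whole function has weight `lam`: the power `ψ^lam` clears the threshold `lam - 1/2`, and the
better weight of the remainder is given up. -/
theorem reg_toFun (hγ : 0 ≤ γ) (u : J m σ lam γ) : Reg σ lam m m (modeCoeff u.toFun) := by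
  have h1 := reg_rpow (b := lam) (γ := lam) (by linarith) u.tsum_lead_lt_top m
  exact (h1.add (u.reg_rem.mono (by linarith))).congr fun k => (u.modeCoeff_toFun k).symm

theorem memLp_toFun (hγ : 0 ≤ γ) (u : J m σ lam γ) : MemLp u.toFun 2 (weightedMeasure lam) := by
  refine MemLp.add (f := fun z : ℝ × Circ => u.fst.toFun z.2 * ((z.1 ^ lam : ℝ) : ℂ)) ?_
    (memLp_weighted_mono u.snd.memLp (by linarith))
  have hv := Lp.memLp u.fst.1
  have hm : AEStronglyMeasurable (fun z : ℝ × Circ => u.fst.toFun z.2 * ((z.1 ^ lam : ℝ) : ℂ))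
      piMeasure := hv.1.comp_snd.mul (aestronglyMeasurable_rpow lam _).comp_fst
  refine memLp_two_of_lintegral (hm.mono_ac (weighted_ac _)) ?_
  rw [lintegral_weighted (hm.enorm.pow_const 2)]
  have h1 : ∀ s ∈ Ioo (0 : ℝ) 1, ENNReal.ofReal (s ^ (-2 * lam)) *
      ∫⁻ x, ‖u.fst.toFun x * ((s ^ lam : ℝ) : ℂ)‖ₑ ^ 2 ∂haarAddCircle =
      ∫⁻ x, ‖u.fst.toFun x‖ₑ ^ 2 ∂haarAddCircle := by
    intro s hs
    simp only [enorm_mul, enorm_ofReal_rpow hs.1, mul_pow, ofReal_rpow_sq hs.1]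
    rw [lintegral_mul_const' _ _ ENNReal.ofReal_ne_top, mul_comm, mul_assoc, ofReal_rpow_mul hs.1]
    simp [mul_comm]
  rw [setLIntegral_congr_fun measurableSet_Ioo h1]
  simp only [lintegral_const, Measure.restrict_apply, MeasurableSet.univ, univ_inter,
    Real.volume_Ioo]
  exact ENNReal.mul_lt_top (lintegral_enorm_sq_lt_top hv) ENNReal.ofReal_lt_top

theorem exists_ks (hσ : 0 ≤ σ) (hγ : 0 ≤ γ) (u : J m σ lam γ) :
    ∃ w : KS m σ lam, w.toFun =ᵐ[piMeasure] u.toFun := by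
  obtain ⟨w, hw⟩ := KS.exists_of_reg hσ (u.reg_toFun hγ)
  exact ⟨w, ae_eq_of_modeCoeff w.memLp (u.memLp_toFun hγ) hw⟩

/-- A function determines its components `v` and `w`. -/
theorem eq_of_toFun_ae_eq (hγ : 1 / 2 ≤ γ) {u v : J m σ lam γ}
    (h : u.toFun =ᵐ[piMeasure] v.toFun) : u = v := by
  have h1 : ∀ k, (fun s => u.lead k * ((s ^ lam : ℝ) : ℂ) + u.rem k s)
      =ᵐ[volume.restrict (Ioo 0 1)] fun s => v.lead k * ((s ^ lam : ℝ) : ℂ) + v.rem k s :=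
    fun k => (u.modeCoeff_toFun k).symm.trans ((modeCoeff_congr h k).trans (v.modeCoeff_toFun k))
  have h2 : ∀ k, u.lead k = v.lead k := fun k => by
    rw [← sub_eq_zero]
    -- The difference of the leading terms equals a difference of remainders, but a nonzero multiple
    -- of `ψ^lam` is not in the weight `lam + γ` once `γ ≥ 1/2`.
    refine eq_zero_of_inQ_rpow (γ := lam + γ) (b := lam) (by linarith)
      (((v.reg_rem.base.1 k).add ((u.reg_rem.base.1 k).const_mul (-1))).congr ?_)
    filter_upwards [h1 k] with s hs
    simp only [Pi.add_apply]
    linear_combination -hs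
  refine ext_modes h2 fun k => ?_
  filter_upwards [h1 k] with s hs
  rw [h2] at hs
  linear_combination hs

end J

/-! ### The equation in the interior -/

/-- `[ψ² ∂_ψ² + 2 ψ ∂_ψ + (1 - k²) / 4] h = F` on `(0, 1)`. -/
def ModeEq (k : ℤ) (h F : ℝ → ℂ) : Prop :=
  ∃ e, HasD h e ∧ HasD e fun s => F s - e s - (1 - (k : ℂ) ^ 2) / 4 * h s

theorem LocInt.integrable_slice {u : ℝ × Circ → ℂ} (hu : LocInt u) :
    ∀ᵐ s ∂volume.restrict (Ioo (0 : ℝ) 1), Integrable (fun x => u (s, x)) haarAddCircle := by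
  have h1 : ∀ n : ℕ, ∀ᵐ s ∂volume.restrict (Icc (1 / ((n : ℝ) + 3)) (1 - 1 / ((n : ℝ) + 3))),
      Integrable (fun x => u (s, x)) (haarAddCircle (T := 2 * π)) := by
    intro n
    set a : ℝ := 1 / ((n : ℝ) + 3) with ha
    have ha0 : 0 < a := by positivity
    have h2 := hu a (1 - a) ha0 (by linarith)
    have h3 : piMeasure.restrict (Icc a (1 - a) ×ˢ univ) =
        (volume.restrict (Icc a (1 - a))).prod (haarAddCircle (T := 2 * π)) := by
      rw [piMeasure, ← Measure.prod_restrict, Measure.restrict_univ, Measure.restrict_restrict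
        measurableSet_Icc, inter_eq_left.2 (Icc_subset_Ioo ha0 (by linarith))]
    rw [IntegrableOn, h3] at h2
    exact h2.prod_right_ae
  simp only [ae_restrict_iff' measurableSet_Icc] at h1
  rw [ae_restrict_iff' measurableSet_Ioo]
  filter_upwards [ae_all_iff.2 h1] with s hs h0
  obtain ⟨n, hn⟩ := exists_nat_one_div_lt (lt_min h0.1 (sub_pos.2 h0.2))
  have h4 : 1 / ((n : ℝ) + 3) ≤ 1 / ((n : ℝ) + 1) := by gcongr; norm_num
  refine hs n ⟨h4.trans (hn.le.trans (min_le_left _ _)), ?_⟩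
  have := hn.le.trans (min_le_right _ _)
  linarith

theorem modeCoeff_operator {u u₁ u₂ uθθ : ℝ × Circ → ℂ} (h : LocInt u) (h₁ : LocInt u₁)
    (h₂ : LocInt u₂) (hθ : LocInt uθθ) (k : ℤ) :
    ∀ᵐ s ∂volume.restrict (Ioo (0 : ℝ) 1), modeCoeff (fun z => ((z.1 ^ (-(1 / 2) : ℝ) : ℝ) : ℂ) *
        ((z.1 : ℂ) ^ 2 * u₂ z + 2 * (z.1 : ℂ) * u₁ z + 1 / 4 * (u z + uθθ z))) k s =
      ((s ^ (-(1 / 2) : ℝ) : ℝ) : ℂ) * ((s : ℂ) ^ 2 * modeCoeff u₂ k s +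
        2 * (s : ℂ) * modeCoeff u₁ k s + 1 / 4 * (modeCoeff u k s + modeCoeff uθθ k s)) := by
  filter_upwards [h.integrable_slice, h₁.integrable_slice, h₂.integrable_slice,
    hθ.integrable_slice] with s i i₁ i₂ iθ
  have e1 := congrFun (fourierCoeff.add i iθ) k
  have e2 := congrFun (fourierCoeff.add (i₂.const_mul ((s : ℂ) ^ 2))
    (i₁.const_mul (2 * (s : ℂ)))) k
  have e3 := congrFun (fourierCoeff.add ((i₂.const_mul ((s : ℂ) ^ 2)).add
    (i₁.const_mul (2 * (s : ℂ)))) ((i.add iθ).const_mul (1 / 4))) k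
  have e4 := fourierCoeff.const_mul ((fun x => (s : ℂ) ^ 2 * u₂ (s, x)) +
    (fun x => 2 * (s : ℂ) * u₁ (s, x)) + fun x => 1 / 4 * (u (s, x) + uθθ (s, x)))
    ((s ^ (-(1 / 2) : ℝ) : ℝ) : ℂ) k
  refine e4.trans ?_
  have e5 := fourierCoeff.const_mul ((fun x => u (s, x)) + fun x => uθθ (s, x)) (1 / 4) k
  refine congrArg _ (e3.trans ?_)
  rw [Pi.add_apply, e2, Pi.add_apply]
  simp only [modeCoeff]
  rw [← fourierCoeff.const_mul, ← fourierCoeff.const_mul]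
  congr 1
  refine e5.trans ?_
  rw [e1, Pi.add_apply]

theorem hasD_of_isWeakDeriv {u u₁ u₂ : ℝ × Circ → ℂ} (h₁ : IsWeakDeriv 1 0 u u₁)
    (h₂ : IsWeakDeriv 2 0 u u₂) (k : ℤ) :
    HasD (modeCoeff u k) (fun s => s * modeCoeff u₁ k s) ∧
      HasD (fun s => s * modeCoeff u₁ k s)
        (fun s => (s : ℂ) ^ 2 * modeCoeff u₂ k s + s * modeCoeff u₁ k s) := by
  have a1 := h₁.1.isWeakDeriv_zero.weakDeriv1 h₁ k
  have a2 := h₁.weakDeriv1 h₂ k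
  have key : ∀ {a b : ℝ → ℂ}, WeakDeriv1 a b → HasD a fun s => s * b s := fun {a b} H => by
    refine WeakDeriv1.congr H (Filter.EventuallyEq.refl _ _) ?_
    filter_upwards [ae_mem_Ioo_restrict] with s hs
    have h0 : (s : ℂ) ≠ 0 := by exact_mod_cast hs.1.ne'
    rw [mul_div_cancel_left₀ _ h0]
  refine ⟨key a1, ((key a2).rpow_mul 1).congr (Filter.Eventually.of_forall fun s => ?_)
    (Filter.Eventually.of_forall fun s => ?_)⟩
  · simp only [Real.rpow_one]
  · simp only [Real.rpow_one, Complex.ofReal_one]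
    ring

theorem rpow_half_mul_neg {s : ℝ} (hs : 0 < s) :
    ((s ^ (1 / 2 : ℝ) : ℝ) : ℂ) * ((s ^ (-(1 / 2) : ℝ) : ℝ) : ℂ) = 1 := by
  rw [← Complex.ofReal_mul, ← Real.rpow_add hs]
  simp

/-- `ψ² ∂_ψ² + 2 ψ ∂_ψ = D² + D`, the operator `∂_θ²` acts as `-k²`, and the factor `ψ^(-1/2)` is
moved to the right-hand side. -/
theorem SolvesInterior.modeEq {u f : ℝ × Circ → ℂ} (H : SolvesInterior u f) (k : ℤ) :
    ModeEq k (modeCoeff u k) fun s => ((s ^ (1 / 2 : ℝ) : ℝ) : ℂ) * modeCoeff f k s := by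
  obtain ⟨u₁, u₂, uθθ, h₁, h₂, hθ, heq⟩ := H
  obtain ⟨b1, b2⟩ := hasD_of_isWeakDeriv h₁ h₂ k
  refine ⟨_, b1, b2.congr (Filter.EventuallyEq.refl _ _) ?_⟩
  filter_upwards [modeCoeff_operator h₁.1 h₁.2.1 h₂.2.1 hθ.2.1 k, modeCoeff_congr heq k,
    h₁.1.isWeakDeriv_zero.modeCoeff_theta hθ k, ae_mem_Ioo_restrict] with s c1 c2 c3 hs
  have hI : (Complex.I * (k : ℂ)) ^ 2 = -(k : ℂ) ^ 2 := by
    rw [mul_pow, Complex.I_sq]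
    ring
  rw [← c2, c1, c3, hI]
  linear_combination (-((s : ℂ) ^ 2 * modeCoeff u₂ k s + 2 * (s : ℂ) * modeCoeff u₁ k s +
    1 / 4 * (modeCoeff u k s + -(k : ℂ) ^ 2 * modeCoeff u k s))) * rpow_half_mul_neg hs.1

/-- As `m ≥ 2`, the second derivatives exist in weighted `L²`, so both sides of the equation lie in
one such space and are determined by their modes. -/
theorem solvesInterior_of_modeEq {m : ℕ} (hm : 2 ≤ m) {γ : ℝ} (w : K m γ) {f : ℝ × Circ → ℂ}
    (hf : MemLp f 2 (weightedMeasure (γ - 1 / 2)))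
    (H : ∀ k, ModeEq k (modeCoeff w.toFun k)
      fun s => ((s ^ (1 / 2 : ℝ) : ℝ) : ℂ) * modeCoeff f k s) : SolvesInterior w.toFun f := by
  let i1 : KIdx m := ⟨(⟨1, by omega⟩, ⟨0, by omega⟩), by simp only; omega⟩
  let i2 : KIdx m := ⟨(⟨2, by omega⟩, ⟨0, by omega⟩), by simp only; omega⟩
  let iθ : KIdx m := ⟨(⟨0, by omega⟩, ⟨2, by omega⟩), by simp only; omega⟩
  have h₁ : IsWeakDeriv 1 0 w.toFun (w.deriv i1) := w.deriv_spec i1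
  have h₂ : IsWeakDeriv 2 0 w.toFun (w.deriv i2) := w.deriv_spec i2
  have hθ : IsWeakDeriv 0 2 w.toFun (w.deriv iθ) := w.deriv_spec iθ
  refine ⟨_, _, _, h₁, h₂, hθ, ?_⟩
  have M1 : MemLp (w.deriv i1) 2 (weightedMeasure (γ - 1)) := by
    have := Lp.memLp (w.deriv i1)
    simpa [i1] using this
  have M2 : MemLp (w.deriv i2) 2 (weightedMeasure (γ - 2)) := by
    have := Lp.memLp (w.deriv i2)
    simpa [i2] using this
  have Mθ : MemLp (w.deriv iθ) 2 (weightedMeasure γ) := by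
    have := Lp.memLp (w.deriv iθ)
    simpa [iθ] using this
  have M0 : MemLp w.toFun 2 (weightedMeasure γ) := Lp.memLp w.1
  have N1 := (memLp_rpow_mul M1 1).const_mul 2
  have N2 := memLp_rpow_mul M2 2
  rw [sub_add_cancel] at N1 N2
  have N := memLp_rpow_mul ((N2.add N1).add ((M0.add Mθ).const_mul (1 / 4))) (-(1 / 2))
  rw [← sub_eq_add_neg] at N
  have hN : (fun z : ℝ × Circ => ((z.1 ^ (-(1 / 2) : ℝ) : ℝ) : ℂ) *
      (((fun z : ℝ × Circ => ((z.1 ^ (2 : ℝ) : ℝ) : ℂ) * w.deriv i2 z) +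
        (fun z : ℝ × Circ => 2 * (((z.1 ^ (1 : ℝ) : ℝ) : ℂ) * w.deriv i1 z))) +
        fun z => 1 / 4 * ((w.toFun + w.deriv iθ) z)) z) = fun z =>
      ((z.1 ^ (-(1 / 2) : ℝ) : ℝ) : ℂ) * ((z.1 : ℂ) ^ 2 * w.deriv i2 z +
        2 * (z.1 : ℂ) * w.deriv i1 z + 1 / 4 * (w.toFun z + w.deriv iθ z)) := by
    ext z
    simp only [Pi.add_apply, Real.rpow_one, Real.rpow_two]
    push_cast
    ring
  refine ae_eq_of_modeCoeff (γ := γ - 1 / 2) ?_ hf fun k => ?_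
  · rw [← hN]
    exact N
  obtain ⟨b1, b2⟩ := hasD_of_isWeakDeriv h₁ h₂ k
  obtain ⟨e, he1, he2⟩ := H k
  have c0 := he1.unique b1
  have c0' := (he2.congr c0 (Filter.EventuallyEq.refl _ _)).unique b2
  filter_upwards [modeCoeff_operator h₁.1 h₁.2.1 h₂.2.1 hθ.2.1 k, c0, c0',
    h₁.1.isWeakDeriv_zero.modeCoeff_theta hθ k, ae_mem_Ioo_restrict] with s c1 c2 c3 c4 hs
  have hI : (Complex.I * (k : ℂ)) ^ 2 = -(k : ℂ) ^ 2 := by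
    rw [mul_pow, Complex.I_sq]
    ring
  rw [c1, c4, hI]
  rw [c2] at c3
  linear_combination -((s ^ (-(1 / 2) : ℝ) : ℝ) : ℂ) * c3 +
    modeCoeff f k s * rpow_half_mul_neg hs.1

theorem SolvesInterior.congr {u u' f : ℝ × Circ → ℂ} (H : SolvesInterior u f)
    (h : u =ᵐ[piMeasure] u') : SolvesInterior u' f := by
  obtain ⟨u₁, u₂, uθθ, h₁, h₂, hθ, heq⟩ := H
  refine ⟨u₁, u₂, uθθ, h₁.congr h (Filter.EventuallyEq.refl _ _),
    h₂.congr h (Filter.EventuallyEq.refl _ _), hθ.congr h (Filter.EventuallyEq.refl _ _), ?_⟩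
  filter_upwards [heq, h] with z h1 h2
  rw [← h2]
  exact h1

theorem ModeEq.congr {k : ℤ} {h h' F F' : ℝ → ℂ} (H : ModeEq k h F)
    (hh : h =ᵐ[volume.restrict (Ioo 0 1)] h') (hF : F =ᵐ[volume.restrict (Ioo 0 1)] F') :
    ModeEq k h' F' := by
  obtain ⟨e, h1, h2⟩ := H
  refine ⟨e, h1.congr hh (Filter.EventuallyEq.refl _ _), h2.congr (Filter.EventuallyEq.refl _ _) ?_⟩
  filter_upwards [hh, hF] with s e1 e2
  rw [e1, e2]

theorem ModeEq.add {k : ℤ} {h h' F F' : ℝ → ℂ} (H : ModeEq k h F) (H' : ModeEq k h' F') :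
    ModeEq k (h + h') (F + F') := by
  obtain ⟨e, h1, h2⟩ := H
  obtain ⟨e', h1', h2'⟩ := H'
  refine ⟨e + e', h1.add h1', (h2.add h2').congr (Filter.EventuallyEq.refl _ _)
    (Filter.Eventually.of_forall fun s => ?_)⟩
  simp only [Pi.add_apply]
  ring

theorem ModeEq.unique {k : ℤ} {h F F' : ℝ → ℂ} (H : ModeEq k h F) (H' : ModeEq k h F') :
    F =ᵐ[volume.restrict (Ioo 0 1)] F' := by
  obtain ⟨e, h1, h2⟩ := H
  obtain ⟨e', h1', h2'⟩ := H'
  have h3 := h1.unique h1'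
  filter_upwards [h3, (h2.congr h3 (Filter.EventuallyEq.refl _ _)).unique h2'] with s e1 e2
  rw [e1] at e2
  linear_combination e2

theorem modeEq_rpow (k : ℤ) (b : ℝ) (C : ℂ) :
    ModeEq k (fun s => C * ((s ^ b : ℝ) : ℂ))
      fun s => ((b + 1 / 2) ^ 2 - (k : ℂ) ^ 2 / 4) * (C * ((s ^ b : ℝ) : ℂ)) := by
  refine ⟨_, hasD_rpow b C, ((hasD_rpow b C).const_mul b).congr (Filter.EventuallyEq.refl _ _)
    (Filter.Eventually.of_forall fun s => ?_)⟩
  ring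

/-- The components of the interior equation. -/
theorem solvesInterior_iff {m : ℕ} (hm : 2 ≤ m) {σ γ : ℝ} (hσ : 0 ≤ σ) (hγ : 1 / 2 ≤ γ)
    {m' : ℕ} (u : J m σ (1 / 2) γ) (f : J m' σ 0 γ) :
    SolvesInterior u.toFun f.toFun ↔ ∀ k : ℤ, f.lead k = (1 - (k : ℂ) ^ 2 / 4) * u.lead k ∧
      ModeEq k (u.rem k) fun s => ((s ^ (1 / 2 : ℝ) : ℝ) : ℂ) * f.rem k s := by
  have hlead : ∀ k : ℤ, ModeEq k (fun s => u.lead k * ((s ^ (1 / 2 : ℝ) : ℝ) : ℂ))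
      fun s => (1 - (k : ℂ) ^ 2 / 4) * u.lead k * ((s ^ (1 / 2 : ℝ) : ℝ) : ℂ) := fun k => by
    refine (modeEq_rpow k (1 / 2) (u.lead k)).congr (Filter.EventuallyEq.refl _ _)
      (Filter.Eventually.of_forall fun s => ?_)
    push_cast
    ring
  have hf : ∀ k, (fun s => ((s ^ (1 / 2 : ℝ) : ℝ) : ℂ) * modeCoeff f.toFun k s)
      =ᵐ[volume.restrict (Ioo 0 1)] fun s => f.lead k * ((s ^ (1 / 2 : ℝ) : ℝ) : ℂ) +
        ((s ^ (1 / 2 : ℝ) : ℝ) : ℂ) * f.rem k s := fun k => by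
    filter_upwards [f.modeCoeff_toFun k] with s hs
    rw [hs, Real.rpow_zero, Complex.ofReal_one]
    ring
  constructor
  · intro H k
    have h1 := (H.modeEq k).congr (u.modeCoeff_toFun k) (hf k)
    -- Two successors unfold `Reg` twice and exhibit `D` and `D²` of the remainder.
    obtain ⟨m, rfl⟩ : ∃ n, m = n + 2 := ⟨m - 2, by omega⟩
    obtain ⟨-, e, he, heB, g, hg, hgR⟩ := u.reg_rem
    set F : ℝ → ℂ := fun s => g k s + e k s + (1 - (k : ℂ) ^ 2) / 4 * u.rem k s with hF
    have h2 : ModeEq k (u.rem k) F := ⟨e k, he k, (hg k).congr (Filter.EventuallyEq.refl _ _)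
      (Filter.Eventually.of_forall fun s => by simp only [hF]; ring)⟩
    have hFQ : InQ (1 / 2 + γ) F := ((hgR.base.1 k).add (heB.1 k)).add
      ((u.reg_rem.base.1 k).const_mul _)
    have h3 := h1.unique ((hlead k).add h2)
    have hfQ : InQ (1 / 2 + γ) fun s => ((s ^ (1 / 2 : ℝ) : ℝ) : ℂ) * f.rem k s := by
      have := (f.reg_rem.base.1 k).rpow_mul (1 / 2)
      rwa [zero_add, add_comm] at this
    -- Both remainders contribute functions of weight `1/2 + γ`, so the coefficients of `ψ^(1/2)`
    -- have to balance separately.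
    have h4 : f.lead k - (1 - (k : ℂ) ^ 2 / 4) * u.lead k = 0 := by
      refine eq_zero_of_inQ_rpow (γ := 1 / 2 + γ) (b := 1 / 2) (by linarith)
        ((hFQ.add (hfQ.const_mul (-1))).congr ?_)
      filter_upwards [h3] with s hs
      simp only [Pi.add_apply] at hs ⊢
      linear_combination -hs
    refine ⟨sub_eq_zero.1 h4, h2.congr (Filter.EventuallyEq.refl _ _) ?_⟩
    filter_upwards [h3] with s hs
    simp only [Pi.add_apply] at hs
    linear_combination -hs + ((s ^ (1 / 2 : ℝ) : ℝ) : ℂ) * h4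
  · intro H
    obtain ⟨w, hw⟩ := u.exists_ks hσ (by linarith)
    have hw' : w.1.toFun =ᵐ[piMeasure] u.toFun := hw
    refine SolvesInterior.congr (solvesInterior_of_modeEq hm w.1 ?_ fun k => ?_) hw'
    · rw [sub_self]
      exact f.memLp_toFun (by linarith)
    · obtain ⟨h1, h2⟩ := H k
      refine ((hlead k).add h2).congr
        ((u.modeCoeff_toFun k).symm.trans (modeCoeff_congr hw' k).symm) ?_
      filter_upwards [hf k] with s hs
      rw [hs, Pi.add_apply, h1]

/-! ### Boundary values -/

theorem fourierCoeff_const_mul_fourier (c : ℂ) (n k : ℤ) :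
    fourierCoeff (fun x : Circ => c * fourier n x) k = if k = n then c else 0 :=
  modeCoeff_modeFun n (fun _ => c) k 0

theorem norm_const_mul_fourier (c : ℂ) (n : ℤ) (x : Circ) : ‖c * fourier n x‖ = ‖c‖ := by
  rw [norm_mul, norm_fourier_apply, mul_one]

theorem fourierCoeff_tsum {c : ℤ → ℂ} (hc : Summable fun n => ‖c n‖) (k : ℤ) :
    fourierCoeff (fun x : Circ => ∑' n, c n * fourier n x) k = c k := by
  have h0 : ∀ n, fourierCoeff (fun x : Circ => c n * fourier n x) k =
      ∫ x : Circ, fourier (-k) x • (c n * fourier n x) ∂haarAddCircle := fun n => rfl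
  have h1 : ∀ n (x : Circ), ‖fourier (-k) x • (c n * fourier n x)‖ = ‖c n‖ := fun n x => by
    rw [norm_smul, norm_fourier_apply, one_mul, norm_const_mul_fourier]
  have h2 := hasSum_integral_of_summable_integral_norm (μ := haarAddCircle (T := 2 * π))
    (F := fun n x => fourier (-k) x • (c n * fourier n x)) (fun n => by
      refine Continuous.integrable_of_hasCompactSupport (by fun_prop)
        (HasCompactSupport.of_compactSpace _)) (by simpa only [h1, integral_const, probReal_univ,
          one_smul] using hc)
  have h3 : ∀ n, ∫ x : Circ, fourier (-k) x • (c n * fourier n x) ∂haarAddCircle =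
      if n = k then c k else 0 := fun n => by
    rw [← h0, fourierCoeff_const_mul_fourier]
    by_cases h : n = k
    · simp [h]
    · rw [if_neg h, if_neg (Ne.symm h)]
  simp only [h3] at h2
  refine Eq.trans ?_ (h2.unique (hasSum_ite_eq k (c k)))
  refine integral_congr_ae (Filter.Eventually.of_forall fun x => ?_)
  simp only [smul_eq_mul]
  rw [tsum_mul_left]

theorem ae_eq_of_fourierCoeff {f g : Circ → ℂ} (hf : MemLp f 2 haarAddCircle)
    (hg : MemLp g 2 haarAddCircle) (h : ∀ k, fourierCoeff f k = fourierCoeff g k) :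
    f =ᵐ[haarAddCircle] g := by
  have h1 : ∀ k, fourierCoeff (f - g) k = 0 := fun k => by
    have h2 := congrFun (fourierCoeff.add (hf.integrable (by norm_num))
      ((hg.const_mul (-1)).integrable (by norm_num))) k
    have h3 := fourierCoeff.const_mul g (-1) k
    rw [Pi.add_apply, h3, h k, neg_one_mul, add_neg_cancel] at h2
    rw [← h2]
    congr 1
    ext x
    simp [sub_eq_add_neg]
  have h2 := lintegral_enorm_sq_eq_tsum (hf.sub hg)
  simp only [h1, enorm_zero, ne_eq, OfNat.ofNat_ne_zero, not_false_eq_true, zero_pow,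
    tsum_zero] at h2
  rw [lintegral_eq_zero_iff' ((hf.sub hg).1.enorm.pow_const 2)] at h2
  filter_upwards [h2] with x hx
  simpa [sub_eq_zero] using hx

theorem summable_exp_neg_abs {σ : ℝ} (hσ : 0 < σ) :
    Summable fun k : ℤ => Real.exp (-(σ * |(k : ℝ)|)) := by
  have h1 : Summable fun n : ℕ => Real.exp (-(σ * n)) := by
    have := Real.summable_exp_nat_mul_iff.2 (neg_lt_zero.2 hσ)
    refine this.congr fun n => ?_
    congr 1
    ring
  refine Summable.of_nat_of_neg ?_ ?_ <;> simpa using h1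

/-- Each term is bounded by the whole sum, so the norms of the modes decay like `exp (-σ |k|)`. -/
theorem Base.exists_bound {σ γ n : ℝ} {h : ℤ → ℝ → ℂ} (H : Base σ γ n h) (hn : 0 ≤ n) :
    ∃ M : ℝ, 0 ≤ M ∧ ∀ k, Q γ (h k) ≤ ENNReal.ofReal (M * Real.exp (-(σ * |(k : ℝ)|)) ^ 2) := by
  refine ⟨(∑' k, ENNReal.ofReal (jw σ n k) * Q γ (h k)).toReal, ENNReal.toReal_nonneg,
    fun k => ?_⟩
  rw [ENNReal.ofReal_mul ENNReal.toReal_nonneg, ENNReal.ofReal_toReal H.2.ne]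
  have h1 : ENNReal.ofReal (Real.exp (2 * σ * |(k : ℝ)|)) * Q γ (h k) ≤
      ∑' k, ENNReal.ofReal (jw σ n k) * Q γ (h k) := by
    refine le_trans ?_ (ENNReal.le_tsum k)
    gcongr
    exact le_mul_of_one_le_left (Real.exp_pos _).le (Real.one_le_rpow (one_le_jap k) hn)
  refine le_trans (le_of_eq ?_) (mul_le_mul_left h1 _)
  rw [mul_right_comm, ← ENNReal.ofReal_mul (Real.exp_pos _).le, ← Real.exp_nat_mul,
    ← Real.exp_add]
  have : 2 * σ * |(k : ℝ)| + ((2 : ℕ) : ℝ) * -(σ * |(k : ℝ)|) = 0 := by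
    push_cast
    ring
  rw [this, Real.exp_zero, ENNReal.ofReal_one, one_mul]

/-- After multiplication by `s` only `∫_0^s F` is left, which Cauchy–Schwarz bounds uniformly on the
whole of `(0, 1]`. -/
theorem enorm_mul_solve₀_one_sq_le {γ : ℝ} (hγ : 0 ≤ γ) {F : ℝ → ℂ} (hF : InQ γ F) {s : ℝ}
    (hs : s ∈ Ioc (0 : ℝ) 1) : ‖(s : ℂ) * solve₀ 1 F s‖ₑ ^ 2 ≤ Q γ F := by
  have h0 : (s : ℂ) ≠ 0 := by exact_mod_cast hs.1.ne'
  have h1 : (s : ℂ) * solve₀ 1 F s = ∫ r in Ioo (0 : ℝ) s, ((r ^ ((1 : ℝ) - 1) : ℝ) : ℂ) * F r := by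
    rw [solve₀, intervalIntegral.integral_of_le hs.1.le, integral_Ioc_eq_integral_Ioo,
      Real.rpow_neg_one, Complex.ofReal_inv, mul_inv_cancel_left₀ h0]
  have hsub : Ioo 0 s ⊆ Ioo (0 : ℝ) 1 := Ioo_subset_Ioo_right hs.2
  have h2 := lintegral_rpow_mul_sq_le (γ := γ) (b := (1 : ℝ) - 1) hsub measurableSet_Ioo hF.1
  rw [h1]
  calc _ ≤ (∫⁻ r in Ioo (0 : ℝ) s, ENNReal.ofReal (r ^ ((1 : ℝ) - 1)) * ‖F r‖ₑ) ^ 2 := by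
        gcongr
        exact enorm_integral_rpow_le measurableSet_Ioo hsub
    _ ≤ _ := h2
    _ ≤ 1 * Q γ F := by
        gcongr
        calc _ ≤ ∫⁻ r in Ioo (0 : ℝ) s, 1 := by
              refine setLIntegral_mono_ae' measurableSet_Ioo
                (Filter.Eventually.of_forall fun r hr => ?_)
              rw [← ENNReal.ofReal_one]
              refine ENNReal.ofReal_le_ofReal (Real.rpow_le_one hr.1.le (hr.2.le.trans hs.2) ?_)
              linarith
          _ ≤ 1 := by
              simpa using hs.2
    _ = _ := one_mul _

theorem piMeasure_eq_restrict : piMeasure =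
    ((volume : Measure ℝ).prod (haarAddCircle (T := 2 * π))).restrict (Ioo 0 1 ×ˢ univ) := by
  rw [piMeasure, ← Measure.prod_restrict, Measure.restrict_univ]

/-- Each mode is `ψ^(-1) ∫_0^ψ (d + h)`. After multiplication by `ψ` the modes are bounded by a
multiple of `exp (-σ |k|)` uniformly in `ψ`, so with `σ > 0` their Fourier series converges
uniformly to a continuous function `V`; the representative is `U = ψ^(-1) V`. -/
theorem exists_trace {σ γ n : ℝ} (hσ : 0 < σ) (hγ : 0 ≤ γ) (hn : 1 ≤ n) {u : ℝ × Circ → ℂ}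
    (hu : MemLp u 2 (weightedMeasure γ)) (H : Reg σ γ n 1 (modeCoeff u)) {d : ℤ → ℝ → ℂ}
    (hd : ∀ k, HasD (modeCoeff u k) (d k)) :
    ∃ U : ℝ × Circ → ℂ, ContinuousOn U (Ioc 0 1 ×ˢ univ) ∧ u =ᵐ[piMeasure] U ∧
      ∀ k, fourierCoeff (fun x => U (1, x)) k = bdry (modeCoeff u k) (d k) := by
  obtain ⟨hB, d', hd', hB'⟩ := H
  replace hB' : Base σ γ (n - 1) d :=
    (show Base σ γ (n - 1) d' from hB').congr fun k => (hd' k).unique (hd k)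
  have hκ : 0 < 1 + γ - 1 / 2 := by linarith
  obtain ⟨M, hM0, hM⟩ := hB.exists_bound (by linarith)
  obtain ⟨M', hM0', hM'⟩ := hB'.exists_bound (by linarith)
  set F : ℤ → ℝ → ℂ := fun k s => d k s + modeCoeff u k s with hFdef
  have hF : ∀ k, InQ γ (F k) := fun k => (hB'.1 k).add (hB.1 k)
  set E : ℤ → ℝ := fun k => Real.exp (-(σ * |(k : ℝ)|)) with hE
  -- This is the constant from bounding the squared norm of `d + h` by `2 (M' + M) exp (-σ |k|)²`.
  set A : ℝ := √(2 * (M' + M)) with hA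
  have hA2 : A ^ 2 = 2 * (M' + M) := Real.sq_sqrt (by positivity)
  have hbound : ∀ k, ∀ s ∈ Ioc (0 : ℝ) 1, ‖(s : ℂ) * solve₀ 1 (F k) s‖ ≤ A * E k := by
    intro k s hs
    have h1 := (enorm_mul_solve₀_one_sq_le hγ (hF k) hs).trans
      ((Q_add_le (hB'.1 k).1).trans (mul_le_mul_right (add_le_add (hM' k) (hM k)) 2))
    have h2 : 2 * (ENNReal.ofReal (M' * E k ^ 2) + ENNReal.ofReal (M * E k ^ 2)) =
        ENNReal.ofReal ((A * E k) ^ 2) := by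
      rw [← ENNReal.ofReal_add (by positivity) (by positivity), ← ENNReal.ofReal_ofNat 2,
        ← ENNReal.ofReal_mul (by norm_num), mul_pow, hA2]
      congr 1
      ring
    rw [h2, enorm_sq_eq_ofReal, ENNReal.ofReal_le_ofReal_iff (by positivity)] at h1
    exact (abs_le_of_sq_le_sq' h1 (by positivity)).2
  have hsum : Summable fun k => A * E k := (summable_exp_neg_abs hσ).mul_left A
  have hsumk : ∀ s ∈ Ioc (0 : ℝ) 1, Summable fun k => ‖(s : ℂ) * solve₀ 1 (F k) s‖ :=
    fun s hs => Summable.of_nonneg_of_le (fun k => norm_nonneg _) (fun k => hbound k s hs) hsum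
  set V : ℝ × Circ → ℂ := fun z => ∑' k, (z.1 : ℂ) * solve₀ 1 (F k) z.1 * fourier k z.2 with hV
  have hVc : ContinuousOn V (Ioc 0 1 ×ˢ univ) := by
    refine continuousOn_tsum (fun k => ?_) hsum fun k z hz => ?_
    · refine ContinuousOn.mul (ContinuousOn.mul (by fun_prop) ?_) (by fun_prop)
      exact (continuousOn_solve₀ hκ (hF k)).comp continuousOn_fst fun z hz => hz.1
    · rw [norm_const_mul_fourier]
      exact hbound k z.1 hz.1
  have hVb : ∀ z ∈ Ioc (0 : ℝ) 1 ×ˢ (univ : Set Circ), ‖V z‖ ≤ ∑' k, A * E k := fun z hz => by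
    refine tsum_of_norm_bounded hsum.hasSum fun k => ?_
    rw [norm_const_mul_fourier]
    exact hbound k z.1 hz.1
  have hVk : ∀ s ∈ Ioc (0 : ℝ) 1, ∀ k, fourierCoeff (fun x => V (s, x)) k =
      (s : ℂ) * solve₀ 1 (F k) s := fun s hs k => fourierCoeff_tsum (hsumk s hs) k
  set U : ℝ × Circ → ℂ := fun z => ((z.1 ^ (-1 : ℝ) : ℝ) : ℂ) * V z with hU
  have hUc : ContinuousOn U (Ioc 0 1 ×ˢ univ) := by
    refine ContinuousOn.mul ?_ hVc
    exact (continuousOn_ofReal_rpow (-1)).comp continuousOn_fst fun z hz => hz.1.1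
  have hUk : ∀ s ∈ Ioc (0 : ℝ) 1, ∀ k, fourierCoeff (fun x => U (s, x)) k =
      solve₀ 1 (F k) s := fun s hs k => by
    have h0 : (s : ℂ) ≠ 0 := by exact_mod_cast hs.1.ne'
    refine (fourierCoeff.const_mul (fun x => V (s, x)) ((s ^ (-1 : ℝ) : ℝ) : ℂ) k).trans ?_
    rw [hVk s hs, Real.rpow_neg_one, Complex.ofReal_inv, inv_mul_cancel_left₀ h0]
  have hVm : AEStronglyMeasurable V piMeasure := by
    rw [piMeasure_eq_restrict]
    exact (hVc.mono (prod_mono Ioo_subset_Ioc_self Subset.rfl)).aestronglyMeasurable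
      (measurableSet_Ioo.prod MeasurableSet.univ)
  have hVL : MemLp V 2 (weightedMeasure 0) := by
    refine memLp_two_of_lintegral (hVm.mono_ac (weighted_ac _)) ?_
    rw [lintegral_weighted (hVm.enorm.pow_const 2)]
    calc _ ≤ ∫⁻ s in Ioo (0 : ℝ) 1, ENNReal.ofReal ((∑' k, A * E k) ^ 2) := by
          refine setLIntegral_mono_ae' measurableSet_Ioo
            (Filter.Eventually.of_forall fun s hs => ?_)
          rw [mul_zero, Real.rpow_zero, ENNReal.ofReal_one, one_mul]
          calc _ ≤ ∫⁻ x : Circ, ENNReal.ofReal ((∑' k, A * E k) ^ 2) ∂haarAddCircle := by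
                refine lintegral_mono fun x => ?_
                rw [enorm_sq_eq_ofReal]
                refine ENNReal.ofReal_le_ofReal (pow_le_pow_left₀ (norm_nonneg _) ?_ 2)
                exact hVb _ ⟨⟨hs.1, hs.2.le⟩, mem_univ _⟩
            _ = _ := by simp
      _ < ⊤ := by simp
  refine ⟨U, hUc, ?_, fun k => ?_⟩
  -- `V` is bounded, so `ψ^(-1) V` lies in the weight `-1`; this is the weight in which `u` and `U`
  -- are compared.
  · refine ae_eq_of_modeCoeff (γ := -1) (memLp_weighted_mono hu (by linarith)) ?_ fun k => ?_
    · have := memLp_rpow_mul hVL (-1)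
      rwa [zero_add] at this
    · have h1 := (hd k).ae_eq_solve₀ hκ (hB.1 k) (hB'.1 k)
      simp only [Complex.ofReal_one, one_mul] at h1
      filter_upwards [h1, ae_mem_Ioo_restrict] with s h2 hs
      rw [h2]
      exact (hUk s ⟨hs.1, hs.2.le⟩ k).symm
  · rw [hUk 1 (right_mem_Ioc.2 zero_lt_one), solve₀_at_one]
    simp [bdry, hFdef]

/-- Two continuous representatives agree on the open set, hence along each segment up to `ψ = 1`;
the trace does not depend on the representative. -/
theorem HasTrace.ae_eq {u : ℝ × Circ → ℂ} {h : Circ → ℂ} (H : HasTrace u h) {U : ℝ × Circ → ℂ}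
    (hU : ContinuousOn U (Ioc 0 1 ×ˢ univ)) (hu : u =ᵐ[piMeasure] U) :
    h =ᵐ[haarAddCircle] fun x => U (1, x) := by
  obtain ⟨U', hU', hu', hh⟩ := H
  have h1 : U' =ᵐ[((volume : Measure ℝ).prod (haarAddCircle (T := 2 * π))).restrict
      (Ioo 0 1 ×ˢ univ)] U := by
    rw [← piMeasure_eq_restrict]
    exact hu'.symm.trans hu
  have hsub : Ioo (0 : ℝ) 1 ×ˢ (univ : Set Circ) ⊆ Ioc 0 1 ×ˢ univ :=
    prod_mono Ioo_subset_Ioc_self Subset.rfl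
  have h2 := Measure.eqOn_open_of_ae_eq h1 (isOpen_Ioo.prod isOpen_univ) (hU'.mono hsub)
    (hU.mono hsub)
  have h3 : ∀ {W : ℝ × Circ → ℂ}, ContinuousOn W (Ioc 0 1 ×ˢ univ) → ∀ x,
      ContinuousOn (fun s => W (s, x)) (Ioc 0 1) := fun hW x =>
    hW.comp (by fun_prop) fun s hs => ⟨hs, mem_univ _⟩
  filter_upwards [hh] with x hx
  rw [hx]
  refine eqOn_Ioc_of_ae_eq (h3 hU' x) (h3 hU x) ?_ (right_mem_Ioc.2 zero_lt_one)
  filter_upwards [ae_mem_Ioo_restrict] with s hs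
  exact h2 ⟨hs, mem_univ _⟩

/-- The Fourier coefficients of `R + ((p_x - i p_y) / 2) exp (i θ) + ((p_x + i p_y) / 2) exp (- i θ)`. -/
def pressure (R px py : ℂ) (k : ℤ) : ℂ :=
  (if k = 0 then R else 0) + (if k = 1 then (px - Complex.I * py) / 2 else 0) +
    if k = -1 then (px + Complex.I * py) / 2 else 0

theorem fourierCoeff_pressure_add (R px py : ℂ) {h : Circ → ℂ} (hh : Integrable h haarAddCircle)
    (k : ℤ) : fourierCoeff (fun x : Circ => R + (px - Complex.I * py) / 2 * fourier 1 x +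
      (px + Complex.I * py) / 2 * fourier (-1) x + h x) k =
      pressure R px py k + fourierCoeff h k := by
  have hi : ∀ (c : ℂ) (n : ℤ), Integrable (fun x : Circ => c * fourier n x) haarAddCircle :=
    fun c n => Continuous.integrable_of_hasCompactSupport (by fun_prop)
      (HasCompactSupport.of_compactSpace _)
  have e1 := congrFun (fourierCoeff.add (hi R 0) (hi ((px - Complex.I * py) / 2) 1)) k
  have e2 := congrFun (fourierCoeff.add ((hi R 0).add (hi ((px - Complex.I * py) / 2) 1))
    (hi ((px + Complex.I * py) / 2) (-1))) k
  have e3 := congrFun (fourierCoeff.add (((hi R 0).add (hi ((px - Complex.I * py) / 2) 1)).add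
    (hi ((px + Complex.I * py) / 2) (-1))) hh) k
  rw [Pi.add_apply, e2, Pi.add_apply, e1, Pi.add_apply, fourierCoeff_const_mul_fourier,
    fourierCoeff_const_mul_fourier, fourierCoeff_const_mul_fourier] at e3
  rw [pressure, ← e3]
  congr 1
  ext x
  simp

/-- Functions in `L²` of the circle are compared by their Fourier coefficients. At `ψ = 1` the power
`ψ^(1/2)` is one, so the mode of the trace is the leading coefficient plus the boundary value of the
remainder. -/
theorem J.solvesBoundary_iff {m : ℕ} (hm : 2 ≤ m) {σ γ : ℝ} (hσ : 0 < σ) (hγ : 0 ≤ γ)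
    (u : J m σ (1 / 2) γ) {d : ℤ → ℝ → ℂ} (hd : ∀ k, HasD (u.rem k) (d k)) {s : ℝ} (g : X s σ)
    (R px py : ℂ) : SolvesBoundary R px py u.toFun g.toFun ↔ ∀ k, fourierCoeff g.toFun k =
      pressure R px py k + (u.lead k + bdry (u.rem k) (d k)) := by
  have hm' : (1 : ℝ) ≤ m := by exact_mod_cast (by omega : 1 ≤ m)
  have hreg := u.reg_toFun hγ
  have hd1 : ∀ k, HasD (modeCoeff u.toFun k)
      ((fun s => (1 / 2 : ℝ) * (u.lead k * ((s ^ (1 / 2 : ℝ) : ℝ) : ℂ))) + d k) := fun k =>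
    ((hasD_rpow (1 / 2) (u.lead k)).add (hd k)).congr (u.modeCoeff_toFun k).symm
      (Filter.EventuallyEq.refl _ _)
  have hrd : ∀ k, InQ (1 / 2 + γ) (d k) := fun k => by
    obtain ⟨m, rfl⟩ : ∃ n, m = n + 1 := ⟨m - 1, by omega⟩
    obtain ⟨-, e, he, hR⟩ := u.reg_rem
    exact (hR.base.1 k).congr ((he k).unique (hd k))
  have hb : ∀ k, bdry (modeCoeff u.toFun k)
      ((fun s => (1 / 2 : ℝ) * (u.lead k * ((s ^ (1 / 2 : ℝ) : ℝ) : ℂ))) + d k) =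
      u.lead k + bdry (u.rem k) (d k) := fun k => by
    have hκ : 0 < 1 + (1 / 2 + γ) - 1 / 2 := by linarith
    have h1 := (hd k).ae_eq_solve₀ hκ (u.reg_rem.base.1 k) (hrd k)
    have hc := continuousOn_solve₀ hκ ((hrd k).add (u.reg_rem.base.1 k))
    simp only [Complex.ofReal_one, one_mul] at h1
    have hH : ContinuousOn (fun s => u.lead k * ((s ^ (1 / 2 : ℝ) : ℝ) : ℂ) +
        solve₀ 1 (fun s => d k s + u.rem k s) s) (Ioc 0 1) := by
      refine ContinuousOn.add (continuousOn_const.mul ?_) hc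
      exact (continuousOn_ofReal_rpow _).mono fun s hs => hs.1
    rw [bdry_eq_of_continuousOn (γ := 1 / 2) (by norm_num) (hd1 k) (hreg.base.1 k) ?_ hH ?_]
    · rw [solve₀_at_one]
      simp [bdry]
    · exact ((inQ_rpow (by norm_num) (u.lead k)).const_mul _).add ((hrd k).mono (by linarith))
    · filter_upwards [h1, u.modeCoeff_toFun k] with s e1 e2
      rw [e2, e1]
  obtain ⟨U, hU, huU, hUk⟩ := exists_trace hσ (by norm_num) hm' (u.memLp_toFun hγ)
    (hreg.le (by omega)) hd1
  have hUc : Continuous fun x => U (1, x) :=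
    hU.comp_continuous (by fun_prop) fun x => ⟨right_mem_Ioc.2 zero_lt_one, mem_univ _⟩
  have hUL : MemLp (fun x => U (1, x)) 2 haarAddCircle :=
    hUc.memLp_of_hasCompactSupport (HasCompactSupport.of_compactSpace _)
  have hi := hUL.integrable (q := 2) (by norm_num)
  have key : ∀ k, fourierCoeff (fun x : Circ => R + (px - Complex.I * py) / 2 * fourier 1 x +
      (px + Complex.I * py) / 2 * fourier (-1) x + U (1, x)) k =
      pressure R px py k + (u.lead k + bdry (u.rem k) (d k)) := fun k => by
    rw [fourierCoeff_pressure_add R px py hi, hUk, hb]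
  constructor
  · rintro ⟨h, hh, hg⟩ k
    rw [← key]
    refine congrFun (fourierCoeff_congr_ae ?_) k
    filter_upwards [hg, hh.ae_eq hU huU] with x e1 e2
    rw [← e1, e2]
  · intro H
    refine ⟨fun x => U (1, x), ⟨U, hU, huU, Filter.Eventually.of_forall fun x => rfl⟩, ?_⟩
    refine ae_eq_of_fourierCoeff ?_ (Lp.memLp g.1) fun k => (key k).trans (H k).symm
    have hc : ∀ (c : ℂ) (n : ℤ), Continuous fun x : Circ => c * fourier n x := fun c n =>
      continuous_const.mul (fourier n).continuous
    exact Continuous.memLp_of_hasCompactSupport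
      (((continuous_const.add (hc _ 1)).add (hc _ (-1))).add hUc)
      (HasCompactSupport.of_compactSpace _)

/-! ### Solution of the mode equations -/

/-- The sign of `c + γ - 1/2` decides whether to integrate from `0` or from `1`; the bound is the
same in both cases. -/
theorem exists_solve {γ c : ℝ} (hκ : c + γ - 1 / 2 ≠ 0) {F : ℝ → ℂ} (hF : InQ γ F) :
    ∃ w, HasD w (fun s => F s - c * w s) ∧ InQ γ w ∧
      Q γ w ≤ ENNReal.ofReal (1 / (c + γ - 1 / 2) ^ 2) * Q γ F := by
  rcases lt_or_gt_of_ne hκ with h | h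
  · refine ⟨solve₁ c F, hasD_solve₁ c hF, inQ_solve₁ h hF, (Q_solve₁_le h hF.1).trans_eq ?_⟩
    rw [← ENNReal.ofReal_pow (one_div_nonneg.2 (by linarith)), div_pow, neg_sq, one_pow]
  · refine ⟨solve₀ c F, hasD_solve₀ h hF, inQ_solve₀ h hF, (Q_solve₀_le h hF.1).trans_eq ?_⟩
    rw [← ENNReal.ofReal_pow (one_div_nonneg.2 h.le), div_pow, one_pow]

theorem abs_intCast_cases (k : ℤ) : |(k : ℝ)| ≤ 2 ∨ 3 ≤ |(k : ℝ)| := by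
  have h : |k| ≤ 2 ∨ 3 ≤ |k| := by omega
  rw [← Int.cast_abs]
  exact_mod_cast h

/-- For `|k| ≤ 2` the base of the square is at least `γ - 1/2` and `1 + k² ≤ 5`. For `|k| ≥ 3` its
absolute value is at least `(1 - γ)(|k| - 1)/2`, and `1 + k² ≤ 10 ((|k| - 1)/2)²` with equality at
`|k| = 3`. Here the range of `γ` keeps the weight off the indicial roots. -/
theorem exists_indicial_bound {γ : ℝ} (hγ : 1 / 2 < γ) (hγ' : γ < 1) :
    ∃ η : ℝ, 0 < η ∧ ∀ k : ℤ, η * (1 + (k : ℝ) ^ 2) ≤ ((1 - |(k : ℝ)|) / 2 + γ) ^ 2 := by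
  refine ⟨min ((γ - 1 / 2) ^ 2 / 5) ((1 - γ) ^ 2 / 10), lt_min (by nlinarith) (by nlinarith),
    fun k => ?_⟩
  rw [← sq_abs (k : ℝ)]
  have ha := abs_nonneg (k : ℝ)
  rcases abs_intCast_cases k with h | h
  · calc _ ≤ (γ - 1 / 2) ^ 2 / 5 * (1 + |(k : ℝ)| ^ 2) := by gcongr; exact min_le_left _ _
      _ ≤ (γ - 1 / 2) ^ 2 / 5 * (1 + 2 ^ 2) := by gcongr
      _ = (γ - 1 / 2) ^ 2 := by ring
      _ ≤ _ := pow_le_pow_left₀ (by linarith) (by linarith) 2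
  · calc _ ≤ (1 - γ) ^ 2 / 10 * (1 + |(k : ℝ)| ^ 2) := by gcongr; exact min_le_right _ _
      _ ≤ (1 - γ) ^ 2 * ((|(k : ℝ)| - 1) / 2) ^ 2 := by
        have : 1 + |(k : ℝ)| ^ 2 ≤ 10 * ((|(k : ℝ)| - 1) / 2) ^ 2 := by nlinarith
        nlinarith [sq_nonneg (1 - γ)]
      _ = ((1 - γ) * ((|(k : ℝ)| - 1) / 2)) ^ 2 := by ring
      _ ≤ (-((1 - |(k : ℝ)|) / 2 + γ)) ^ 2 := by
        refine pow_le_pow_left₀ (mul_nonneg (by linarith) (by linarith)) ?_ 2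
        nlinarith
      _ = _ := neg_sq _

theorem ofReal_mul_le {a b c : ℝ} (ha : 0 ≤ a) (h : a * b ≤ c) :
    ENNReal.ofReal a * ENNReal.ofReal b ≤ ENNReal.ofReal c := by
  rw [← ENNReal.ofReal_mul ha]
  exact ENNReal.ofReal_le_ofReal h

/-- Solve the two first-order factors in turn, `(D + (1 + |k|)/2) y = F` and then `(D + (1 - |k|)/2)
w = y`. Each inversion gains one power of `1 + k²` in the squared norm, uniformly in `k`. -/
theorem exists_modeSol {γ : ℝ} (hγ : 1 / 2 < γ) (hγ' : γ < 1) :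
    ∃ C : ℝ, 0 ≤ C ∧ ∀ (k : ℤ) (F : ℝ → ℂ), InQ (1 / 2 + γ) F → ∃ w e, HasD w e ∧
      HasD e (fun s => F s - e s - (1 - (k : ℂ) ^ 2) / 4 * w s) ∧ InQ (1 / 2 + γ) w ∧
      InQ (1 / 2 + γ) e ∧
      ENNReal.ofReal ((1 + (k : ℝ) ^ 2) ^ 2) * Q (1 / 2 + γ) w ≤
        ENNReal.ofReal C * Q (1 / 2 + γ) F ∧
      ENNReal.ofReal (1 + (k : ℝ) ^ 2) * Q (1 / 2 + γ) e ≤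
        ENNReal.ofReal C * Q (1 / 2 + γ) F := by
  obtain ⟨η, hη, hb⟩ := exists_indicial_bound hγ hγ'
  -- The first factor costs `4` and the second `1/η`, which gives `4/η` for `w`; the estimate of `e`
  -- needs `2 (4 + (1/4)(4/η))`. The constant covers both.
  refine ⟨8 + 4 / η, by positivity, fun k F hF => ?_⟩
  set a : ℝ := |(k : ℝ)| with ha
  have ha0 : 0 ≤ a := abs_nonneg _
  have hka : (k : ℝ) ^ 2 = a ^ 2 := (sq_abs _).symm
  have hkac : (k : ℂ) ^ 2 = (a : ℂ) ^ 2 := by exact_mod_cast hka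
  set N : ℝ := 1 + (k : ℝ) ^ 2 with hN
  have hN0 : 0 < N := jap_pos k
  have hb' : η * N ≤ ((1 - a) / 2 + γ) ^ 2 := hb k
  have e1 : (1 + a) / 2 + (1 / 2 + γ) - 1 / 2 = (1 + a) / 2 + γ := by ring
  have e2 : (1 - a) / 2 + (1 / 2 + γ) - 1 / 2 = (1 - a) / 2 + γ := by ring
  have k2 : (1 - a) / 2 + γ ≠ 0 := fun h => by
    rw [h] at hb'
    nlinarith [mul_pos hη hN0]
  obtain ⟨y, hy, hyQ, hyle⟩ := exists_solve (γ := 1 / 2 + γ) (c := (1 + a) / 2)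
    (by rw [e1]; positivity) hF
  obtain ⟨w, hw, hwQ, hwle⟩ := exists_solve (γ := 1 / 2 + γ) (c := (1 - a) / 2)
    (by rwa [e2]) hyQ
  rw [e1] at hyle
  rw [e2] at hwle
  have hy1 : ENNReal.ofReal N * Q (1 / 2 + γ) y ≤ ENNReal.ofReal 4 * Q (1 / 2 + γ) F := by
    refine (mul_le_mul_right hyle _).trans ?_
    rw [← mul_assoc]
    gcongr
    refine ofReal_mul_le hN0.le ?_
    rw [mul_one_div, div_le_iff₀ (by positivity), hN, hka]
    nlinarith
  have hw1 : ENNReal.ofReal N * Q (1 / 2 + γ) w ≤ ENNReal.ofReal (1 / η) * Q (1 / 2 + γ) y := by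
    refine (mul_le_mul_right hwle _).trans ?_
    rw [← mul_assoc]
    gcongr
    refine ofReal_mul_le hN0.le ?_
    rw [mul_one_div, div_le_div_iff₀ (by positivity) hη]
    linarith
  have hw2 : ENNReal.ofReal (N ^ 2) * Q (1 / 2 + γ) w ≤
      ENNReal.ofReal (4 / η) * Q (1 / 2 + γ) F := by
    calc _ = ENNReal.ofReal N * (ENNReal.ofReal N * Q (1 / 2 + γ) w) := by
          rw [← mul_assoc, ← ENNReal.ofReal_mul hN0.le, sq]
      _ ≤ ENNReal.ofReal N * (ENNReal.ofReal (1 / η) * Q (1 / 2 + γ) y) := by gcongr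
      _ = ENNReal.ofReal (1 / η) * (ENNReal.ofReal N * Q (1 / 2 + γ) y) := by ring
      _ ≤ ENNReal.ofReal (1 / η) * (ENNReal.ofReal 4 * Q (1 / 2 + γ) F) := by gcongr
      _ = _ := by
        rw [← mul_assoc, ← ENNReal.ofReal_mul (by positivity)]
        congr 2
        ring
  have hk2 : ENNReal.ofReal ((1 - a) ^ 2 / 4) * ENNReal.ofReal N ≤
      ENNReal.ofReal (N ^ 2 / 4) := by
    refine ofReal_mul_le (by positivity) ?_
    have : (1 - a) ^ 2 ≤ N := by
      rw [hN, hka]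
      nlinarith
    nlinarith
  refine ⟨w, fun s => y s + -(((1 - a) / 2 : ℝ) : ℂ) * w s, hw.congr (Filter.EventuallyEq.refl _ _)
    (Filter.Eventually.of_forall fun s => ?_), (hy.add (hw.const_mul (-(((1 - a) / 2 : ℝ) : ℂ)))).congr
    (Filter.EventuallyEq.refl _ _) (Filter.Eventually.of_forall fun s => ?_), hwQ,
    hyQ.add (hwQ.const_mul _), ?_, ?_⟩
  · simp only
    ring
  · simp only [Pi.add_apply]
    rw [hkac]
    push_cast
    ring
  · refine hw2.trans ?_
    gcongr
    linarith
  · have hQe : Q (1 / 2 + γ) (fun s => y s + -(((1 - a) / 2 : ℝ) : ℂ) * w s) ≤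
        2 * (Q (1 / 2 + γ) y + ENNReal.ofReal ((1 - a) ^ 2 / 4) * Q (1 / 2 + γ) w) := by
      refine (Q_add_le (h' := fun s => -(((1 - a) / 2 : ℝ) : ℂ) * w s) hyQ.1).trans_eq ?_
      rw [Q_const_mul, enorm_sq_eq_ofReal, norm_neg, Complex.norm_real, Real.norm_eq_abs, sq_abs]
      congr 4
      ring
    calc _ ≤ ENNReal.ofReal N * (2 * (Q (1 / 2 + γ) y +
          ENNReal.ofReal ((1 - a) ^ 2 / 4) * Q (1 / 2 + γ) w)) := by gcongr
      _ = 2 * (ENNReal.ofReal N * Q (1 / 2 + γ) y +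
          ENNReal.ofReal ((1 - a) ^ 2 / 4) * ENNReal.ofReal N * Q (1 / 2 + γ) w) := by ring
      _ ≤ 2 * (ENNReal.ofReal 4 * Q (1 / 2 + γ) F +
          ENNReal.ofReal (1 / 4) * (ENNReal.ofReal (N ^ 2) * Q (1 / 2 + γ) w)) := by
        refine mul_le_mul_right (add_le_add hy1 ?_) 2
        rw [← mul_assoc, ← ENNReal.ofReal_mul (by norm_num : (0 : ℝ) ≤ 1 / 4)]
        gcongr
        refine hk2.trans_eq ?_
        congr 1
        ring
      _ ≤ 2 * (ENNReal.ofReal 4 * Q (1 / 2 + γ) F +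
          ENNReal.ofReal (1 / 4) * (ENNReal.ofReal (4 / η) * Q (1 / 2 + γ) F)) := by gcongr
      _ = (ENNReal.ofReal 2 * (ENNReal.ofReal 4 + ENNReal.ofReal (1 / 4) * ENNReal.ofReal (4 / η)))
          * Q (1 / 2 + γ) F := by
        rw [ENNReal.ofReal_ofNat 2]
        ring
      _ ≤ _ := by
        gcongr
        rw [← ENNReal.ofReal_mul (by norm_num), ← ENNReal.ofReal_add (by norm_num) (by positivity)]
        refine ofReal_mul_le (by norm_num) ?_
        have : 0 < 1 / η := by positivity
        have h4 : 4 / η = 4 * (1 / η) := by ring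
        rw [h4]
        linarith

/-- Elliptic bootstrapping: the equation expresses `D e` by `F`, `e` and `k² w`, and the factor `k²`
costs exactly the two extra orders of `w`. So each power of `D` on `F` gives one more on `e` and on
`w`. -/
theorem reg_of_modeEq {σ γ n : ℝ} {j : ℕ} {w e F : ℤ → ℝ → ℂ} (hw : Base σ γ (n + 2) w)
    (he : Base σ γ (n + 1) e) (h1 : ∀ k, HasD (w k) (e k))
    (h2 : ∀ k : ℤ, HasD (e k) fun s => F k s - e k s - (1 - (k : ℂ) ^ 2) / 4 * w k s)
    (hF : Reg σ γ n j F) : Reg σ γ (n + 1) (j + 1) e ∧ Reg σ γ (n + 2) (j + 2) w := by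
  have hn1 : n + 1 - 1 = n := by ring
  have hn2 : n + 2 - 1 = n + 1 := by ring
  have hn3 : n + 2 - 2 = n := by ring
  suffices H : Reg σ γ (n + 1) (j + 1) e from ⟨H, hw, e, h1, by rwa [hn2]⟩
  have key : ∀ j, Reg σ γ n j F → Reg σ γ n j e → Reg σ γ (n + 2) j w →
      Reg σ γ n j fun k s => F k s - e k s - (1 - (k : ℂ) ^ 2) / 4 * w k s := by
    intro j rF re rw'
    have r2 := rw'.sq_mul
    rw [hn3] at r2
    refine (((rF.add (re.const_mul (-1))).add ((rw'.weaken (by linarith)).const_mul (-(1 / 4)))).add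
      (r2.const_mul (1 / 4))).congr fun k => Filter.Eventually.of_forall fun s => ?_
    simp only [Pi.add_apply]
    ring
  induction j with
  | zero =>
    refine ⟨he, _, h2, ?_⟩
    rw [hn1]
    exact key 0 hF (Reg.weaken (j := 0) he (by linarith)) hw
  | succ j ih =>
    have h3 := ih hF.pred
    refine ⟨he, _, h2, ?_⟩
    rw [hn1]
    refine key (j + 1) hF (h3.weaken (by linarith)) ⟨hw, e, h1, ?_⟩
    rw [hn2]
    exact h3.pred

theorem exists_reg_modeSol {σ γ n : ℝ} (hγ : 1 / 2 < γ) (hγ' : γ < 1) {j : ℕ} {F : ℤ → ℝ → ℂ}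
    (hF : Reg σ (1 / 2 + γ) n j F) : ∃ w e : ℤ → ℝ → ℂ, (∀ k, HasD (w k) (e k)) ∧
      (∀ k : ℤ, HasD (e k) fun s => F k s - e k s - (1 - (k : ℂ) ^ 2) / 4 * w k s) ∧
      Reg σ (1 / 2 + γ) (n + 2) (j + 2) w ∧ Reg σ (1 / 2 + γ) (n + 1) (j + 1) e := by
  obtain ⟨C, hC, H⟩ := exists_modeSol hγ hγ'
  choose w e h1 h2 hw he hwle hele using fun k => H k (F k) (hF.base.1 k)
  have hB : ∀ {a : ℝ} {h : ℤ → ℝ → ℂ}, (∀ k, InQ (1 / 2 + γ) (h k)) →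
      (∀ k : ℤ, ENNReal.ofReal ((1 + (k : ℝ) ^ 2) ^ a) * Q (1 / 2 + γ) (h k) ≤
        ENNReal.ofReal C * Q (1 / 2 + γ) (F k)) → Base σ (1 / 2 + γ) (n + a) h := by
    intro a h hh hle
    refine hF.base.of_le (fun k => (hh k).1) (ENNReal.ofReal_ne_top (r := C)) fun k => ?_
    rw [jw_add, ENNReal.ofReal_mul (Real.rpow_nonneg (jap_pos k).le _), mul_right_comm]
    refine (mul_le_mul_left (hle k) _).trans_eq ?_
    ring
  have hr := reg_of_modeEq (hB hw fun k => ?_) (hB he fun k => ?_) h1 h2 hF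
  · exact ⟨w, e, h1, h2, hr.2, hr.1⟩
  · rw [Real.rpow_two]
    exact hwle k
  · rw [Real.rpow_one]
    exact hele k

/-! ### Weighted sums, the trace estimate and homogeneous solutions -/

theorem tsum_add_lt_top {w : ℤ → ℝ≥0∞} {a b : ℤ → ℂ} (ha : ∑' k, w k * ‖a k‖ₑ ^ 2 < ⊤)
    (hb : ∑' k, w k * ‖b k‖ₑ ^ 2 < ⊤) : ∑' k, w k * ‖a k + b k‖ₑ ^ 2 < ⊤ := by
  refine lt_of_le_of_lt (b := 2 * ∑' k, w k * ‖a k‖ₑ ^ 2 + 2 * ∑' k, w k * ‖b k‖ₑ ^ 2) ?_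
    (ENNReal.add_lt_top.2 ⟨ENNReal.mul_lt_top (by simp) ha, ENNReal.mul_lt_top (by simp) hb⟩)
  rw [← ENNReal.tsum_mul_left, ← ENNReal.tsum_mul_left, ← ENNReal.tsum_add]
  refine ENNReal.tsum_le_tsum fun k => ?_
  calc _ ≤ w k * (2 * (‖a k‖ₑ ^ 2 + ‖b k‖ₑ ^ 2)) := by
        gcongr
        exact enorm_add_sq_le _ _
    _ = _ := by ring

theorem tsum_lt_top_of_le {w w' : ℤ → ℝ≥0∞} {a b : ℤ → ℂ} (ha : ∑' k, w k * ‖a k‖ₑ ^ 2 < ⊤)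
    {C : ℝ} (h : ∀ k, w' k * ‖b k‖ₑ ^ 2 ≤ ENNReal.ofReal C * (w k * ‖a k‖ₑ ^ 2)) :
    ∑' k, w' k * ‖b k‖ₑ ^ 2 < ⊤ := by
  refine (ENNReal.tsum_le_tsum h).trans_lt ?_
  rw [ENNReal.tsum_mul_left]
  exact ENNReal.mul_lt_top ENNReal.ofReal_lt_top ha

theorem tsum_lt_top_of_finite {w : ℤ → ℝ} {a : ℤ → ℂ} (t : Finset ℤ)
    (h : ∀ k, k ∉ t → a k = 0) : ∑' k, ENNReal.ofReal (w k) * ‖a k‖ₑ ^ 2 < ⊤ := by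
  rw [tsum_eq_sum (s := t) fun k hk => by simp [h k hk]]
  exact ENNReal.sum_lt_top.2 fun k _ => ENNReal.mul_lt_top ENNReal.ofReal_lt_top
    (ENNReal.pow_lt_top enorm_lt_top)

theorem jw_mono {σ n n' : ℝ} (h : n ≤ n') (k : ℤ) : jw σ n k ≤ jw σ n' k :=
  mul_le_mul_of_nonneg_right (Real.rpow_le_rpow_of_exponent_le (one_le_jap k) h)
    (Real.exp_pos _).le

theorem tsum_jw_mono {σ n n' : ℝ} (h : n ≤ n') {a : ℤ → ℂ}
    (ha : ∑' k, ENNReal.ofReal (jw σ n' k) * ‖a k‖ₑ ^ 2 < ⊤) :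
    ∑' k, ENNReal.ofReal (jw σ n k) * ‖a k‖ₑ ^ 2 < ⊤ :=
  (ENNReal.tsum_le_tsum fun k => mul_le_mul_left
    (ENNReal.ofReal_le_ofReal (jw_mono h k)) _).trans_lt ha

/-- The trace theorem with half an order of loss. Taking `c = 1 + |k|` in `enorm_bdry_sq_le` bounds
the squared boundary value by `‖d‖² / (1 + |k|) + (1 + |k|) ‖h‖²`, which balances the order `n - 1`
of `d` against the order `n` of `h`. -/
theorem tsum_bdry_lt_top {σ γ n : ℝ} (hγ : 1 / 2 ≤ γ) {h d : ℤ → ℝ → ℂ} (hh : Base σ γ n h)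
    (hd : Base σ γ (n - 1) d) (H : ∀ k, HasD (h k) (d k)) :
    ∑' k, ENNReal.ofReal (jw σ (n - 1 / 2) k) * ‖bdry (h k) (d k)‖ₑ ^ 2 < ⊤ := by
  refine lt_of_le_of_lt (b := ∑' k, ENNReal.ofReal (jw σ (n - 1) k) * Q γ (d k) +
    ∑' k, 2 * (ENNReal.ofReal (jw σ n k) * Q γ (h k))) ?_ (ENNReal.add_lt_top.2 ⟨hd.2, ?_⟩)
  swap
  · rw [ENNReal.tsum_mul_left]
    exact ENNReal.mul_lt_top (by simp) hh.2
  rw [← ENNReal.tsum_add]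
  refine ENNReal.tsum_le_tsum fun k => ?_
  set a : ℝ := |(k : ℝ)| with ha
  have ha0 : 0 ≤ a := abs_nonneg _
  have hka : (k : ℝ) ^ 2 = a ^ 2 := (sq_abs _).symm
  -- The ratio of consecutive half-order weights; it is comparable to `1 + |k|`, namely `r ≤ 1 + |k|
  -- ≤ 2 r`.
  set r : ℝ := √(1 + (k : ℝ) ^ 2) with hr
  have hr0 : 0 < r := Real.sqrt_pos.2 (jap_pos k)
  have hr2 : r ^ 2 = 1 + a ^ 2 := by rw [hr, Real.sq_sqrt (jap_pos k).le, hka]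
  have hr1 : r ≤ 1 + a := by nlinarith
  have hr3 : 1 + a ≤ 2 * r :=
    (abs_le_of_sq_le_sq' (by nlinarith [sq_nonneg (1 - a)]) (by positivity)).2
  have hj1 : jw σ (n - 1 / 2) k = r * jw σ (n - 1) k := by
    rw [hr, Real.sqrt_eq_rpow, ← jw_add]
    congr 1
    ring
  have hj2 : r * jw σ (n - 1 / 2) k = jw σ n k := by
    rw [hr, Real.sqrt_eq_rpow, ← jw_add]
    congr 1
    ring
  have hb := enorm_bdry_sq_le (c := 1 + a) (by linarith) (by linarith) (H k) (hh.1 k) (hd.1 k)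
  have hQ : Q γ (fun s => d k s + ((1 + a : ℝ) : ℂ) * h k s) ≤
      2 * (Q γ (d k) + ENNReal.ofReal ((1 + a) ^ 2) * Q γ (h k)) := by
    refine (Q_add_le (h' := fun s => ((1 + a : ℝ) : ℂ) * h k s) (hd.1 k).1).trans_eq ?_
    rw [Q_const_mul, enorm_sq_eq_ofReal, Complex.norm_real, Real.norm_eq_abs, sq_abs]
  have hc : ENNReal.ofReal (1 / (2 * (1 + a + γ - 1 / 2))) ≤ ENNReal.ofReal (1 / (2 * (1 + a))) :=
    ENNReal.ofReal_le_ofReal (one_div_le_one_div_of_le (by positivity) (by linarith))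
  have hj0 := (jw_pos σ (n - 1) k).le
  have hj0' := (jw_pos σ (n - 1 / 2) k).le
  calc _ ≤ ENNReal.ofReal (jw σ (n - 1 / 2) k) * (ENNReal.ofReal (1 / (2 * (1 + a))) *
        (ENNReal.ofReal 2 * (Q γ (d k) + ENNReal.ofReal ((1 + a) ^ 2) * Q γ (h k)))) := by
        rw [ENNReal.ofReal_ofNat 2]
        gcongr
        exact hb.trans (mul_le_mul' hc hQ)
    _ = ENNReal.ofReal (jw σ (n - 1 / 2) k * (1 / (1 + a))) * Q γ (d k) +
        ENNReal.ofReal (jw σ (n - 1 / 2) k * (1 + a)) * Q γ (h k) := by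
        have x1 : ENNReal.ofReal (jw σ (n - 1 / 2) k * (1 / (1 + a))) =
            ENNReal.ofReal (jw σ (n - 1 / 2) k) * ENNReal.ofReal (1 / (2 * (1 + a))) *
              ENNReal.ofReal 2 := by
          rw [← ENNReal.ofReal_mul hj0', ← ENNReal.ofReal_mul (by positivity)]
          congr 1
          field_simp
        have x2 : ENNReal.ofReal (jw σ (n - 1 / 2) k * (1 + a)) =
            ENNReal.ofReal (jw σ (n - 1 / 2) k) * ENNReal.ofReal (1 / (2 * (1 + a))) *
              ENNReal.ofReal 2 * ENNReal.ofReal ((1 + a) ^ 2) := by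
          rw [← ENNReal.ofReal_mul hj0', ← ENNReal.ofReal_mul (by positivity),
            ← ENNReal.ofReal_mul (by positivity)]
          congr 1
          field_simp
        rw [x1, x2]
        ring
    _ ≤ ENNReal.ofReal (jw σ (n - 1) k) * Q γ (d k) +
        ENNReal.ofReal (2 * jw σ n k) * Q γ (h k) := by
        refine add_le_add (mul_le_mul_left (ENNReal.ofReal_le_ofReal ?_) _)
          (mul_le_mul_left (ENNReal.ofReal_le_ofReal ?_) _)
        · rw [mul_one_div, div_le_iff₀ (by positivity), hj1, mul_comm]
          gcongr
        · rw [← hj2]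
          nlinarith
    _ = _ := by
        rw [ENNReal.ofReal_mul (by norm_num), ENNReal.ofReal_ofNat 2, mul_assoc]

theorem inQ_zero (γ : ℝ) : InQ γ fun _ => 0 :=
  ⟨aestronglyMeasurable_const, by simp [Q]⟩

theorem reg_zero (σ γ n : ℝ) (j : ℕ) : Reg σ γ n j fun _ _ => 0 := by
  have hB : ∀ n, Base σ γ n fun _ _ => 0 := fun n => ⟨fun _ => inQ_zero γ, by simp [Q]⟩
  induction j generalizing n with
  | zero => exact hB n
  | succ j ih =>
    refine ⟨hB n, _, fun k => ?_, ih (n - 1)⟩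
    simpa using hasD_rpow 0 0

/-- The solutions `c ψ ^ ((|k| - 1) / 2)` of the homogeneous equations with `|k| ≥ 3`. -/
theorem reg_homogeneous {σ γ : ℝ} (hγ : 0 ≤ γ) (hγ' : γ < 1) {n : ℝ} {c : ℤ → ℂ}
    (hc0 : ∀ k : ℤ, |(k : ℝ)| ≤ 2 → c k = 0)
    (hc : ∑' k, ENNReal.ofReal (jw σ (n + 2 - 1 / 2) k) * ‖c k‖ₑ ^ 2 < ⊤) (j : ℕ) :
    Reg σ (1 / 2 + γ) (n + 2) (j + 2)
      fun k s => c k * ((s ^ ((|(k : ℝ)| - 1) / 2) : ℝ) : ℂ) := by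
  have hQ0 : ∀ h : ℝ → ℂ, Q (1 / 2 + γ) (fun s => 0 * h s) = 0 := fun h => by
    rw [Q_const_mul]
    simp
  have hin : ∀ k : ℤ, InQ (1 / 2 + γ) fun s => c k * ((s ^ ((|(k : ℝ)| - 1) / 2) : ℝ) : ℂ) := by
    intro k
    rcases abs_intCast_cases k with h | h
    · rw [hc0 k h]
      exact ⟨(aestronglyMeasurable_rpow _ _).const_mul 0, by rw [hQ0]; simp⟩
    · exact inQ_rpow (by linarith) _
  have hB : Base σ (1 / 2 + γ) (n + 2)
      fun k s => c k * ((s ^ ((|(k : ℝ)| - 1) / 2) : ℝ) : ℂ) := by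
    refine ⟨hin, lt_of_le_of_lt (b := ENNReal.ofReal (2 / (1 - γ)) *
      ∑' k, ENNReal.ofReal (jw σ (n + 2 - 1 / 2) k) * ‖c k‖ₑ ^ 2) ?_
      (ENNReal.mul_lt_top ENNReal.ofReal_lt_top hc)⟩
    rw [← ENNReal.tsum_mul_left]
    refine ENNReal.tsum_le_tsum fun k => ?_
    rcases abs_intCast_cases k with h | h
    · rw [hc0 k h, hQ0]
      simp
    · rw [Q_rpow (by linarith)]
      set a : ℝ := |(k : ℝ)| with ha
      have hka : (k : ℝ) ^ 2 = a ^ 2 := (sq_abs _).symm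
      set r : ℝ := √(1 + (k : ℝ) ^ 2) with hr
      have hr0 : 0 < r := Real.sqrt_pos.2 (jap_pos k)
      have hr2 : r ^ 2 = 1 + a ^ 2 := by rw [hr, Real.sq_sqrt (jap_pos k).le, hka]
      have hr3 : r ≤ 2 * (a - 1) := by nlinarith
      have hj2 : r * jw σ (n + 2 - 1 / 2) k = jw σ (n + 2) k := by
        rw [hr, Real.sqrt_eq_rpow, ← jw_add]
        congr 1
        ring
      -- The right-hand side is `a - 1 - 2γ`, the reciprocal of the squared norm of the power; as `a
      -- ≥ 3` and `γ < 1`, it grows like `a`, so extending boundary data inwards gains half an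
      -- order.
      have hd : (1 - γ) * (a - 1) ≤ 2 * ((a - 1) / 2) - 2 * (1 / 2 + γ) + 1 := by nlinarith
      have hp : 0 < (1 - γ) * (a - 1) := mul_pos (by linarith) (by linarith)
      have hj0 := (jw_pos σ (n + 2 - 1 / 2) k).le
      calc _ = ENNReal.ofReal (jw σ (n + 2) k *
            (1 / (2 * ((a - 1) / 2) - 2 * (1 / 2 + γ) + 1))) * ‖c k‖ₑ ^ 2 := by
            rw [ENNReal.ofReal_mul (jw_pos _ _ _).le]
            ring
        _ ≤ ENNReal.ofReal (2 / (1 - γ) * jw σ (n + 2 - 1 / 2) k) * ‖c k‖ₑ ^ 2 := by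
            refine mul_le_mul_left (ENNReal.ofReal_le_ofReal ?_) _
            rw [← hj2, mul_one_div, div_le_iff₀ (hp.trans_le hd)]
            have hg : 0 < 1 - γ := by linarith
            calc _ ≤ 2 * (a - 1) * jw σ (n + 2 - 1 / 2) k := by gcongr
              _ = 2 / (1 - γ) * jw σ (n + 2 - 1 / 2) k * ((1 - γ) * (a - 1)) := by
                field_simp
              _ ≤ _ := by gcongr
        _ = _ := by
            have hg : 0 < 1 - γ := by linarith
            rw [ENNReal.ofReal_mul (by positivity), mul_assoc]
  -- `D` acts on these powers as multiplication by `(|k| - 1)/2`, which costs one order.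
  have hE : Base σ (1 / 2 + γ) (n + 1) fun k s => (((|(k : ℝ)| - 1) / 2 : ℝ) : ℂ) *
      (c k * ((s ^ ((|(k : ℝ)| - 1) / 2) : ℝ) : ℂ)) := by
    refine hB.mul (C := 1) fun k => ?_
    have h1 : n + 2 - (n + 1) = 1 := by ring
    rw [h1, Real.rpow_one, one_mul, Complex.norm_real, Real.norm_eq_abs, sq_abs,
      ← sq_abs (k : ℝ)]
    gcongr
    nlinarith [abs_nonneg (k : ℝ)]
  refine (reg_of_modeEq (F := fun _ _ => 0) (j := j) hB hE (fun k => hasD_rpow _ _) (fun k => ?_)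
    ?_).2
  · refine ((hasD_rpow _ (c k)).const_mul _).congr (Filter.EventuallyEq.refl _ _)
      (Filter.Eventually.of_forall fun s => ?_)
    have hka : (k : ℂ) ^ 2 = ((|(k : ℝ)| : ℝ) : ℂ) ^ 2 := by exact_mod_cast (sq_abs (k : ℝ)).symm
    simp only [hka]
    push_cast
    ring
  · exact reg_zero _ _ _ j

/-- The homogeneous mode equation. -/
theorem homogeneous_ae_eq {γ : ℝ} (hγ : 0 ≤ γ) {k : ℤ} {h e : ℝ → ℂ} (hh : InQ (1 / 2 + γ) h)
    (he : InQ (1 / 2 + γ) e) (h1 : HasD h e)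
    (h2 : HasD e fun s => -e s - (1 - (k : ℂ) ^ 2) / 4 * h s) :
    ∃ C : ℂ, h =ᵐ[volume.restrict (Ioo 0 1)] fun s =>
      C * ((s ^ ((|(k : ℝ)| - 1) / 2) : ℝ) : ℂ) := by
  set a : ℝ := |(k : ℝ)| with ha
  have ha0 : 0 ≤ a := abs_nonneg _
  have hka' : (k : ℝ) ^ 2 = a ^ 2 := (sq_abs _).symm
  have hka : (k : ℂ) ^ 2 = (a : ℂ) ^ 2 := by exact_mod_cast hka'
  set c₂ : ℂ := (((1 - a) / 2 : ℝ) : ℂ) with hc₂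
  -- The outer factor comes first: `(D + (1 - |k|)/2) h` is a multiple of `ψ^(-(1 + |k|)/2)`, too
  -- singular for the weight, so it vanishes and a first-order equation for `h` remains.
  have h3 : HasD (e + fun s => c₂ * h s)
      fun s => -(((1 + a) / 2 : ℝ) : ℂ) * (e + fun s => c₂ * h s) s := by
    refine (h2.add (h1.const_mul c₂)).congr (Filter.EventuallyEq.refl _ _)
      (Filter.Eventually.of_forall fun s => ?_)
    simp only [Pi.add_apply, hka, hc₂]
    push_cast
    ring
  obtain ⟨C', hC'⟩ := h3.ae_eq_rpow
  have h4 : C' = 0 := eq_zero_of_inQ_rpow (γ := 1 / 2 + γ) (b := -((1 + a) / 2)) (by linarith)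
    ((he.add (hh.const_mul c₂)).congr hC')
  have h5 : HasD h fun s => -(((1 - a) / 2 : ℝ) : ℂ) * h s := by
    refine h1.congr (Filter.EventuallyEq.refl _ _) ?_
    filter_upwards [hC'] with s hs
    rw [h4, zero_mul, Pi.add_apply] at hs
    linear_combination hs
  obtain ⟨C, hC⟩ := h5.ae_eq_rpow
  refine ⟨C, hC.trans (Filter.Eventually.of_forall fun s => ?_)⟩
  have : -((1 - a) / 2) = (a - 1) / 2 := by ring
  simp only [this]

theorem bdry_rpow {γ b : ℝ} (hγ : 0 ≤ γ) (hb : γ - 1 / 2 < b) (C : ℂ) :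
    bdry (fun s => C * ((s ^ b : ℝ) : ℂ)) (fun s => b * (C * ((s ^ b : ℝ) : ℂ))) = C := by
  rw [bdry_eq_of_continuousOn hγ (hasD_rpow b C) (inQ_rpow hb C) ((inQ_rpow hb C).const_mul _)
    (H := fun s => C * ((s ^ b : ℝ) : ℂ)) ?_ (Filter.EventuallyEq.refl _ _)]
  · simp
  · exact continuousOn_const.mul ((continuousOn_ofReal_rpow b).mono fun s hs => hs.1)

theorem bdry_congr {h h' d d' : ℝ → ℂ} (hh : h =ᵐ[volume.restrict (Ioo 0 1)] h')
    (hd : d =ᵐ[volume.restrict (Ioo 0 1)] d') : bdry h d = bdry h' d' := by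
  refine integral_congr_ae ?_
  filter_upwards [hh, hd] with s e1 e2
  rw [e1, e2]

theorem InQ.integrableOn {γ : ℝ} (hγ : 0 ≤ γ) {h : ℝ → ℂ} (H : InQ γ h) :
    IntegrableOn h (Ioo 0 1) := by
  simpa using H.integrableOn_rpow_mul (b := 0) (by linarith)

theorem bdry_add {γ : ℝ} (hγ : 0 ≤ γ) {h h' d d' : ℝ → ℂ} (i1 : InQ γ h) (i2 : InQ γ h')
    (i3 : InQ γ d) (i4 : InQ γ d') : bdry (h + h') (d + d') = bdry h d + bdry h' d' := by
  refine Eq.trans (integral_congr_ae (Filter.Eventually.of_forall fun s => ?_))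
    (integral_add ((i3.add i1).integrableOn hγ) ((i4.add i2).integrableOn hγ))
  simp only [Pi.add_apply]
  ring

theorem bdry_const_mul (c : ℂ) (h d : ℝ → ℂ) :
    bdry (fun s => c * h s) (fun s => c * d s) = c * bdry h d := by
  rw [bdry, bdry, ← integral_const_mul]
  simp only [mul_add]

/-! ### Linearity and continuity of the components of `J` -/

namespace J

variable {m : ℕ} {σ lam γ : ℝ}

theorem lead_add (u v : J m σ lam γ) (k : ℤ) : (u + v).lead k = u.lead k + v.lead k :=
  X.fourierCoeff_add u.fst v.fst k

theorem lead_smul (c : ℂ) (u : J m σ lam γ) (k : ℤ) : (c • u).lead k = c * u.lead k :=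
  X.fourierCoeff_smul c u.fst k

theorem rem_add (u v : J m σ lam γ) (k : ℤ) :
    (u + v).rem k =ᵐ[volume.restrict (Ioo 0 1)] u.rem k + v.rem k :=
  K.modeCoeff_add u.snd.1 v.snd.1 k

theorem rem_smul (c : ℂ) (u : J m σ lam γ) (k : ℤ) :
    (c • u).rem k =ᵐ[volume.restrict (Ioo 0 1)] fun s => c * u.rem k s :=
  K.modeCoeff_smul c u.snd.1 k

theorem lead_zero (k : ℤ) : (0 : J m σ lam γ).lead k = 0 := by
  simpa using lead_smul 0 (0 : J m σ lam γ) k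

theorem rem_zero (k : ℤ) : (0 : J m σ lam γ).rem k =ᵐ[volume.restrict (Ioo 0 1)] 0 := by
  have h := rem_smul 0 (0 : J m σ lam γ) k
  rw [zero_smul] at h
  filter_upwards [h] with s hs
  rw [hs, zero_mul, Pi.zero_apply]

theorem exists_hasD (hm : 2 ≤ m) (u : J m σ lam γ) : ∃ e e₂ : ℤ → ℝ → ℂ,
    (∀ k, HasD (u.rem k) (e k)) ∧ (∀ k, HasD (e k) (e₂ k)) ∧
      Reg σ (lam + γ) (m - 1) (m - 2 + 1) e ∧ Reg σ (lam + γ) ((m - 2 : ℕ) : ℝ) (m - 2) e₂ := by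
  have h : Reg σ (lam + γ) m (m - 2 + 1 + 1) u.rem := by
    have : m - 2 + 1 + 1 = m := by omega
    rw [this]
    exact u.reg_rem
  obtain ⟨-, e, he, hR⟩ := h
  have hR' := hR
  obtain ⟨-, e₂, he₂, hR₂⟩ := hR'
  refine ⟨e, e₂, he, he₂, hR, ?_⟩
  rw [Nat.cast_sub hm]
  convert hR₂ using 1
  push_cast
  ring

theorem inQ_of_hasD (hm : 2 ≤ m) (u : J m σ lam γ) {k : ℤ} {d : ℝ → ℂ} (hd : HasD (u.rem k) d) :
    InQ (lam + γ) d := by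
  obtain ⟨e, -, he, -, hR, -⟩ := u.exists_hasD hm
  exact (hR.base.1 k).congr ((he k).unique hd)

theorem exists_of_modes (hσ : 0 ≤ σ) {v : ℤ → ℂ} {w : ℤ → ℝ → ℂ}
    (hv : ∑' k, ENNReal.ofReal (jw σ m k) * ‖v k‖ₑ ^ 2 < ⊤) (hw : Reg σ (lam + γ) m m w) :
    ∃ u : J m σ lam γ, (∀ k, u.lead k = v k) ∧
      ∀ k, u.rem k =ᵐ[volume.restrict (Ioo 0 1)] w k := by
  obtain ⟨a, ha⟩ := X.exists_of_tsum (Nat.cast_nonneg m) hσ hv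
  obtain ⟨b, hb⟩ := KS.exists_of_reg hσ hw
  exact ⟨WithLp.toLp 2 (a, b), ha, hb⟩

theorem continuous_lead (k : ℤ) : Continuous fun u : J m σ lam γ => u.lead k :=
  (X.continuous_fourierCoeff k).comp J.continuous_fst

theorem continuous_integral_rem (k : ℤ) {g : ℝ → ℂ} (hg : Test1 g) :
    Continuous fun u : J m σ lam γ => ∫ s in Ioo (0 : ℝ) 1, u.rem k s * g s :=
  (KS.continuous_integral_modeCoeff k hg).comp J.continuous_snd

end J

/-! ### The weak form of the mode equations -/

/-- The transpose of `ψ ∂_ψ`. -/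
def adjD (g : ℝ → ℂ) (s : ℝ) : ℂ := -1 * deriv (fun r => ((r ^ (1 : ℝ) : ℝ) : ℂ) * g r) s

theorem Test1.adjD {g : ℝ → ℂ} (hg : Test1 g) : Test1 (adjD g) :=
  (hg.rpow_mul 1).deriv.const_mul (-1)

theorem HasD.integral_mul {h d g : ℝ → ℂ} (H : HasD h d) (hg : Test1 g) :
    ∫ s in Ioo (0 : ℝ) 1, d s * g s = ∫ s in Ioo (0 : ℝ) 1, h s * adjD g s := by
  have h1 := H.2.2 _ (hg.rpow_mul 1)
  have h2 : ∫ s in Ioo (0 : ℝ) 1, d s * g s =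
      ∫ s in Ioo (0 : ℝ) 1, d s / s * (((s ^ (1 : ℝ) : ℝ) : ℂ) * g s) := by
    refine setIntegral_congr_fun measurableSet_Ioo fun s hs => ?_
    have h0 : (s : ℂ) ≠ 0 := by exact_mod_cast hs.1.ne'
    simp only [Real.rpow_one]
    field_simp
  rw [h2, ← neg_eq_iff_eq_neg.2 h1, ← integral_neg]
  refine setIntegral_congr_fun measurableSet_Ioo fun s hs => ?_
  simp only [FlowLines.adjD]
  ring

/-- The transpose of `ψ² ∂_ψ² + 2 ψ ∂_ψ + (1 - k²) / 4`. -/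
def adjOp (k : ℤ) (g : ℝ → ℂ) (s : ℝ) : ℂ :=
  adjD (adjD g) s + adjD g s + (1 - (k : ℂ) ^ 2) / 4 * g s

theorem Test1.adjOp {g : ℝ → ℂ} (hg : Test1 g) (k : ℤ) : Test1 (adjOp k g) :=
  (hg.adjD.adjD.add hg.adjD).add (hg.const_mul _)

/-- Moving all derivatives to the test function removes `e` from the equation and leaves only
integrals of `F` and `h` against test functions. In this form the equation is preserved under
limits. -/
theorem hasD_iff_integral {k : ℤ} {h e e₂ F : ℝ → ℂ} (h1 : HasD h e) (h2 : HasD e e₂)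
    (hF : LocInt1 F) : HasD e (fun s => F s - e s - (1 - (k : ℂ) ^ 2) / 4 * h s) ↔
      ∀ g, Test1 g → ∫ s in Ioo (0 : ℝ) 1, F s * g s =
        ∫ s in Ioo (0 : ℝ) 1, h s * adjOp k g s := by
  set G : ℝ → ℂ := (e₂ + e) + fun s => (1 - (k : ℂ) ^ 2) / 4 * h s with hG
  have hGL : LocInt1 G := (h2.locInt1_right.add h1.locInt1_right).add (h1.1.const_mul _)
  have key : ∀ g, Test1 g → ∫ s in Ioo (0 : ℝ) 1, G s * g s =
      ∫ s in Ioo (0 : ℝ) 1, h s * adjOp k g s := by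
    intro g hg
    have i1 := h2.locInt1_right.integrable_mul hg
    have i2 := h1.locInt1_right.integrable_mul hg
    have i3 := h1.1.integrable_mul (hg.const_mul ((1 - (k : ℂ) ^ 2) / 4))
    have j1 := h1.1.integrable_mul hg.adjD.adjD
    have j2 := h1.1.integrable_mul hg.adjD
    have e1 : ∫ s in Ioo (0 : ℝ) 1, G s * g s = ∫ s in Ioo (0 : ℝ) 1, (e₂ s * g s + e s * g s +
        h s * ((1 - (k : ℂ) ^ 2) / 4 * g s)) := by
      refine integral_congr_ae (Filter.Eventually.of_forall fun s => ?_)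
      simp only [hG, Pi.add_apply]
      ring
    have e2 : ∫ s in Ioo (0 : ℝ) 1, h s * adjOp k g s = ∫ s in Ioo (0 : ℝ) 1,
        (h s * adjD (adjD g) s + h s * adjD g s + h s * ((1 - (k : ℂ) ^ 2) / 4 * g s)) := by
      refine integral_congr_ae (Filter.Eventually.of_forall fun s => ?_)
      simp only [adjOp]
      ring
    have add3 : ∀ {a b c : ℝ → ℂ}, IntegrableOn a (Ioo 0 1) → IntegrableOn b (Ioo 0 1) →
        IntegrableOn c (Ioo 0 1) → ∫ s in Ioo (0 : ℝ) 1, (a s + b s + c s) =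
          (∫ s in Ioo (0 : ℝ) 1, a s) + (∫ s in Ioo (0 : ℝ) 1, b s) +
            ∫ s in Ioo (0 : ℝ) 1, c s := fun ia ib ic => by
      rw [← integral_add ia ib]
      exact integral_add (ia.add ib) ic
    rw [e1, e2, add3 i1 i2 i3, add3 j1 j2 i3, h2.integral_mul hg, h1.integral_mul hg.adjD, h1.integral_mul hg]
  constructor
  · intro H g hg
    rw [← key g hg]
    refine integral_congr_ae ?_
    filter_upwards [H.unique h2] with s hs
    simp only [hG, Pi.add_apply]
    rw [← hs]
    ring
  · intro H
    have h3 : F + (fun s => -1 * G s) =ᵐ[volume.restrict (Ioo 0 1)] 0 := by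
      refine (hF.add (hGL.const_mul (-1))).ae_eq_zero fun g hg => ?_
      have e1 : ∫ s in Ioo (0 : ℝ) 1, (F + fun s => -1 * G s) s * g s =
          ∫ s in Ioo (0 : ℝ) 1, (F s * g s - G s * g s) := by
        refine integral_congr_ae (Filter.Eventually.of_forall fun s => ?_)
        simp only [Pi.add_apply]
        ring
      rw [e1, integral_sub (hF.integrable_mul hg) (hGL.integrable_mul hg), H g hg, key g hg,
        sub_self]
    refine h2.congr (Filter.EventuallyEq.refl _ _) ?_
    filter_upwards [h3] with s hs
    simp only [hG, Pi.add_apply, Pi.zero_apply] at hs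
    linear_combination -hs

/-! ### The linear problem in terms of Fourier coefficients -/

/-- The linear problem, mode by mode. -/
def SolvesModes {m m' : ℕ} {σ γ s : ℝ} (R px py : ℂ) (u : J m σ (1 / 2) γ) (f : J m' σ 0 γ)
    (g : X s σ) : Prop :=
  ∀ k : ℤ, f.lead k = (1 - (k : ℂ) ^ 2 / 4) * u.lead k ∧ ∃ e, HasD (u.rem k) e ∧
    HasD e (fun s => ((s ^ (1 / 2 : ℝ) : ℝ) : ℂ) * f.rem k s - e s -
      (1 - (k : ℂ) ^ 2) / 4 * u.rem k s) ∧
    fourierCoeff g.toFun k = pressure R px py k + (u.lead k + bdry (u.rem k) e)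

section Problem

variable {m m' : ℕ} {σ γ s : ℝ}

theorem solvesModes_iff (hm : 2 ≤ m) (hσ : 0 < σ) (hγ : 1 / 2 ≤ γ) {R px py : ℂ}
    {u : J m σ (1 / 2) γ} {f : J m' σ 0 γ} {g : X s σ} : SolvesModes R px py u f g ↔
      SolvesInterior u.toFun f.toFun ∧ SolvesBoundary R px py u.toFun g.toFun := by
  rw [solvesInterior_iff hm hσ.le hγ]
  constructor
  · intro H
    choose h1 e h2 h3 h4 using H
    exact ⟨fun k => ⟨h1 k, e k, h2 k, h3 k⟩,
      (J.solvesBoundary_iff hm hσ (by linarith) u h2 g R px py).2 h4⟩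
  · rintro ⟨H1, H2⟩
    choose h1 e h2 h3 using H1
    rw [J.solvesBoundary_iff hm hσ (by linarith) u h2 g R px py] at H2
    exact fun k => ⟨h1 k, e k, h2 k, h3 k, H2 k⟩

theorem pressure_add (R px py R' px' py' : ℂ) (k : ℤ) :
    pressure (R + R') (px + px') (py + py') k = pressure R px py k + pressure R' px' py' k := by
  simp only [pressure]
  split_ifs <;> ring

theorem pressure_mul (c R px py : ℂ) (k : ℤ) :
    pressure (c * R) (c * px) (c * py) k = c * pressure R px py k := by
  simp only [pressure]
  split_ifs <;> ring

theorem SolvesModes.add (hm : 2 ≤ m) (hγ : 0 ≤ γ) {R px py R' px' py' : ℂ}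
    {u u' : J m σ (1 / 2) γ} {f f' : J m' σ 0 γ} {g g' : X s σ} (H : SolvesModes R px py u f g)
    (H' : SolvesModes R' px' py' u' f' g') :
    SolvesModes (R + R') (px + px') (py + py') (u + u') (f + f') (g + g') := by
  intro k
  obtain ⟨h1, e, h2, h3, h4⟩ := H k
  obtain ⟨h1', e', h2', h3', h4'⟩ := H' k
  refine ⟨?_, e + e', (h2.add h2').congr (J.rem_add u u' k).symm (Filter.EventuallyEq.refl _ _),
    (h3.add h3').congr (Filter.EventuallyEq.refl _ _) ?_, ?_⟩
  · rw [J.lead_add, J.lead_add, h1, h1']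
    ring
  · filter_upwards [J.rem_add u u' k, J.rem_add f f' k] with s a1 a2
    rw [a1, a2]
    simp only [Pi.add_apply]
    ring
  · rw [X.fourierCoeff_add, h4, h4', pressure_add, J.lead_add,
      bdry_congr (J.rem_add u u' k) (Filter.EventuallyEq.refl _ _),
      bdry_add (by linarith) (u.reg_rem.base.1 k) (u'.reg_rem.base.1 k) (u.inQ_of_hasD hm h2)
        (u'.inQ_of_hasD hm h2')]
    ring

theorem SolvesModes.smul (c : ℂ) {R px py : ℂ} {u : J m σ (1 / 2) γ} {f : J m' σ 0 γ} {g : X s σ}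
    (H : SolvesModes R px py u f g) :
    SolvesModes (c * R) (c * px) (c * py) (c • u) (c • f) (c • g) := by
  intro k
  obtain ⟨h1, e, h2, h3, h4⟩ := H k
  refine ⟨?_, _, (h2.const_mul c).congr (J.rem_smul c u k).symm (Filter.EventuallyEq.refl _ _),
    (h3.const_mul c).congr (Filter.EventuallyEq.refl _ _) ?_, ?_⟩
  · rw [J.lead_smul, J.lead_smul, h1]
    ring
  · filter_upwards [J.rem_smul c u k, J.rem_smul c f k] with s a1 a2
    rw [a1, a2]
    ring
  · rw [X.fourierCoeff_smul, h4, pressure_mul, J.lead_smul,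
      bdry_congr (J.rem_smul c u k) (Filter.EventuallyEq.refl _ _), bdry_const_mul]
    ring

/-- Neither the equation nor the boundary value depends on the choice of `e`, since `D h` is unique
almost everywhere. -/
theorem SolvesModes.unique_right {R px py : ℂ} {u : J m σ (1 / 2) γ} {f f' : J m' σ 0 γ}
    {g g' : X s σ} (H : SolvesModes R px py u f g) (H' : SolvesModes R px py u f' g') :
    f = f' ∧ g = g' := by
  refine ⟨J.ext_modes (fun k => (H k).1.trans (H' k).1.symm) fun k => ?_,
    X.ext_fourierCoeff fun k => ?_⟩
  · obtain ⟨-, e, h2, h3, -⟩ := H k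
    obtain ⟨-, e', h2', h3', -⟩ := H' k
    have h4 := ModeEq.unique (k := k) ⟨e, h2, h3⟩ ⟨e', h2', h3'⟩
    filter_upwards [h4, ae_mem_Ioo_restrict] with s hs hs0
    exact mul_left_cancel₀ (left_ne_zero_of_mul_eq_one (rpow_half_mul_neg hs0.1)) hs
  · obtain ⟨-, e, h2, -, h4⟩ := H k
    obtain ⟨-, e', h2', -, h4'⟩ := H' k
    rw [h4, h4', bdry_congr (Filter.EventuallyEq.refl _ _) (h2.unique h2')]

theorem one_sub_sq_ne_zero {k : ℤ} (h : ¬(k = 2 ∨ k = -2)) : 1 - (k : ℂ) ^ 2 / 4 ≠ 0 := by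
  intro h0
  have h1 : ((k : ℂ) - 2) * (k + 2) = 0 := by linear_combination -4 * h0
  have h2 : (k - 2) * (k + 2) = 0 := by exact_mod_cast h1
  rcases mul_eq_zero.1 h2 with h3 | h3
  · exact h (Or.inl (by omega))
  · exact h (Or.inr (by omega))

/-- Every remainder is a multiple of `ψ^((|k| - 1)/2)`, and for `|k| ≤ 2` the weight makes the
multiple zero. The interior equation kills the leading coefficients except at `k = ±2`, where the
boundary condition does; it then kills the multiples for `|k| ≥ 3` and `R, p_x, p_y` for `|k| ≤ 1`.
-/
theorem SolvesModes.eq_zero (hm : 2 ≤ m) (hγ : 1 / 2 < γ) (hγ' : γ < 1) {R px py : ℂ}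
    {u : J m σ (1 / 2) γ} (H : SolvesModes R px py u (0 : J m' σ 0 γ) (0 : X s σ)) :
    R = 0 ∧ px = 0 ∧ py = 0 ∧ u = 0 := by
  have hg0 : ∀ k, fourierCoeff (0 : X s σ).toFun k = 0 := fun k => by
    simpa using X.fourierCoeff_smul 0 (0 : X s σ) k
  have main : ∀ k, ∃ C, u.rem k =ᵐ[volume.restrict (Ioo 0 1)]
      (fun s => C * ((s ^ ((|(k : ℝ)| - 1) / 2) : ℝ) : ℂ)) ∧
      (1 - (k : ℂ) ^ 2 / 4) * u.lead k = 0 ∧ pressure R px py k + (u.lead k + C) = 0 ∧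
      (|(k : ℝ)| ≤ 2 → C = 0) := by
    intro k
    obtain ⟨h1, e, h2, h3, h4⟩ := H k
    have hh := u.reg_rem.base.1 k
    have he := u.inQ_of_hasD hm h2
    obtain ⟨C, hC⟩ := homogeneous_ae_eq (by linarith) hh he h2 (h3.congr
      (Filter.EventuallyEq.refl _ _) (by
        filter_upwards [J.rem_zero (m := m') (σ := σ) (lam := 0) (γ := γ) k] with s hs
        rw [hs, Pi.zero_apply]
        ring))
    have hC2 : |(k : ℝ)| ≤ 2 → C = 0 := fun hk =>
      -- For `|k| ≤ 2` the exponent is at most `1/2`, and `1/2 < γ` is the threshold of the weight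
      -- `1/2 + γ`.
      eq_zero_of_inQ_rpow (γ := 1 / 2 + γ) (by linarith) (hh.congr hC)
    rw [J.lead_zero] at h1
    refine ⟨C, hC, h1.symm, ?_, hC2⟩
    rw [hg0, bdry_congr hC (h2.unique ((hasD_rpow _ C).congr hC.symm
      (Filter.EventuallyEq.refl _ _)))] at h4
    rcases abs_intCast_cases k with hk | hk
    · rw [hC2 hk] at h4 ⊢
      simpa [bdry] using h4.symm
    · rw [bdry_rpow (γ := 1 / 2 + γ) (by linarith) (by linarith)] at h4
      exact h4.symm
  choose C hC h1 h2 h3 using main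
  have hlead : ∀ k, u.lead k = 0 := fun k => by
    by_cases hk : k = 2 ∨ k = -2
    · have h4 := h2 k
      have h5 : pressure R px py k = 0 := by rcases hk with rfl | rfl <;> simp [pressure]
      have h6 : C k = 0 := h3 k (by rcases hk with rfl | rfl <;> simp)
      rwa [h5, h6, zero_add, add_zero] at h4
    · exact (mul_eq_zero.1 (h1 k)).resolve_left (one_sub_sq_ne_zero hk)
  have hp : ∀ k : ℤ, |(k : ℝ)| ≤ 2 → pressure R px py k = 0 := fun k hk => by
    simpa [hlead, h3 k hk] using h2 k
  have hC0 : ∀ k, C k = 0 := fun k => by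
    rcases abs_intCast_cases k with hk | hk
    · exact h3 k hk
    have h4 := h2 k
    have h5 : pressure R px py k = 0 := by
      have : k ≠ 0 ∧ k ≠ 1 ∧ k ≠ -1 := by
        refine ⟨?_, ?_, ?_⟩ <;> rintro rfl <;> norm_num at hk
      simp [pressure, this]
    rwa [h5, hlead, zero_add, zero_add] at h4
  have p0 := hp 0 (by norm_num)
  have p1 := hp 1 (by norm_num)
  have p2 := hp (-1) (by norm_num)
  simp [pressure] at p0 p1 p2
  have hpx : px = 0 := by linear_combination (1 / 2 : ℂ) * p1 + (1 / 2 : ℂ) * p2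
  refine ⟨p0, hpx, ?_, J.ext_modes (fun k => by rw [hlead, J.lead_zero]) fun k => ?_⟩
  · rw [hpx, zero_add] at p2
    exact (mul_eq_zero.1 p2).resolve_left Complex.I_ne_zero
  · refine (hC k).trans (Filter.EventuallyEq.trans ?_ (J.rem_zero k).symm)
    rw [hC0]
    exact Filter.Eventually.of_forall fun s => by simp

end Problem

theorem tsum_mul_lt_top {σ n n' C : ℝ} {c a : ℤ → ℂ}
    (ha : ∑' k, ENNReal.ofReal (jw σ n k) * ‖a k‖ₑ ^ 2 < ⊤)
    (hc : ∀ k : ℤ, ‖c k‖ ^ 2 ≤ C * (1 + (k : ℝ) ^ 2) ^ (n - n')) :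
    ∑' k, ENNReal.ofReal (jw σ n' k) * ‖c k * a k‖ₑ ^ 2 < ⊤ := by
  refine tsum_lt_top_of_le ha (C := C) fun k => ?_
  have hj := (jw_pos σ n' k).le
  have h1 : jw σ n' k * ‖c k‖ ^ 2 ≤ C * jw σ n k := by
    have h2 : jw σ n k = (1 + (k : ℝ) ^ 2) ^ (n - n') * jw σ n' k := by
      rw [← jw_add, add_sub_cancel]
    rw [h2]
    nlinarith [hc k]
  have hC : 0 ≤ C := by
    have h2 := (sq_nonneg ‖c k‖).trans (hc k)
    exact nonneg_of_mul_nonneg_left h2 (Real.rpow_pos_of_pos (jap_pos k) _)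
  rw [enorm_mul, mul_pow, ← mul_assoc, ← mul_assoc, enorm_sq_eq_ofReal (c k),
    ← ENNReal.ofReal_mul hj, ← ENNReal.ofReal_mul hC]
  exact mul_le_mul_left (ENNReal.ofReal_le_ofReal h1) _

theorem norm_one_sub_sq (k : ℤ) : ‖1 - (k : ℂ) ^ 2 / 4‖ ^ 2 = (1 - (k : ℝ) ^ 2 / 4) ^ 2 := by
  have : 1 - (k : ℂ) ^ 2 / 4 = ((1 - (k : ℝ) ^ 2 / 4 : ℝ) : ℂ) := by
    push_cast
    ring
  rw [this, Complex.norm_real, Real.norm_eq_abs, sq_abs]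

/-! ### Image, surjectivity and the closed graph -/

section Existence

variable {m : ℕ} {σ γ : ℝ}

/-- The data are read off from `u`, and the content is that they lie in the right spaces: two orders
are lost inside and half an order on the boundary. The moments of order `±2` vanish because `1 -
k²/4` does. -/
theorem exists_image (hm : 2 ≤ m) (hσ : 0 ≤ σ) (hγ : 0 ≤ γ) (R px py : ℂ)
    (u : J m σ (1 / 2) γ) : ∃ (f : JTilde (m - 2) σ γ) (g : X ((m : ℝ) - 1 / 2) σ),
      SolvesModes R px py u f.1 g := by
  have hm2 : ((m - 2 : ℕ) : ℝ) = m - 2 := by rw [Nat.cast_sub hm]; norm_num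
  have hm2' : (2 : ℝ) ≤ m := by exact_mod_cast hm
  obtain ⟨e, e₂, h1, h2, hR1, hR2⟩ := u.exists_hasD hm
  have hv : ∑' k : ℤ, ENNReal.ofReal (jw σ ((m - 2 : ℕ) : ℝ) k) *
      ‖(1 - (k : ℂ) ^ 2 / 4) * u.lead k‖ₑ ^ 2 < ⊤ := by
    refine tsum_mul_lt_top (C := 1) u.tsum_lead_lt_top fun k => ?_
    rw [norm_one_sub_sq, hm2, sub_sub_cancel, Real.rpow_two, one_mul]
    refine sq_le_sq' ?_ ?_ <;> nlinarith [sq_nonneg (k : ℝ)]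
  have hrem : Reg σ (1 / 2 + γ) ((m - 2 : ℕ) : ℝ) (m - 2) u.rem := by
    refine Reg.weaken (u.reg_rem.le (by omega)) ?_
    rw [hm2]
    linarith
  have hF : Reg σ (1 / 2 + γ) ((m - 2 : ℕ) : ℝ) (m - 2)
      fun k s => e₂ k s + e k s + (1 - (k : ℂ) ^ 2) / 4 * u.rem k s := by
    have h3 := (u.reg_rem.le (Nat.sub_le m 2)).sq_mul
    rw [← hm2] at h3
    have h4 : Reg σ (1 / 2 + γ) ((m - 2 : ℕ) : ℝ) (m - 2) e := hR1.pred.weaken (by linarith)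
    refine (((hR2.add h4).add (hrem.const_mul (1 / 4))).add (h3.const_mul (-(1 / 4)))).congr
      fun k => Filter.Eventually.of_forall fun s => ?_
    simp only [Pi.add_apply]
    ring
  -- The factor `ψ^(-1/2)` of the operator lowers the weight from `1/2 + γ` to the weight `γ` of the
  -- target.
  have hF' := hF.rpow_mul (-(1 / 2))
  have hγ2 : 1 / 2 + γ + -(1 / 2) = 0 + γ := by ring
  rw [hγ2] at hF'
  obtain ⟨f, hf1, hf2⟩ := J.exists_of_modes hσ hv hF'
  have hft : f ∈ JTilde (m - 2) σ γ := by
    have h3 : ∀ k : ℤ, f.leadingMoment k = f.lead (-k) := fun k => f.leadingMoment_eq k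
    constructor
    · rw [h3, hf1]
      norm_num
    · rw [h3, hf1]
      norm_num
  have hB : Base σ (1 / 2 + γ) ((m : ℝ) - 1) e := hR1.base
  have hg : ∑' k : ℤ, ENNReal.ofReal (jw σ ((m : ℝ) - 1 / 2) k) *
      ‖pressure R px py k + (u.lead k + bdry (u.rem k) (e k))‖ₑ ^ 2 < ⊤ := by
    refine tsum_add_lt_top (tsum_lt_top_of_finite {0, 1, -1} fun k hk => ?_)
      (tsum_add_lt_top (tsum_jw_mono (by linarith) u.tsum_lead_lt_top)
        (tsum_bdry_lt_top (by linarith) u.reg_rem.base hB h1))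
    simp only [Finset.mem_insert, Finset.mem_singleton, not_or] at hk
    simp [pressure, hk]
  obtain ⟨g, hg⟩ := X.exists_of_tsum (by linarith) hσ hg
  refine ⟨⟨f, hft⟩, g, fun k => ⟨hf1 k, e k, h1 k, ?_, hg k⟩⟩
  refine (h2 k).congr (Filter.EventuallyEq.refl _ _) ?_
  filter_upwards [hf2 k, ae_mem_Ioo_restrict] with s hs hs0
  rw [hs, ← mul_assoc, rpow_half_mul_neg hs0.1]
  ring

/-- Equivalent to `1 + k² ≤ 8 |1 - k²/4|`, which holds for `|k| ≤ 1` and for `|k| ≥ 3`, with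
equality at `|k| = 3`; this is the source of `64`. -/
theorem norm_inv_one_sub_sq_le {k : ℤ} (hk : ¬(k = 2 ∨ k = -2)) :
    ‖(1 - (k : ℂ) ^ 2 / 4)⁻¹‖ ^ 2 ≤ 64 * (1 + (k : ℝ) ^ 2) ^ (-2 : ℝ) := by
  have h1 : (1 + (k : ℝ) ^ 2) ^ 2 ≤ 64 * (1 - (k : ℝ) ^ 2 / 4) ^ 2 := by
    have h2 : |k| ≤ 1 ∨ 3 ≤ |k| := by
      rw [abs_le, le_abs]
      omega
    have h3 : |(k : ℝ)| ≤ 1 ∨ 3 ≤ |(k : ℝ)| := by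
      rw [← Int.cast_abs]
      exact_mod_cast h2
    rw [← sq_abs (k : ℝ)]
    have ha := abs_nonneg (k : ℝ)
    have h4 : 64 * (1 - |(k : ℝ)| ^ 2 / 4) ^ 2 = (8 * (1 - |(k : ℝ)| ^ 2 / 4)) ^ 2 := by ring
    rw [h4]
    refine sq_le_sq.2 ?_
    rw [abs_of_nonneg (by positivity)]
    rcases h3 with h | h
    · refine le_trans ?_ (le_abs_self _)
      nlinarith
    · refine le_trans ?_ (neg_le_abs _)
      nlinarith
  have h5 : 0 < (1 - (k : ℝ) ^ 2 / 4) ^ 2 := by nlinarith [pow_pos (jap_pos k) 2]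
  rw [norm_inv, inv_pow, norm_one_sub_sq, Real.rpow_neg (jap_pos k).le, Real.rpow_two,
    ← div_eq_mul_inv, inv_eq_one_div, div_le_div_iff₀ h5 (pow_pos (jap_pos k) 2), one_mul]
  exact h1

/-- Start from the particular remainder `w` with boundary values `b`, and correct the boundary
condition by the one free constant of each mode: the pressure terms for `|k| ≤ 1`, the leading
coefficient for `k = ±2`, a homogeneous solution for `|k| ≥ 3`. -/
theorem exists_preimage (hm : 2 ≤ m) (hσ : 0 ≤ σ) (hγ : 1 / 2 < γ) (hγ' : γ < 1)
    (f : JTilde (m - 2) σ γ) (g : X ((m : ℝ) - 1 / 2) σ) :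
    ∃ (R px py : ℂ) (u : J m σ (1 / 2) γ), SolvesModes R px py u f.1 g := by
  have hm2 : ((m - 2 : ℕ) : ℝ) + 2 = m := by rw [Nat.cast_sub hm]; norm_num
  have hm3 : m - 2 + 2 = m := by omega
  have hF := f.1.reg_rem.rpow_mul (1 / 2)
  have hγ2 : 0 + γ + 1 / 2 = 1 / 2 + γ := by ring
  rw [hγ2] at hF
  obtain ⟨w, e, h1, h2, hw, he⟩ := exists_reg_modeSol hγ hγ' hF
  rw [hm2, hm3] at hw
  set b : ℤ → ℂ := fun k => bdry (w k) (e k) with hb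
  have hbsum : ∑' k : ℤ, ENNReal.ofReal (jw σ ((m : ℝ) - 1 / 2) k) * ‖b k‖ₑ ^ 2 < ⊤ := by
    refine tsum_bdry_lt_top (by linarith) hw.base ?_ h1
    have h3 := he.base
    have : ((m - 2 : ℕ) : ℝ) + 1 = m - 1 := by linarith
    rwa [this] at h3
  set G : ℤ → ℂ := fun k => fourierCoeff g.toFun k with hG
  -- The interior equation determines `v` except at `k = ±2`, where it is chosen to satisfy the
  -- boundary condition. Writing it as a bounded multiplier plus finitely many terms makes
  -- summability immediate.
  set v : ℤ → ℂ := fun k => (if k = 2 ∨ k = -2 then 0 else (1 - (k : ℂ) ^ 2 / 4)⁻¹) * f.1.lead k +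
    if k = 2 ∨ k = -2 then G k - b k else 0 with hv
  have hvsum : ∑' k : ℤ, ENNReal.ofReal (jw σ m k) * ‖v k‖ₑ ^ 2 < ⊤ := by
    refine tsum_add_lt_top (tsum_mul_lt_top (C := 64) f.1.tsum_lead_lt_top fun k => ?_)
      (tsum_lt_top_of_finite {2, -2} fun k hk => ?_)
    · have h3 : ((m - 2 : ℕ) : ℝ) - m = -2 := by linarith
      rw [h3]
      split_ifs with hk
      · rw [norm_zero, zero_pow two_ne_zero]
        have := Real.rpow_pos_of_pos (jap_pos k) (-2)
        positivity
      · exact norm_inv_one_sub_sq_le hk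
    · simp only [Finset.mem_insert, Finset.mem_singleton] at hk
      rw [if_neg hk]
  -- The boundary defect for `|k| ≥ 3`; each homogeneous power equals one at `ψ = 1`, so the defect
  -- itself is the coefficient.
  set c : ℤ → ℂ := fun k => (if |k| ≤ 2 then 0 else 1) * (G k + -1 * (v k + b k)) with hc
  have hcsum : ∑' k : ℤ, ENNReal.ofReal (jw σ ((m : ℝ) - 1 / 2) k) * ‖c k‖ₑ ^ 2 < ⊤ := by
    refine tsum_mul_lt_top (C := 1) (n := (m : ℝ) - 1 / 2) (tsum_add_lt_top g.tsum_lt_top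
      (tsum_mul_lt_top (C := 1) (n := (m : ℝ) - 1 / 2)
        (tsum_add_lt_top (tsum_jw_mono (by linarith) hvsum) hbsum) fun k => ?_)) fun k => ?_
    · simp
    · split_ifs <;> simp
  have hc0 : ∀ k : ℤ, |(k : ℝ)| ≤ 2 → c k = 0 := fun k hk => by
    have h3 : |k| ≤ 2 := by exact_mod_cast hk
    simp [hc, h3]
  have hhom : Reg σ (1 / 2 + γ) m m
      fun k s => c k * ((s ^ ((|(k : ℝ)| - 1) / 2) : ℝ) : ℂ) := by
    have h3 := reg_homogeneous (σ := σ) (n := ((m - 2 : ℕ) : ℝ)) (by linarith) hγ' hc0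
      (by rwa [hm2]) (m - 2)
    rwa [hm2, hm3] at h3
  obtain ⟨u, hu1, hu2⟩ := J.exists_of_modes hσ hvsum (hw.add hhom)
  have hbdry : ∀ k : ℤ, bdry (fun s => c k * ((s ^ ((|(k : ℝ)| - 1) / 2) : ℝ) : ℂ))
      (fun s => (((|(k : ℝ)| - 1) / 2 : ℝ) : ℂ) * (c k * ((s ^ ((|(k : ℝ)| - 1) / 2) : ℝ) : ℂ))) =
      c k := fun k => by
    rcases abs_intCast_cases k with hk | hk
    · rw [hc0 k hk]
      simp [bdry]
    · exact bdry_rpow (γ := 1 / 2 + γ) (by linarith) (by linarith) _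
  have hbdry' : ∀ k : ℤ, bdry (u.rem k) (e k + fun s => (((|(k : ℝ)| - 1) / 2 : ℝ) : ℂ) *
      (c k * ((s ^ ((|(k : ℝ)| - 1) / 2) : ℝ) : ℂ))) = b k + c k := fun k => by
    have h3 := hhom.base.1 k
    rw [bdry_congr (hu2 k) (Filter.EventuallyEq.refl _ _)]
    refine (bdry_add (γ := 1 / 2 + γ) (by linarith) (hw.base.1 k) h3 (he.base.1 k)
      (h3.const_mul _)).trans ?_
    rw [hbdry]
  set A : ℤ → ℂ := fun k => G k - v k - b k with hA
  -- Inverts `(p_x - i p_y)/2 = A 1` and `(p_x + i p_y)/2 = A (-1)`.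
  refine ⟨A 0, A 1 + A (-1), Complex.I * (A 1 - A (-1)), u, fun k => ⟨?_, _,
    ((h1 k).add (hasD_rpow _ (c k))).congr (hu2 k).symm (Filter.EventuallyEq.refl _ _), ?_, ?_⟩⟩
  · rw [hu1]
    by_cases hk : k = 2 ∨ k = -2
    · have hf0 : f.1.lead k = 0 := by
        have h3 : ∀ k : ℤ, f.1.leadingMoment k = f.1.lead (-k) := fun k => f.1.leadingMoment_eq k
        have h4 := f.2.1
        have h5 := f.2.2
        rw [h3] at h4 h5
        rcases hk with rfl | rfl
        · exact h5
        · exact h4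
      have h6 : 1 - (k : ℂ) ^ 2 / 4 = 0 := by rcases hk with rfl | rfl <;> norm_num
      rw [hf0, h6, zero_mul]
    · simp only [hv, if_neg hk, add_zero]
      rw [mul_inv_cancel_left₀ (one_sub_sq_ne_zero hk)]
  · refine ((h2 k).add ((hasD_rpow _ (c k)).const_mul _)).congr (Filter.EventuallyEq.refl _ _) ?_
    filter_upwards [hu2 k] with s hs
    have hka : (k : ℂ) ^ 2 = ((|(k : ℝ)| : ℝ) : ℂ) ^ 2 := by
      exact_mod_cast (sq_abs (k : ℝ)).symm
    rw [hs]
    simp only [Pi.add_apply, hka]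
    push_cast
    ring
  · rw [hbdry', hu1]
    show G k = _
    have hI : ∀ z : ℂ, Complex.I * (Complex.I * z) = -z := fun z => by
      rw [← mul_assoc, Complex.I_mul_I]
      ring
    by_cases hk : |k| ≤ 2
    · have hck : c k = 0 := by simp [hc, hk]
      have hv2 : (k = 2 ∨ k = -2) → v k = G k - b k := fun h => by simp [hv, h]
      rw [hck]
      obtain ⟨hk1, hk2⟩ := abs_le.1 hk
      interval_cases k
      · rw [hv2 (by norm_num)]
        simp [pressure]
      · simp [pressure, hI, hA]
        ring
      · simp [pressure, hA]
      · simp [pressure, hI, hA]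
        ring
      · rw [hv2 (by norm_num)]
        simp [pressure]
    · have h3 : k ≠ 0 ∧ k ≠ 1 ∧ k ≠ -1 := by
        refine ⟨?_, ?_, ?_⟩ <;> rintro rfl <;> norm_num at hk
      simp only [pressure, h3, hc, hk, if_false]
      ring

/-! ### The isomorphism -/

/-- The graph of the linear problem. -/
def problemGraph (σ γ : ℝ) (hm : 2 ≤ m) (hγ : 0 ≤ γ) :
    Submodule ℂ (((ℂ × ℂ × ℂ) × J m σ (1 / 2) γ) ×
      (JTilde (m - 2) σ γ × X ((m : ℝ) - 1 / 2) σ)) where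
  carrier := {z | SolvesModes z.1.1.1 z.1.1.2.1 z.1.1.2.2 z.1.2 z.2.1.1 z.2.2}
  add_mem' h h' := SolvesModes.add hm hγ h h'
  zero_mem' := by
    intro k
    have h0 : fourierCoeff (0 : X ((m : ℝ) - 1 / 2) σ).toFun k = 0 := by
      simpa using X.fourierCoeff_smul 0 (0 : X ((m : ℝ) - 1 / 2) σ) k
    have hz : HasD (fun _ => 0) fun _ => 0 := by simpa using hasD_rpow 0 0
    refine ⟨?_, fun _ => 0, hz.congr (J.rem_zero k).symm (Filter.EventuallyEq.refl _ _),
      hz.congr (Filter.EventuallyEq.refl _ _) ?_, ?_⟩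
    · show (0 : J (m - 2) σ 0 γ).lead k = _ * (0 : J m σ (1 / 2) γ).lead k
      rw [J.lead_zero, J.lead_zero, mul_zero]
    · filter_upwards [J.rem_zero (m := m) (σ := σ) (lam := 1 / 2) (γ := γ) k,
        J.rem_zero (m := m - 2) (σ := σ) (lam := 0) (γ := γ) k] with s a1 a2
      have a1' : (0 : J m σ (1 / 2) γ).rem k s = 0 := a1
      have a2' : (0 : J (m - 2) σ 0 γ).rem k s = 0 := a2
      show 0 = ((s ^ (1 / 2 : ℝ) : ℝ) : ℂ) * (0 : J (m - 2) σ 0 γ).rem k s - 0 -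
        (1 - (k : ℂ) ^ 2) / 4 * (0 : J m σ (1 / 2) γ).rem k s
      rw [a1', a2']
      ring
    · refine h0.trans ?_
      show 0 = pressure 0 0 0 k + ((0 : J m σ (1 / 2) γ).lead k +
        bdry ((0 : J m σ (1 / 2) γ).rem k) fun _ => 0)
      rw [J.lead_zero, bdry_congr (J.rem_zero k) (Filter.EventuallyEq.refl _ _)]
      simp [pressure, bdry]
  smul_mem' c _ h := SolvesModes.smul c h

/-- Once `e` is eliminated, by the weak form inside and by the functionals `Λ` at the boundary,
every condition is an equality of two continuous functions of the data, and the graph is an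
intersection of closed sets. -/
theorem isClosed_problemGraph (hm : 2 ≤ m) (hγ : 0 ≤ γ) :
    IsClosed (problemGraph σ γ hm hγ : Set (((ℂ × ℂ × ℂ) × J m σ (1 / 2) γ) ×
      (JTilde (m - 2) σ γ × X ((m : ℝ) - 1 / 2) σ))) := by
  choose Λ hΛc hΛ using fun k => KS.exists_bdry (m := m) (σ := σ) (γ := 1 / 2 + γ)
    (by omega) (by linarith) k
  have key : (problemGraph σ γ hm hγ : Set (((ℂ × ℂ × ℂ) × J m σ (1 / 2) γ) ×
      (JTilde (m - 2) σ γ × X ((m : ℝ) - 1 / 2) σ))) =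
      {z | ∀ k : ℤ, (z.2.1.1.lead k = (1 - (k : ℂ) ^ 2 / 4) * z.1.2.lead k ∧
        fourierCoeff z.2.2.toFun k = pressure z.1.1.1 z.1.1.2.1 z.1.1.2.2 k +
          (z.1.2.lead k + Λ k z.1.2.snd)) ∧
        ∀ φ, Test1 φ → ∫ s in Ioo (0 : ℝ) 1, z.2.1.1.rem k s * (((s ^ (1 / 2 : ℝ) : ℝ) : ℂ) * φ s) =
          ∫ s in Ioo (0 : ℝ) 1, z.1.2.rem k s * adjOp k φ s} := by
    ext ⟨⟨⟨R, px, py⟩, u⟩, f, g⟩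
    refine forall_congr' fun k => ?_
    obtain ⟨e, e₂, h1, h2, -, -⟩ := u.exists_hasD hm
    have hL : LocInt1 fun s => ((s ^ (1 / 2 : ℝ) : ℝ) : ℂ) * f.1.rem k s :=
      (f.1.reg_rem.base.1 k).locInt1.rpow_mul _
    have hw := hasD_iff_integral (k := k) (h1 k) (h2 k) hL
    have hcomm : ∀ φ : ℝ → ℂ, ∫ s in Ioo (0 : ℝ) 1, ((s ^ (1 / 2 : ℝ) : ℝ) : ℂ) * f.1.rem k s * φ s =
        ∫ s in Ioo (0 : ℝ) 1, f.1.rem k s * (((s ^ (1 / 2 : ℝ) : ℝ) : ℂ) * φ s) := fun φ => by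
      refine integral_congr_ae (Filter.Eventually.of_forall fun s => ?_)
      ring
    simp only [hcomm] at hw
    constructor
    · rintro ⟨a1, e', a2, a3, a4⟩
      refine ⟨⟨a1, a4.trans ?_⟩, hw.1 ?_⟩
      · rw [hΛ k u.snd e' a2]
        rfl
      · have a5 := a2.unique (h1 k)
        refine a3.congr a5 ?_
        filter_upwards [a5] with s hs
        rw [hs]
    · rintro ⟨⟨a1, a2⟩, a3⟩
      refine ⟨a1, e k, h1 k, hw.2 a3, a2.trans ?_⟩
      rw [hΛ k u.snd (e k) (h1 k)]
      rfl
  rw [key]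
  simp only [Set.ofPred_forall, Set.ofPred_and]
  have cu : Continuous fun z : ((ℂ × ℂ × ℂ) × J m σ (1 / 2) γ) ×
      (JTilde (m - 2) σ γ × X ((m : ℝ) - 1 / 2) σ) => z.1.2 := by fun_prop
  have cf : Continuous fun z : ((ℂ × ℂ × ℂ) × J m σ (1 / 2) γ) ×
      (JTilde (m - 2) σ γ × X ((m : ℝ) - 1 / 2) σ) => z.2.1.1 := by fun_prop
  have cg : Continuous fun z : ((ℂ × ℂ × ℂ) × J m σ (1 / 2) γ) ×
      (JTilde (m - 2) σ γ × X ((m : ℝ) - 1 / 2) σ) => z.2.2 := by fun_prop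
  refine isClosed_iInter fun k => ((isClosed_eq ?_ ?_).inter (isClosed_eq ?_ ?_)).inter
    (isClosed_iInter fun φ => isClosed_iInter fun hφ => isClosed_eq ?_ ?_)
  · exact (J.continuous_lead k).comp cf
  · exact continuous_const.mul ((J.continuous_lead k).comp cu)
  · exact (X.continuous_fourierCoeff k).comp cg
  · refine Continuous.add ?_ (((J.continuous_lead k).comp cu).add
      ((hΛc k).comp (J.continuous_snd.comp cu)))
    simp only [pressure]
    split_ifs <;> fun_prop
  · exact (J.continuous_integral_rem k (hφ.rpow_mul _)).comp cf
  · exact (J.continuous_integral_rem k (hφ.adjOp k)).comp cu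

end Existence

/-- A subspace that is a graph over both factors is the graph of a linear bijection. The closed
graph theorem bounds it, and Banach's theorem bounds its inverse. -/
theorem exists_continuousLinearEquiv_of_graph {E F : Type*} [NormedAddCommGroup E]
    [NormedSpace ℂ E] [CompleteSpace E] [NormedAddCommGroup F] [NormedSpace ℂ F] [CompleteSpace F]
    (G : Submodule ℂ (E × F)) (hG : IsClosed (G : Set (E × F))) (h1 : ∀ x, ∃! y, (x, y) ∈ G)
    (h2 : ∀ y, ∃! x, (x, y) ∈ G) : ∃ T : E ≃L[ℂ] F, ∀ x y, T x = y ↔ (x, y) ∈ G := by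
  have hG₁ : Function.Bijective (Prod.fst ∘ G.subtype) := by
    refine ⟨fun a b hab => ?_, fun x => ?_⟩
    · obtain ⟨⟨x, y⟩, ha⟩ := a
      obtain ⟨⟨x', y'⟩, hb⟩ := b
      obtain rfl : x = x' := hab
      obtain rfl : y = y' := (h1 x).unique ha hb
      rfl
    · obtain ⟨y, hy, -⟩ := h1 x
      exact ⟨⟨(x, y), hy⟩, rfl⟩
  have hG₂ : Function.Bijective (Prod.snd ∘ G.subtype) := by
    refine ⟨fun a b hab => ?_, fun y => ?_⟩
    · obtain ⟨⟨x, y⟩, ha⟩ := a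
      obtain ⟨⟨x', y'⟩, hb⟩ := b
      obtain rfl : y = y' := hab
      obtain rfl : x = x' := (h2 y).unique ha hb
      rfl
    · obtain ⟨x, hx, -⟩ := h2 y
      exact ⟨⟨(x, y), hx⟩, rfl⟩
  obtain ⟨e, he⟩ := Submodule.exists_equiv_eq_graph hG₁ hG₂
  have hc : Continuous e.toLinearMap := by
    refine LinearMap.continuous_of_isClosed_graph (g := e.toLinearMap) ?_
    rwa [← he]
  refine ⟨e.toContinuousLinearEquivOfContinuous hc, fun x y => ?_⟩
  rw [he, LinearMap.mem_graph_iff]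
  exact eq_comm

end FlowLines

end

theorem mainTheorem3 (m : ℕ) (hm : 2 ≤ m) (σ : ℝ) (hσ : 0 < σ) (γ : ℝ) (hγ : 1 / 2 < γ)
    (hγ' : γ < 1) :
    CompleteSpace (FlowLines.J m σ (1 / 2) γ) ∧
    CompleteSpace (FlowLines.JTilde (m - 2) σ γ) ∧
    CompleteSpace (FlowLines.X ((m : ℝ) - 1 / 2) σ) ∧
    (∀ u u' : FlowLines.J m σ (1 / 2) γ,
      u.toFun =ᵐ[FlowLines.piMeasure] u'.toFun → u = u') ∧
    (∀ f f' : FlowLines.J (m - 2) σ 0 γ,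
      f.toFun =ᵐ[FlowLines.piMeasure] f'.toFun → f = f') ∧
    ∃ T : ((ℂ × ℂ × ℂ) × FlowLines.J m σ (1 / 2) γ) ≃L[ℂ]
        (FlowLines.JTilde (m - 2) σ γ × FlowLines.X ((m : ℝ) - 1 / 2) σ),
      ∀ (R px py : ℂ) (u : FlowLines.J m σ (1 / 2) γ) (f : FlowLines.JTilde (m - 2) σ γ)
        (g : FlowLines.X ((m : ℝ) - 1 / 2) σ),
        T ((R, px, py), u) = (f, g) ↔
          FlowLines.SolvesInterior u.toFun f.1.toFun ∧
            FlowLines.SolvesBoundary R px py u.toFun g.toFun := by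
  have hm' : (2 : ℝ) ≤ m := by exact_mod_cast hm
  have hγ0 : 0 ≤ γ := by linarith
  have i1 : CompleteSpace (FlowLines.J m σ (1 / 2) γ) := FlowLines.J.completeSpace hσ.le
  have i2 : CompleteSpace (FlowLines.JTilde (m - 2) σ γ) := FlowLines.JTilde.completeSpace hσ.le
  have i3 : CompleteSpace (FlowLines.X ((m : ℝ) - 1 / 2) σ) :=
    FlowLines.X.completeSpace (by linarith) hσ.le
  refine ⟨i1, i2, i3, fun u u' h => FlowLines.J.eq_of_toFun_ae_eq hγ.le h,
    fun f f' h => FlowLines.J.eq_of_toFun_ae_eq hγ.le h, ?_⟩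
  refine Exists.imp (fun T hT R px py u f g => (hT _ _).trans
    (FlowLines.solvesModes_iff hm hσ hγ.le)) (FlowLines.exists_continuousLinearEquiv_of_graph
      (FlowLines.problemGraph σ γ hm hγ0) (FlowLines.isClosed_problemGraph hm hγ0) ?_ ?_)
  · rintro ⟨⟨R, px, py⟩, u⟩
    obtain ⟨f, g, h⟩ := FlowLines.exists_image hm hσ.le hγ0 R px py u
    refine ⟨(f, g), h, ?_⟩
    rintro ⟨f', g'⟩ h'
    obtain ⟨a1, a2⟩ := FlowLines.SolvesModes.unique_right h' h
    exact Prod.ext (Subtype.ext a1) a2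
  · rintro ⟨f, g⟩
    obtain ⟨R, px, py, u, h⟩ := FlowLines.exists_preimage hm hσ.le hγ hγ' f g
    refine ⟨((R, px, py), u), h, fun x hx => ?_⟩
    -- By linearity the difference of two preimages solves the problem with zero data, which reduces
    -- uniqueness to injectivity.
    have h0 := (FlowLines.problemGraph σ γ hm hγ0).sub_mem hx
      (show (((R, px, py), u), (f, g)) ∈ FlowLines.problemGraph σ γ hm hγ0 from h)
    rw [Prod.mk_sub_mk, sub_self] at h0
    obtain ⟨b1, b2, b3, b4⟩ := FlowLines.SolvesModes.eq_zero hm hγ hγ' h0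
    exact Prod.ext (Prod.ext (sub_eq_zero.1 b1) (Prod.ext (sub_eq_zero.1 b2) (sub_eq_zero.1 b3)))
      (sub_eq_zero.1 b4)
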